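/- Let $n\ge 2$, let $\Omega=\{x\in\mathbb{R}^n : x_1^2+\dots+x_{n-1}^2<x_n^2\}$ be the open double cone, $X=\overline\Omega$ (with Lebesgue measure; $\partial\Omega$ is a null set), and $r(x)=|x|$. For $1\le p\le\infty$ let $W^1_p(\Omega)$ be the space of real functions $f\in L^p(\Omega)$ whose distributional gradient on $\Omega$ belongs to $L^p(\Omega)$, with norm $\|f\|_{W^1_p(\Omega)}=\|f\|_{L^p(\Omega)}+\|\,|\nabla f|\,\|_{L^p(\Omega)}$. Let $H^1_p(X)$ be, for $p<\infty$, the completion for this norm (that is, the closure in $W^1_p(\Omega)$) of the space of Lipschitz functions on $X$ with compact support, and for $p=\infty$ the space $\operatorname{Lip}(X)\cap L^\infty(X)$, again with the norm of $W^1_\infty(\Omega)$. Set $$\widetilde H^1_p(X)=\{f\in H^1_p(X) : f/r\in L^p(X)\},\qquad \|f\|_{\widetilde H^1_p(X)}=\|f\|_{W^1_p(\Omega)}+\|f/r\|_{L^p(\Omega)}.$$ **Theorem.** The family $(\widetilde H^1_p(X))_{1\le p\le\infty}$ is a scale of interpolation spaces for the real interpolation method: if $1\le p_0<p_1\le\infty$,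 $0<\theta<1$ and $\frac1p=\frac{1-\theta}{p_0}+\frac{\theta}{p_1}$, then $$\bigl(\widetilde H^1_{p_0}(X),\widetilde H^1_{p_1}(X)\bigr)_{\theta,p}=\widetilde H^1_p(X)$$ with equivalent norms, the constants depending only on $n,p_0,p_1,\theta$. In particular, $(\widetilde H^1_1(X),\widetilde H^1_\infty(X))_{1-1/p,\,p}=\widetilde H^1_p(X)$ with equivalent norms for $1<p<\infty$. Here $(A_0,A_1)_{\theta,p}$ is the space of all $f\in A_0+A_1$ for which the norm $\bigl(\int_0^\infty (t^{-\theta}K(t,f))^p\,\frac{dt}{t}\bigr)^{1/p}$ is finite, where $K(t,f)=\inf\{\|a_0\|_{A_0}+t\|a_1\|_{A_1} : f=a_0+a_1,\ a_0\in A_0,\ a_1\in A_1\}$. -/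

import Mathlib

open MeasureTheory Set
open scoped ENNReal NNReal ContDiff

noncomputable section

/-- The double cone `x₁² + ⋯ + x_{n-1}² < x_n²` in `ℝⁿ`, where `n = m + 1`. -/
def doubleCone (m : ℕ) : Set (EuclideanSpace ℝ (Fin (m + 1))) :=
  {x | ∑ i : Fin m, x i.castSucc ^ 2 < x (Fin.last m) ^ 2}

/-- `G` is the distributional gradient of `f` in the open set `O`: both are locally integrable
on `O`, and `∫_O f ∂_v φ = - ∫_O ⟨G, v⟩ φ` for all directions `v` and all smooth `φ` with compact
support in `O`. -/
def HasWeakGradient {n : ℕ} (O : Set (EuclideanSpace ℝ (Fin n)))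
    (f : EuclideanSpace ℝ (Fin n) → ℝ)
    (G : EuclideanSpace ℝ (Fin n) → EuclideanSpace ℝ (Fin n)) : Prop :=
  LocallyIntegrableOn f O ∧ LocallyIntegrableOn G O ∧
    ∀ φ : EuclideanSpace ℝ (Fin n) → ℝ, ContDiff ℝ ∞ φ → HasCompactSupport φ → tsupport φ ⊆ O →
      ∀ v : EuclideanSpace ℝ (Fin n),
        ∫ x in O, f x * fderiv ℝ φ x v = -∫ x in O, inner ℝ (G x) v * φ x

/-- Membership in the Sobolev space `W¹_p(O)`: `f ∈ L^p(O)` with distributional gradient in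
`L^p(O)`. -/
def MemSobolev {n : ℕ} (O : Set (EuclideanSpace ℝ (Fin n))) (p : ℝ≥0∞)
    (f : EuclideanSpace ℝ (Fin n) → ℝ) : Prop :=
  MemLp f p (volume.restrict O) ∧
    ∃ G, HasWeakGradient O f G ∧ MemLp G p (volume.restrict O)

/-- The norm `‖f‖_{L^p(O)} + ‖∇f‖_{L^p(O)}` of `W¹_p(O)`. The distributional gradient is unique up
to null sets when it exists, so that the infimum is over a single value; it is `∞` when there is
no distributional gradient. -/
def sobolevNorm {n : ℕ} (O : Set (EuclideanSpace ℝ (Fin n))) (p : ℝ≥0∞)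
    (f : EuclideanSpace ℝ (Fin n) → ℝ) : ℝ≥0∞ :=
  eLpNorm f p (volume.restrict O) +
    ⨅ (G : EuclideanSpace ℝ (Fin n) → EuclideanSpace ℝ (Fin n)) (_ : HasWeakGradient O f G),
      eLpNorm G p (volume.restrict O)

/-- Measurable real functions on the double cone `Ω`, modulo equality almost everywhere. As the
boundary of `Ω` is a null set, these are also the classes of functions on `X = closure Ω`. -/
abbrev ConeFun (m : ℕ) : Type :=
  EuclideanSpace ℝ (Fin (m + 1)) →ₘ[volume.restrict (doubleCone m)] ℝ

/-- The (classes of) Lipschitz functions on `X = closure Ω`. -/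
def coneLip (m : ℕ) : Set (ConeFun m) :=
  {f | ∃ (K : ℝ≥0) (u : EuclideanSpace ℝ (Fin (m + 1)) → ℝ),
    LipschitzOnWith K u (closure (doubleCone m)) ∧
    f =ᵐ[volume.restrict (doubleCone m)] u}

/-- The (classes of) Lipschitz functions on `X = closure Ω` with compact support in `X`. -/
def coneLipCompact (m : ℕ) : Set (ConeFun m) :=
  {f | ∃ (K : ℝ≥0) (u : EuclideanSpace ℝ (Fin (m + 1)) → ℝ),
    LipschitzOnWith K u (closure (doubleCone m)) ∧
    (∃ S, IsCompact S ∧ ∀ x ∈ closure (doubleCone m), x ∉ S → u x = 0) ∧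
    f =ᵐ[volume.restrict (doubleCone m)] u}

/-- The space `H¹_p(X)`. For `p < ∞` it is the completion of the compactly supported Lipschitz
functions on `X` for the norm of `W¹_p(Ω)`, realized as their closure in the Banach space
`W¹_p(Ω)`; for `p = ∞` it is `Lip(X) ∩ L^∞(X)`. In both cases its norm is that of `W¹_p(Ω)`. -/
def coneH (m : ℕ) (p : ℝ≥0∞) : Set (ConeFun m) :=
  {f | (p < ⊤ ∧ MemSobolev (doubleCone m) p f ∧
      ∀ ε : ℝ≥0∞, 0 < ε → ∃ g ∈ coneLipCompact m, sobolevNorm (doubleCone m) p ⇑(f - g) < ε) ∨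
    (p = ⊤ ∧ f ∈ coneLip m ∧ MemLp f ⊤ (volume.restrict (doubleCone m)))}

/-- The space `{f ∈ H¹_p(X) : f / r ∈ L^p(X)}`, where `r(x) = |x|`. -/
def coneHTilde (m : ℕ) (p : ℝ≥0∞) : Set (ConeFun m) :=
  {f | f ∈ coneH m p ∧ MemLp (fun x => f x / ‖x‖) p (volume.restrict (doubleCone m))}

/-- The norm `‖f‖_{W¹_p(Ω)} + ‖f / r‖_{L^p(Ω)}`. -/
def coneHTildeNorm (m : ℕ) (p : ℝ≥0∞) (f : ConeFun m) : ℝ≥0∞ :=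
  sobolevNorm (doubleCone m) p f +
    eLpNorm (fun x => f x / ‖x‖) p (volume.restrict (doubleCone m))

/-- The `K`-functional `K(t, f) = inf {N₀ a₀ + t N₁ a₁ : f = a₀ + a₁, a₀ ∈ A₀, a₁ ∈ A₁}` of two
subspaces `A₀`, `A₁` of a common vector space with norms `N₀`, `N₁`. -/
def kFunctional {V : Type*} [AddCommGroup V] (A₀ A₁ : Set V) (N₀ N₁ : V → ℝ≥0∞) (t : ℝ) (f : V) :
    ℝ≥0∞ :=
  ⨅ (a₀ ∈ A₀) (a₁ ∈ A₁) (_ : f = a₀ + a₁), N₀ a₀ + ENNReal.ofReal t * N₁ a₁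

/-- The norm of the real interpolation space `(A₀, A₁)_{θ,q}`: the `L^q` norm of `t^{-θ} K(t, f)` on
`(0, ∞)` with respect to the measure `dt / t`. -/
def realInterpNorm {V : Type*} [AddCommGroup V] (A₀ A₁ : Set V) (N₀ N₁ : V → ℝ≥0∞) (θ : ℝ)
    (q : ℝ≥0∞) (f : V) : ℝ≥0∞ :=
  eLpNorm (fun t : ℝ => ENNReal.ofReal (t ^ (-θ)) * kFunctional A₀ A₁ N₀ N₁ t f) q
    ((volume.restrict (Ioi 0)).withDensity fun t : ℝ => ENNReal.ofReal t⁻¹)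

/-- The real interpolation space `(A₀, A₁)_{θ,q}`: the elements of `A₀ + A₁` of finite norm. -/
def realInterpSpace {V : Type*} [AddCommGroup V] (A₀ A₁ : Set V) (N₀ N₁ : V → ℝ≥0∞) (θ : ℝ)
    (q : ℝ≥0∞) : Set V :=
  {f | (∃ a₀ ∈ A₀, ∃ a₁ ∈ A₁, f = a₀ + a₁) ∧ realInterpNorm A₀ A₁ N₀ N₁ θ q f < ⊤}

end

/-!
The space for the exponent `p` is described by the integrability of one function: if `f` has the
distributional gradient `G`, set `F = |f| + |f| / r + |G|` (`coneSize`). Its `L^p` norm is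
equivalent to the norm of `f`, and for `p < ∞` its finiteness already implies that `f` is a limit
of compactly supported Lipschitz functions (`mem_coneHTilde_of_eLpNorm_coneSize_lt_top`). The
theorem therefore amounts to the comparison of the `K`-functional of `f` with that of `F` for the
couple of Lebesgue spaces.

The `K`-functional is bounded from below by the decreasing rearrangement: a decomposition
`f = f₀ + f₁` gives `F ≤ F₀ + F₁` almost everywhere, hence `F*(2 s) ≤ F₀*(s) + F₁*(s)`, and
Chebyshev's inequality bounds the right side by the norms of `f₀` and `f₁`
(`mul_decRearr_le_kFunctional`). With `s` a power of `t`, the norm of the interpolation space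
becomes the `L^p` norm of `F*`, that is, of `F`.

The bound from above rests on Lipschitz truncation (`exists_truncation_eLpNorm_le`). Let `U` be the
set where `F` or one of its averages over centered balls exceeds a height `l`. Off `U`, the function
`f` coincides with a function `g` which is Lipschitz with constant `C l` and satisfies
`|g| ≤ l min(1, r)`:

* within one of the two components of the cone, which is a convex cone, two points `x` and `y` are
  compared with the mean of `f` over a ball of radius `|x - y|` which both of them see through
  segments in the component (`enorm_sub_le_of_lintegral_closedBall_le`);
* points of different components form an obtuse angle at the vertex, so that `|x|` and `|y|` are at
  most `|x - y|`, and `|f| ≤ l r` gives the Lipschitz bound. This is where the weight `1 / r`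
  enters, which connects the two components.

The gradients of `f` and `g` coincide almost everywhere off `U`, as the gradient vanishes on level
sets. By the weak type estimate, `f - g` is controlled in `L^{p₀}` by the part of `F` above `l / 2`,
and `g` in `L^{p₁}` by `min(F, l)` and `|U|`. Taking for `l` the height `F*(s)` bounds the
`K`-functional by `F*` alone (`exists_kFunctional_le_decRearr`), and summation over dyadic
dilations of `F*` bounds the interpolation norm (`exists_eLpNorm_le_of_le_decRearr`).
-/

/-! ### Maximal function bounds -/

/-- The weak type estimate for the Hardy–Littlewood maximal function, in the refined form in which
only the large values of `F` contribute. The set `U` contains every point at which `F`, or one of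
its averages over centered balls, exceeds `l`. -/
theorem exists_measurableSet_forall_notMem_lintegral_closedBall_le {E : Type*}
    [NormedAddCommGroup E] [NormedSpace ℝ E] [FiniteDimensional ℝ E] [Nontrivial E]
    [MeasurableSpace E] [BorelSpace E] (μ : Measure E) [μ.IsAddHaarMeasure] {F : E → ℝ≥0∞}
    (hF : Measurable F) {l : ℝ≥0∞} (hl : l ≠ 0) (hl' : l ≠ ⊤) :
    ∃ U : Set E, MeasurableSet U ∧
      l * μ U ≤ (2 * 5 ^ Module.finrank ℝ E + 1) * ∫⁻ x in {x | l / 2 < F x}, F x ∂μ ∧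
      ∀ x ∉ U, F x ≤ l ∧ ∀ r > 0, ∫⁻ y in Metric.closedBall x r, F y ∂μ
        ≤ l * μ (Metric.closedBall x r) := by
  set A : Set E := {x | l / 2 < F x} with hA
  have hAm : MeasurableSet A := measurableSet_lt measurable_const hF
  set I := ∫⁻ x in A, F x ∂μ with hI
  have hl2 : l / 2 ≤ l := ENNReal.half_le_self
  by_cases hItop : I = ⊤
  · refine ⟨univ, MeasurableSet.univ, ?_, fun x hx => absurd (mem_univ x) hx⟩
    rw [hItop, ENNReal.mul_top (by simp)]
    exact le_top
  set n := Module.finrank ℝ E with hn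
  have hn0 : n ≠ 0 := Module.finrank_pos.ne'
  set T : Set (E × ℝ) := {q | 0 < q.2 ∧
    l * μ (Metric.closedBall q.1 q.2) < ∫⁻ y in Metric.closedBall q.1 q.2, F y ∂μ} with hT
  -- on a bad ball, the large values of `F` carry at least half of the integral
  have hball : ∀ q ∈ T, l * μ (Metric.closedBall q.1 q.2)
      ≤ 2 * ∫⁻ y in Metric.closedBall q.1 q.2 ∩ A, F y ∂μ := by
    rintro ⟨x, r⟩ ⟨hr, hq⟩
    simp only at hr hq ⊢
    set B := Metric.closedBall x r
    have h1 : ∫⁻ y in B, F y ∂μ ≤ ∫⁻ y in B ∩ A, F y ∂μ + l / 2 * μ B := by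
      rw [← lintegral_inter_add_sdiff F B hAm]
      gcongr
      calc ∫⁻ y in B \ A, F y ∂μ ≤ ∫⁻ y in B \ A, l / 2 ∂μ := by
            apply setLIntegral_mono measurable_const
            intro y hy
            simpa [hA] using hy.2
        _ = l / 2 * μ (B \ A) := by simp
        _ ≤ l / 2 * μ B := by gcongr; exact sdiff_subset
    have hBfin : l / 2 * μ B ≠ ⊤ :=
      ENNReal.mul_ne_top (ENNReal.div_ne_top hl' (by simp)) measure_closedBall_lt_top.ne
    have h2 : l / 2 * μ B + l / 2 * μ B ≤ ∫⁻ y in B ∩ A, F y ∂μ + l / 2 * μ B := by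
      rw [← add_mul, ENNReal.add_halves]
      exact hq.le.trans h1
    have h3 := (ENNReal.add_le_add_iff_right hBfin).1 h2
    calc l * μ B = 2 * (l / 2 * μ B) := by
          rw [← mul_assoc, ENNReal.mul_div_cancel (by simp) (by simp)]
      _ ≤ _ := by gcongr
  have hc0 : μ (Metric.ball (0 : E) 1) ≠ 0 := (Metric.measure_ball_pos μ 0 one_pos).ne'
  have hctop : μ (Metric.ball (0 : E) 1) ≠ ⊤ := measure_ball_lt_top.ne
  -- the radii of the bad balls are bounded, as the covering theorem requires
  have hRad : ∃ R : ℝ, ∀ q ∈ T, q.2 ≤ R := by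
    set D := 2 * I / (l * μ (Metric.ball (0 : E) 1)) with hD
    have hDtop : D ≠ ⊤ := ENNReal.div_ne_top (ENNReal.mul_ne_top (by simp) hItop)
      (mul_ne_zero hl hc0)
    refine ⟨max 1 D.toReal, fun q hq => ?_⟩
    have h1 := (hball q hq).trans (mul_le_mul_right (lintegral_mono_set inter_subset_right) 2)
    rw [Measure.addHaar_closedBall μ _ hq.1.le] at h1
    have h2 : ENNReal.ofReal (q.2 ^ n) ≤ D := by
      rw [hD, ENNReal.le_div_iff_mul_le (Or.inl (mul_ne_zero hl hc0))
        (Or.inl (ENNReal.mul_ne_top hl' hctop))]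
      calc _ = l * (ENNReal.ofReal (q.2 ^ n) * μ (Metric.ball (0 : E) 1)) := by ring
        _ ≤ _ := h1
    rcases le_total q.2 1 with h | h
    · exact h.trans (le_max_left _ _)
    · exact (le_self_pow₀ h hn0).trans
        (((ENNReal.ofReal_le_iff_le_toReal hDtop).1 h2).trans (le_max_right _ _))
  obtain ⟨R, hR⟩ := hRad
  obtain ⟨u, huT, hdis, hcov⟩ := Vitali.exists_disjoint_subfamily_covering_enlargement_closedBall
    T (fun q : E × ℝ => q.1) (fun q => q.2) R hR 5 (by norm_num)
  have hucount : u.Countable := by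
    refine hdis.countable_of_nonempty_interior fun q hq => ⟨q.1, ?_⟩
    exact Metric.ball_subset_interior_closedBall (Metric.mem_ball_self (huT hq).1)
  refine ⟨(⋃ q ∈ u, Metric.closedBall q.1 (5 * q.2)) ∪ {x | l < F x}, ?_, ?_, ?_⟩
  · exact (MeasurableSet.biUnion hucount fun q _ => Metric.isClosed_closedBall.measurableSet).union
      (measurableSet_lt measurable_const hF)
  · have h1 : l * μ (⋃ q ∈ u, Metric.closedBall q.1 (5 * q.2)) ≤ 2 * 5 ^ n * I := by
      calc l * μ (⋃ q ∈ u, Metric.closedBall q.1 (5 * q.2))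
          ≤ l * ∑' q : u, μ (Metric.closedBall q.1.1 (5 * q.1.2)) := by
            gcongr; exact measure_biUnion_le μ hucount _
        _ = ∑' q : u, 5 ^ n * (l * μ (Metric.closedBall q.1.1 q.1.2)) := by
            rw [← ENNReal.tsum_mul_left]
            refine tsum_congr fun q => ?_
            have hq := (huT q.2).1.le
            rw [Measure.addHaar_closedBall μ _ hq, Measure.addHaar_closedBall μ _ (by positivity),
              mul_pow, ENNReal.ofReal_mul (by positivity), ENNReal.ofReal_pow (by norm_num)]
            simp only [ENNReal.ofReal_ofNat]
            ring
        _ ≤ ∑' q : u, 5 ^ n * (2 * ∫⁻ y in Metric.closedBall q.1.1 q.1.2 ∩ A, F y ∂μ) := by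
            exact ENNReal.tsum_le_tsum fun q => mul_le_mul_right (hball q.1 (huT q.2)) _
        _ = 2 * 5 ^ n * ∑' q : u, ∫⁻ y in Metric.closedBall q.1.1 q.1.2 ∩ A, F y ∂μ := by
            rw [← ENNReal.tsum_mul_left]
            exact tsum_congr fun q => by ring
        _ = 2 * 5 ^ n * ∫⁻ y in ⋃ q ∈ u, (Metric.closedBall q.1 q.2 ∩ A), F y ∂μ := by
            rw [lintegral_biUnion hucount
              (fun q _ => Metric.isClosed_closedBall.measurableSet.inter hAm)
              (hdis.mono fun q => inter_subset_left)]
        _ ≤ 2 * 5 ^ n * I := by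
            gcongr; exact lintegral_mono_set (iUnion₂_subset fun q _ => inter_subset_right)
    have h2 : l * μ {x | l < F x} ≤ I := by
      calc l * μ {x | l < F x} = ∫⁻ x in {x | l < F x}, l ∂μ := by simp
        _ ≤ ∫⁻ x in {x | l < F x}, F x ∂μ :=
            setLIntegral_mono hF fun x hx => le_of_lt hx
        _ ≤ I := lintegral_mono_set fun x hx => lt_of_le_of_lt hl2 hx
    calc _ ≤ l * (μ (⋃ q ∈ u, Metric.closedBall q.1 (5 * q.2)) + μ {x | l < F x}) := by
          gcongr; exact measure_union_le _ _
      _ ≤ 2 * 5 ^ n * I + I := by rw [mul_add]; exact add_le_add h1 h2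
      _ = _ := by ring
  · intro x hx
    simp only [mem_union, mem_iUnion, mem_ofPred_eq, not_or, not_lt] at hx
    refine ⟨hx.2, fun r hr => ?_⟩
    by_contra! hlt
    obtain ⟨b, hb, hsub⟩ := hcov (x, r) ⟨hr, hlt⟩
    exact hx.1 ⟨b, hb, hsub (Metric.mem_closedBall_self hr.le)⟩

/-- The `L^q` form of the weak type estimate, with the same bad set for all `q`. -/
theorem exists_measurableSet_rpow_measure_le {E : Type*}
    [NormedAddCommGroup E] [NormedSpace ℝ E] [FiniteDimensional ℝ E] [Nontrivial E]
    [MeasurableSpace E] [BorelSpace E] (μ : Measure E) [μ.IsAddHaarMeasure] {F : E → ℝ≥0∞}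
    (hF : Measurable F) {l : ℝ≥0∞} (hl : l ≠ 0) (hl' : l ≠ ⊤) :
    ∃ U : Set E, MeasurableSet U ∧
      (∀ q : ℝ, 1 ≤ q → l * μ U ^ q⁻¹ ≤ (2 * (2 * 5 ^ Module.finrank ℝ E + 1)) *
        (∫⁻ x in {x | l / 2 < F x}, F x ^ q ∂μ) ^ q⁻¹) ∧
      ∀ x ∉ U, F x ≤ l ∧ ∀ r > 0, ∫⁻ y in Metric.closedBall x r, F y ∂μ
        ≤ l * μ (Metric.closedBall x r) := by
  obtain ⟨U, hU, hmU, hUx⟩ :=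
    exists_measurableSet_forall_notMem_lintegral_closedBall_le μ hF hl hl'
  refine ⟨U, hU, fun q hq => ?_, hUx⟩
  have hAm : MeasurableSet {x | l / 2 < F x} := measurableSet_lt measurable_const hF
  set D : ℝ≥0∞ := 2 * 5 ^ Module.finrank ℝ E + 1 with hD
  have hD1 : 1 ≤ D := by simp [hD]
  have hq0 : 0 < q := by linarith
  have hk0 : l / 2 ≠ 0 := (ENNReal.half_pos hl).ne'
  have hktop : l / 2 ≠ ⊤ := ENNReal.div_ne_top hl' (by simp)
  -- `(l / 2) ^ (q - 1) * F ≤ F ^ q` where `F` exceeds `l / 2`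
  have h1 : (l / 2) ^ (q - 1) * ∫⁻ x in {x | l / 2 < F x}, F x ∂μ
      ≤ ∫⁻ x in {x | l / 2 < F x}, F x ^ q ∂μ := by
    rw [← lintegral_const_mul _ hF]
    refine setLIntegral_mono (hF.pow_const _) fun x hx => ?_
    have hx' : l / 2 < F x := hx
    have h0 : F x ≠ 0 := (lt_of_le_of_lt zero_le hx').ne'
    calc (l / 2) ^ (q - 1) * F x ≤ F x ^ (q - 1) * F x := by gcongr
      _ = F x ^ q := by
        by_cases ht : F x = ⊤
        · rcases hq.eq_or_lt with rfl | hq1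
          · simp
          · rw [ht, ENNReal.top_rpow_of_pos (by linarith), ENNReal.top_rpow_of_pos hq0]; simp
        · conv_lhs => rw [← ENNReal.rpow_one (F x), ← ENNReal.rpow_mul, one_mul]
          rw [← ENNReal.rpow_add _ _ h0 ht]; simp
  have h2 : (l / 2) ^ q * μ U ≤ D * ∫⁻ x in {x | l / 2 < F x}, F x ^ q ∂μ := by
    calc (l / 2) ^ q * μ U = (l / 2) ^ (q - 1) * (l / 2 * μ U) := by
          rw [← mul_assoc]
          congr 1
          conv_rhs => enter [2]; rw [← ENNReal.rpow_one (l / 2)]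
          rw [← ENNReal.rpow_add _ _ hk0 hktop]; simp
      _ ≤ (l / 2) ^ (q - 1) * (D * ∫⁻ x in {x | l / 2 < F x}, F x ∂μ) := by
          exact mul_le_mul_right ((mul_le_mul_left ENNReal.half_le_self _).trans hmU) _
      _ = D * ((l / 2) ^ (q - 1) * ∫⁻ x in {x | l / 2 < F x}, F x ∂μ) := by ring
      _ ≤ _ := by gcongr
  have hqi : 0 ≤ q⁻¹ := by positivity
  have h3 := ENNReal.rpow_le_rpow h2 hqi
  rw [ENNReal.mul_rpow_of_nonneg _ _ hqi, ENNReal.mul_rpow_of_nonneg _ _ hqi,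
    ENNReal.rpow_rpow_inv hq0.ne'] at h3
  calc l * μ U ^ q⁻¹ = 2 * (l / 2 * μ U ^ q⁻¹) := by
        rw [← mul_assoc, ENNReal.mul_div_cancel (by simp) (by simp)]
    _ ≤ 2 * (D ^ q⁻¹ * (∫⁻ x in {x | l / 2 < F x}, F x ^ q ∂μ) ^ q⁻¹) := by gcongr
    _ ≤ 2 * (D * (∫⁻ x in {x | l / 2 < F x}, F x ^ q ∂μ) ^ q⁻¹) := by
        gcongr
        calc D ^ q⁻¹ ≤ D ^ (1 : ℝ) :=
              ENNReal.rpow_le_rpow_of_exponent_le hD1 (inv_le_one_of_one_le₀ hq)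
          _ = D := by simp
    _ = _ := by ring

/-! ### Weak gradients -/

section WeakGradient

variable {n : ℕ} {O : Set (EuclideanSpace ℝ (Fin n))}

theorem integrableOn_mul_of_tsupport_subset (hO : MeasurableSet O)
    {f ψ : EuclideanSpace ℝ (Fin n) → ℝ} (hf : LocallyIntegrableOn f O) (hψ : Continuous ψ)
    (hc : HasCompactSupport ψ) (hs : tsupport ψ ⊆ O) :
    IntegrableOn (fun x => f x * ψ x) O := by
  have hK : IsCompact (tsupport ψ) := hc
  have h1 : IntegrableOn (fun x => f x * ψ x) (tsupport ψ) :=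
    (hf.integrableOn_compact_subset hs hK).mul_continuousOn hψ.continuousOn hK
  refine h1.of_forall_sdiff_eq_zero hO fun x hx => ?_
  simp [image_eq_zero_of_notMem_tsupport hx.2]

theorem locallyIntegrableOn_inner_right {G : EuclideanSpace ℝ (Fin n) → EuclideanSpace ℝ (Fin n)}
    (hG : LocallyIntegrableOn G O) (v : EuclideanSpace ℝ (Fin n)) :
    LocallyIntegrableOn (fun x => inner ℝ (G x) v) O := by
  have h := (innerSL ℝ v).locallyIntegrableOn_comp hG
  refine h.congr (Filter.Eventually.of_forall fun x => ?_)
  simp [real_inner_comm]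

theorem continuous_fderiv_apply_of_smooth {φ : EuclideanSpace ℝ (Fin n) → ℝ}
    (hφ : ContDiff ℝ ∞ φ) (v : EuclideanSpace ℝ (Fin n)) :
    Continuous fun x => fderiv ℝ φ x v :=
  (hφ.continuous_fderiv (by simp)).clm_apply continuous_const

theorem tsupport_fderiv_apply_subset_tsupport (φ : EuclideanSpace ℝ (Fin n) → ℝ)
    (v : EuclideanSpace ℝ (Fin n)) : tsupport (fun x => fderiv ℝ φ x v) ⊆ tsupport φ := by
  refine closure_minimal (fun x hx => ?_) (isClosed_tsupport φ)
  by_contra h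
  exact hx (by simp [fderiv_of_notMem_tsupport (𝕜 := ℝ) h])

theorem HasCompactSupport.fderiv_apply' {φ : EuclideanSpace ℝ (Fin n) → ℝ}
    (hφ : HasCompactSupport φ) (v : EuclideanSpace ℝ (Fin n)) :
    HasCompactSupport fun x => fderiv ℝ φ x v :=
  hφ.mono' ((subset_tsupport _).trans (tsupport_fderiv_apply_subset_tsupport φ v))

variable {f f' : EuclideanSpace ℝ (Fin n) → ℝ}
  {G G' : EuclideanSpace ℝ (Fin n) → EuclideanSpace ℝ (Fin n)}

theorem HasWeakGradient.congr (h : HasWeakGradient O f G) (hf : f =ᵐ[volume.restrict O] f')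
    (hG : G =ᵐ[volume.restrict O] G') : HasWeakGradient O f' G' := by
  refine ⟨h.1.congr hf, h.2.1.congr hG, fun φ h1 h2 h3 v => ?_⟩
  have e1 : ∫ x in O, f' x * fderiv ℝ φ x v = ∫ x in O, f x * fderiv ℝ φ x v :=
    integral_congr_ae (hf.mono fun x hx => by simp [hx])
  have e2 : ∫ x in O, inner ℝ (G' x) v * φ x = ∫ x in O, inner ℝ (G x) v * φ x :=
    integral_congr_ae (hG.mono fun x hx => by simp [hx])
  rw [e1, e2, h.2.2 φ h1 h2 h3 v]

theorem HasWeakGradient.add (hO : MeasurableSet O) (h : HasWeakGradient O f G)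
    (h' : HasWeakGradient O f' G') : HasWeakGradient O (f + f') (G + G') := by
  refine ⟨h.1.add h'.1, h.2.1.add h'.2.1, fun φ h1 h2 h3 v => ?_⟩
  have c1 := continuous_fderiv_apply_of_smooth h1 v
  have c2 := h2.fderiv_apply' v
  have c3 := (tsupport_fderiv_apply_subset_tsupport φ v).trans h3
  simp only [Pi.add_apply, add_mul, inner_add_left]
  rw [integral_add (integrableOn_mul_of_tsupport_subset hO h.1 c1 c2 c3)
      (integrableOn_mul_of_tsupport_subset hO h'.1 c1 c2 c3),
    integral_add
      (integrableOn_mul_of_tsupport_subset hO (locallyIntegrableOn_inner_right h.2.1 v)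
        h1.continuous h2 h3)
      (integrableOn_mul_of_tsupport_subset hO (locallyIntegrableOn_inner_right h'.2.1 v)
        h1.continuous h2 h3),
    h.2.2 φ h1 h2 h3 v, h'.2.2 φ h1 h2 h3 v]
  ring

theorem HasWeakGradient.neg (h : HasWeakGradient O f G) : HasWeakGradient O (-f) (-G) := by
  refine ⟨h.1.neg, h.2.1.neg, fun φ h1 h2 h3 v => ?_⟩
  simp only [Pi.neg_apply, neg_mul, inner_neg_left, integral_neg]
  rw [h.2.2 φ h1 h2 h3 v]

theorem HasWeakGradient.sub (hO : MeasurableSet O) (h : HasWeakGradient O f G)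
    (h' : HasWeakGradient O f' G') : HasWeakGradient O (f - f') (G - G') := by
  rw [sub_eq_add_neg, sub_eq_add_neg]
  exact h.add hO h'.neg

theorem HasWeakGradient.mono {O' : Set (EuclideanSpace ℝ (Fin n))} (h : HasWeakGradient O f G)
    (hO : O' ⊆ O) : HasWeakGradient O' f G := by
  refine ⟨h.1.mono_set hO, h.2.1.mono_set hO, fun φ h1 h2 h3 v => ?_⟩
  have key : ∀ u ψ : EuclideanSpace ℝ (Fin n) → ℝ, tsupport ψ ⊆ O' →
      ∫ x in O', u x * ψ x = ∫ x in O, u x * ψ x := by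
    intro u ψ hψ
    rw [setIntegral_eq_integral_of_forall_compl_eq_zero,
      setIntegral_eq_integral_of_forall_compl_eq_zero]
    · intro x hx
      simp [image_eq_zero_of_notMem_tsupport fun h => hx (hO (hψ h))]
    · intro x hx
      simp [image_eq_zero_of_notMem_tsupport fun h => hx (hψ h)]
  rw [key _ _ ((tsupport_fderiv_apply_subset_tsupport φ v).trans h3), key _ _ h3,
    h.2.2 φ h1 h2 (h3.trans hO) v]

/-- Uniqueness of the distributional gradient. -/
theorem HasWeakGradient.ae_eq (hO : IsOpen O) (h : HasWeakGradient O f G)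
    (h' : HasWeakGradient O f G') : G =ᵐ[volume.restrict O] G' := by
  have key : ∀ i : Fin n, ∀ᵐ x, x ∈ O →
      inner ℝ ((G - G') x) (EuclideanSpace.basisFun (Fin n) ℝ i) = 0 := by
    intro i
    set v := EuclideanSpace.basisFun (Fin n) ℝ i
    refine hO.ae_eq_zero_of_integral_contDiff_smul_eq_zero
      (locallyIntegrableOn_inner_right (h.2.1.sub h'.2.1) v) fun φ h1 h2 h3 => ?_
    have hd := h.sub hO.measurableSet h'
    have h4 := hd.2.2 φ h1 h2 h3 v
    simp only [sub_self, Pi.zero_apply, zero_mul, integral_zero] at h4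
    rw [← setIntegral_eq_integral_of_forall_compl_eq_zero (s := O)]
    · simp only [smul_eq_mul, mul_comm (φ _)]
      linarith
    · intro x hx
      simp [image_eq_zero_of_notMem_tsupport fun h => hx (h3 h)]
  rw [Filter.EventuallyEq, ae_restrict_iff' hO.measurableSet]
  filter_upwards [ae_all_iff.2 key] with x hx hxO
  have : (G - G') x = 0 := by
    ext i
    have := hx i hxO
    rwa [real_inner_comm, EuclideanSpace.basisFun_inner] at this
  exact sub_eq_zero.1 this

theorem measurable_gradient (g : EuclideanSpace ℝ (Fin n) → ℝ) : Measurable (gradient g) :=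
  (InnerProductSpace.toDual ℝ _).symm.continuous.measurable.comp (measurable_fderiv ℝ g)

theorem LipschitzWith.norm_gradient_le {K : ℝ≥0} {g : EuclideanSpace ℝ (Fin n) → ℝ}
    (hg : LipschitzWith K g) (x : EuclideanSpace ℝ (Fin n)) : ‖gradient g x‖ ≤ K := by
  rw [gradient, LinearIsometryEquiv.norm_map]
  exact norm_fderiv_le_of_lipschitz ℝ hg

/-- The almost everywhere defined gradient of a Lipschitz function is its distributional
gradient. -/
theorem LipschitzWith.hasWeakGradient {K : ℝ≥0} {g : EuclideanSpace ℝ (Fin n) → ℝ}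
    (hg : LipschitzWith K g) (O : Set (EuclideanSpace ℝ (Fin n))) :
    HasWeakGradient O g (gradient g) := by
  have hloc : LocallyIntegrable (gradient g) :=
    (memLp_top_of_bound (measurable_gradient g).aestronglyMeasurable K
      (Filter.Eventually.of_forall hg.norm_gradient_le)).locallyIntegrable le_top
  suffices h : HasWeakGradient univ g (gradient g) from h.mono (subset_univ O)
  refine ⟨hg.continuous.locallyIntegrable.locallyIntegrableOn _, hloc.locallyIntegrableOn _,
    fun φ h1 h2 h3 v => ?_⟩
  obtain ⟨D, hD⟩ := h1.lipschitzWith_of_hasCompactSupport h2 (by simp)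
  have h4 := hg.integral_lineDeriv_mul_eq hD h2 (μ := volume) v
  simp only [Measure.restrict_univ, inner_gradient_left]
  have e1 : ∫ x, lineDeriv ℝ g x v * φ x = ∫ x, fderiv ℝ g x v * φ x := by
    refine integral_congr_ae ?_
    filter_upwards [hg.ae_differentiableAt] with x hx
    simp [hx.lineDeriv_eq_fderiv]
  have e2 : ∫ x, lineDeriv ℝ φ x (-v) * g x = -∫ x, g x * fderiv ℝ φ x v := by
    rw [← integral_neg]
    refine integral_congr_ae (Filter.Eventually.of_forall fun x => ?_)
    simp only [((h1.differentiable (by simp)) x).lineDeriv_eq_fderiv, map_neg]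
    ring
  rw [← e1, h4, e2, neg_neg]

end WeakGradient

/-! ### Difference quotients of weakly differentiable functions -/

section Difference

variable {n : ℕ} {O : Set (EuclideanSpace ℝ (Fin n))}

/-- Joint integrability of the translates of a locally integrable function, for use in Fubini's
theorem. -/
theorem integrable_translate_prod {u : EuclideanSpace ℝ (Fin n) → ℝ} (hu : Measurable u)
    (hloc : LocallyIntegrableOn u O) {h : EuclideanSpace ℝ (Fin n)}
    {K : Set (EuclideanSpace ℝ (Fin n))} (hK : IsCompact K)
    (hKO : ∀ x ∈ K, ∀ s ∈ Icc (0 : ℝ) 1, x + s • h ∈ O) :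
    Integrable (fun p : EuclideanSpace ℝ (Fin n) × ℝ => u (p.1 + p.2 • h))
      ((volume.restrict K).prod (volume.restrict (Ioc (0 : ℝ) 1))) := by
  have hm : Measurable fun p : EuclideanSpace ℝ (Fin n) × ℝ => u (p.1 + p.2 • h) :=
    hu.comp (by fun_prop)
  set K' : Set (EuclideanSpace ℝ (Fin n)) := (fun p : EuclideanSpace ℝ (Fin n) × ℝ =>
    p.1 + p.2 • h) '' (K ×ˢ Icc (0 : ℝ) 1) with hK'
  have hK'c : IsCompact K' := (hK.prod isCompact_Icc).image (by fun_prop)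
  have hK'O : K' ⊆ O := by
    rintro _ ⟨⟨x, s⟩, ⟨hx, hs⟩, rfl⟩
    exact hKO x hx s hs
  refine ⟨hm.aestronglyMeasurable, ?_⟩
  rw [HasFiniteIntegral, lintegral_prod_symm' _ hm.enorm]
  calc ∫⁻ s in Ioc (0 : ℝ) 1, ∫⁻ x in K, ‖u (x + s • h)‖ₑ
      ≤ ∫⁻ s in Ioc (0 : ℝ) 1, ∫⁻ x in K', ‖u x‖ₑ := by
        refine setLIntegral_mono measurable_const fun s hs => ?_
        rw [← lintegral_indicator hK.measurableSet, ← lintegral_indicator hK'c.measurableSet,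
          ← lintegral_add_right_eq_self (fun x => K'.indicator (fun x => ‖u x‖ₑ) x) (s • h)]
        refine lintegral_mono fun x => ?_
        by_cases hx : x ∈ K
        · have : x + s • h ∈ K' := ⟨(x, s), ⟨hx, Ioc_subset_Icc_self hs⟩, rfl⟩
          simp [hx, this]
        · simp [hx]
    _ = ∫⁻ x in K', ‖u x‖ₑ := by simp
    _ < ⊤ := (hloc.integrableOn_compact_subset hK'O hK'c).2

theorem integrable_mul_translate_prod {u ψ : EuclideanSpace ℝ (Fin n) → ℝ}
    (hu : Measurable u) (hloc : LocallyIntegrableOn u O) (hψ : Continuous ψ)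
    (hc : HasCompactSupport ψ) {h : EuclideanSpace ℝ (Fin n)}
    (hKO : ∀ x ∈ tsupport ψ, ∀ s ∈ Icc (0 : ℝ) 1, x + s • h ∈ O) :
    Integrable (fun p : EuclideanSpace ℝ (Fin n) × ℝ => u p.1 * ψ (p.1 - p.2 • h))
      ((volume : Measure (EuclideanSpace ℝ (Fin n))).prod (volume.restrict (Ioc (0 : ℝ) 1))) := by
  set K' : Set (EuclideanSpace ℝ (Fin n)) := (fun p : EuclideanSpace ℝ (Fin n) × ℝ =>
    p.1 + p.2 • h) '' (tsupport ψ ×ˢ Icc (0 : ℝ) 1) with hK'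
  have hK'c : IsCompact K' := (IsCompact.prod hc isCompact_Icc).image (by fun_prop)
  have hK'O : K' ⊆ O := by
    rintro _ ⟨⟨x, s⟩, ⟨hx, hs⟩, rfl⟩
    exact hKO x hx s hs
  obtain ⟨C, hC⟩ := hψ.bounded_above_of_compact_support hc
  have h1 : Integrable (K'.indicator u) :=
    (hloc.integrableOn_compact_subset hK'O hK'c).integrable_indicator hK'c.measurableSet
  have h2 : Integrable (fun _ : ℝ => C) (volume.restrict (Ioc (0 : ℝ) 1)) := integrable_const C
  refine (h1.mul_prod h2).mono
    ((hu.comp measurable_fst).mul (hψ.measurable.comp (by fun_prop))).aestronglyMeasurable ?_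
  have : ∀ᵐ p ∂((volume : Measure (EuclideanSpace ℝ (Fin n))).prod
      (volume.restrict (Ioc (0 : ℝ) 1))), p.2 ∈ Ioc (0 : ℝ) 1 :=
    Measure.quasiMeasurePreserving_snd.ae (ae_restrict_mem measurableSet_Ioc)
  filter_upwards [this] with p hp
  by_cases hx : p.1 - p.2 • h ∈ tsupport ψ
  · have hx' : p.1 ∈ K' := ⟨(p.1 - p.2 • h, p.2), ⟨hx, Ioc_subset_Icc_self hp⟩, by simp⟩
    rw [indicator_of_mem hx', norm_mul, norm_mul]
    gcongr
    exact (hC _).trans (le_abs_self C)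
  · simp only [image_eq_zero_of_notMem_tsupport hx, mul_zero, norm_zero]
    positivity

variable {f : EuclideanSpace ℝ (Fin n) → ℝ}
  {G : EuclideanSpace ℝ (Fin n) → EuclideanSpace ℝ (Fin n)}

/-- A weakly differentiable function is the integral of its gradient along almost every translate
of a segment which keeps the domain invariant. -/
theorem HasWeakGradient.ae_sub_eq_integral (hO : IsOpen O) (hf : Measurable f) (hG : Measurable G)
    (hfG : HasWeakGradient O f G) {h : EuclideanSpace ℝ (Fin n)}
    (hh : ∀ x ∈ O, ∀ s ∈ Icc (0 : ℝ) 1, x + s • h ∈ O) :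
    ∀ᵐ x, x ∈ O → f (x + h) - f x = ∫ s in Ioc (0 : ℝ) 1, inner ℝ (G (x + s • h)) h := by
  set u : EuclideanSpace ℝ (Fin n) → ℝ := fun x => inner ℝ (G x) h with hu
  have hum : Measurable u := hG.inner_const
  have huloc : LocallyIntegrableOn u O := locallyIntegrableOn_inner_right hfG.2.1 h
  have hh1 : ∀ x ∈ O, x + h ∈ O := fun x hx => by simpa using hh x hx 1 (by simp)
  have hloc1 : LocallyIntegrableOn (fun x => f (x + h)) O := by
    rw [locallyIntegrableOn_iff hO.isLocallyClosed]
    intro K hKO hK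
    have h1 : IntegrableOn f ((fun x => x + h) '' K) :=
      hfG.1.integrableOn_compact_subset (by rintro _ ⟨x, hx, rfl⟩; exact hh1 x (hKO hx))
        (hK.image (by fun_prop))
    rwa [(measurePreserving_add_right volume h).integrableOn_image
      (MeasurableEquiv.addRight h).measurableEmbedding] at h1
  have hloc2 : LocallyIntegrableOn (fun x => ∫ s in Ioc (0 : ℝ) 1, u (x + s • h)) O := by
    rw [locallyIntegrableOn_iff hO.isLocallyClosed]
    intro K hKO hK
    exact (integrable_translate_prod hum huloc hK fun x hx => hh x (hKO hx)).integral_prod_left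
  -- tested against `φ`, both sides are integrals of `f` against translates of the derivative of `φ`
  have main := hO.ae_eq_zero_of_integral_contDiff_smul_eq_zero
    ((hloc1.sub hfG.1).sub hloc2) (μ := volume) ?_
  · filter_upwards [main] with x hx hxO
    have := hx hxO
    simpa [sub_eq_zero] using this
  intro φ h1 h2 h3
  have hφc := h1.continuous
  set D : EuclideanSpace ℝ (Fin n) → ℝ := fun x => fderiv ℝ φ x h with hD
  have hDc : Continuous D := continuous_fderiv_apply_of_smooth h1 h
  have hDs : HasCompactSupport D := h2.fderiv_apply' h
  have hDt : tsupport D ⊆ tsupport φ := tsupport_fderiv_apply_subset_tsupport φ h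
  have whole : ∀ w ψ : EuclideanSpace ℝ (Fin n) → ℝ, tsupport ψ ⊆ O →
      ∫ x in O, w x * ψ x = ∫ x, w x * ψ x := fun w ψ hψ =>
    setIntegral_eq_integral_of_forall_compl_eq_zero fun x hx => by
      simp [image_eq_zero_of_notMem_tsupport fun h => hx (hψ h)]
  have int : ∀ w ψ : EuclideanSpace ℝ (Fin n) → ℝ, LocallyIntegrableOn w O → Continuous ψ →
      HasCompactSupport ψ → tsupport ψ ⊆ O → Integrable fun x => w x * ψ x := by
    intro w ψ hw a b c
    refine (integrableOn_iff_integrable_of_support_subset fun x hx => ?_).1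
      (integrableOn_mul_of_tsupport_subset hO.measurableSet hw a b c)
    exact c (subset_tsupport _ (right_ne_zero_of_mul hx))
  -- the translated test functions
  have htest : ∀ s ∈ Icc (0 : ℝ) 1, ContDiff ℝ ∞ (fun x => φ (x - s • h)) ∧
      HasCompactSupport (fun x => φ (x - s • h)) ∧ tsupport (fun x => φ (x - s • h)) ⊆ O := by
    intro s hs
    refine ⟨h1.comp (by fun_prop), h2.comp_homeomorph (Homeomorph.subRight (s • h)), ?_⟩
    have : tsupport (fun x => φ (x - s • h)) ⊆ (fun x => x - s • h) ⁻¹' tsupport φ :=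
      tsupport_comp_subset_preimage φ (by fun_prop)
    intro x hx
    have := hh _ (h3 (this hx)) s hs
    simpa using this
  have e1 : ∫ x, f (x + h) * φ x = ∫ x, f x * φ (x - h) := by
    rw [← integral_add_right_eq_self (fun x => f x * φ (x - h)) h]
    simp
  have ftc : ∀ x, φ (x - h) - φ x = -∫ s in Ioc (0 : ℝ) 1, D (x - s • h) := by
    intro x
    have hder : ∀ s ∈ uIcc (0 : ℝ) 1, HasDerivAt (fun s : ℝ => φ (x - s • h))
        (-D (x - s • h)) s := by
      intro s _
      have hl : HasDerivAt (fun s : ℝ => x - s • h) (-h) s := by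
        simpa using ((hasDerivAt_id s).smul_const h).const_sub x
      have := ((h1.differentiable (by simp)) (x - s • h)).hasFDerivAt.comp_hasDerivAt s hl
      simpa [hD, Function.comp_def] using this
    have := intervalIntegral.integral_eq_sub_of_hasDerivAt hder
      (Continuous.intervalIntegrable (by fun_prop) _ _)
    rw [intervalIntegral.integral_of_le zero_le_one] at this
    rw [← integral_neg, this]
    simp
  have e2 : (∫ x, f x * φ (x - h)) - ∫ x, f x * φ x
      = -∫ s in Ioc (0 : ℝ) 1, ∫ x, f x * D (x - s • h) := by
    have hp := integrable_mul_translate_prod hf hfG.1 hDc hDs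
      fun x hx => hh x (h3 (hDt hx))
    have i1 : Integrable fun x => f x * φ (x - h) := by
      obtain ⟨a, b, c⟩ := htest 1 (by simp)
      simpa using int f _ hfG.1 a.continuous b c
    rw [← integral_integral_swap (f := fun x s => f x * D (x - s • h)) hp, ← integral_neg]
    refine (integral_sub i1 (int f _ hfG.1 hφc h2 h3)).symm.trans ?_
    refine integral_congr_ae (Filter.Eventually.of_forall fun x => ?_)
    simp only
    rw [integral_const_mul, ← mul_sub, ftc]
    ring
  have e3 : ∀ s ∈ Ioc (0 : ℝ) 1, ∫ x, f x * D (x - s • h) = -∫ x, u (x + s • h) * φ x := by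
    intro s hs
    obtain ⟨a, b, c⟩ := htest s (Ioc_subset_Icc_self hs)
    have hw := hfG.2.2 _ a b c h
    have hd : ∀ x, fderiv ℝ (fun x => φ (x - s • h)) x h = D (x - s • h) := by
      intro x
      rw [fderiv_comp_sub]
    rw [whole _ _ c, whole _ _ ((tsupport_fderiv_apply_subset_tsupport _ h).trans c)] at hw
    simp only [hd] at hw
    rw [hw, ← integral_add_right_eq_self (fun x => inner ℝ (G x) h * φ (x - s • h)) (s • h)]
    simp [hu]
  have e4 : ∫ s in Ioc (0 : ℝ) 1, ∫ x, u (x + s • h) * φ x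
      = ∫ x, (∫ s in Ioc (0 : ℝ) 1, u (x + s • h)) * φ x := by
    simp only [← integral_mul_const]
    refine (integral_integral_swap (f := fun x s => u (x + s • h) * φ x) ?_).symm
    obtain ⟨C, hC⟩ := hφc.bounded_above_of_compact_support h2
    have hA := integrable_translate_prod hum huloc h2 fun x hx => hh x (h3 hx)
    have hK := (isClosed_tsupport φ).measurableSet
    have hB : Integrable (fun p : EuclideanSpace ℝ (Fin n) × ℝ => u (p.1 + p.2 • h) * φ p.1)
        ((volume.restrict (tsupport φ)).prod (volume.restrict (Ioc (0 : ℝ) 1))) :=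
      hA.mul_bdd (c := C) (hφc.comp continuous_fst).aestronglyMeasurable
        (Filter.Eventually.of_forall fun p => hC p.1)
    have hr : (volume.restrict (tsupport φ)).prod (volume.restrict (Ioc (0 : ℝ) 1))
        = ((volume : Measure (EuclideanSpace ℝ (Fin n))).prod
          (volume.restrict (Ioc (0 : ℝ) 1))).restrict (tsupport φ ×ˢ univ) := by
      rw [← Measure.prod_restrict, Measure.restrict_univ]
    rw [hr] at hB
    refine (integrableOn_iff_integrable_of_support_subset fun p hp => ?_).1 hB
    exact ⟨subset_tsupport _ (right_ne_zero_of_mul hp), mem_univ _⟩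
  have i1 := int _ _ hloc1 hφc h2 h3
  have i2 := int _ _ hfG.1 hφc h2 h3
  have i3 := int _ _ hloc2 hφc h2 h3
  have e5 : ∫ s in Ioc (0 : ℝ) 1, ∫ x, f x * D (x - s • h)
      = -∫ s in Ioc (0 : ℝ) 1, ∫ x, u (x + s • h) * φ x := by
    rw [← integral_neg]
    exact setIntegral_congr_fun measurableSet_Ioc e3
  calc ∫ x, φ x • (((fun x => f (x + h)) - f) - fun x => ∫ s in Ioc (0 : ℝ) 1, u (x + s • h)) x
      = ∫ x, ((f (x + h) * φ x - f x * φ x) - (∫ s in Ioc (0 : ℝ) 1, u (x + s • h)) * φ x) := by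
        refine integral_congr_ae (Filter.Eventually.of_forall fun x => ?_)
        simp only [Pi.sub_apply, smul_eq_mul]
        ring
    _ = 0 := by
        rw [integral_sub (f := fun x => f (x + h) * φ x - f x * φ x) (i1.sub i2) i3,
          integral_sub i1 i2, e1, e2, e5, e4]
        ring

end Difference

/-! ### The gradient vanishes on level sets -/

section LevelSet

open Filter Topology

variable {n : ℕ} {O : Set (EuclideanSpace ℝ (Fin n))}

/-- Continuity of translations in `L¹`. -/
theorem tendsto_lintegral_enorm_translate_sub {γ : EuclideanSpace ℝ (Fin n) → ℝ}
    (hγ : Integrable γ) :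
    Tendsto (fun v => ∫⁻ x, ‖γ (x + v) - γ x‖ₑ) (𝓝 0) (𝓝 0) := by
  have : Fact ((1 : ℝ≥0∞) ≠ ⊤) := ⟨by simp⟩
  have hmem : MemLp γ 1 volume := memLp_one_iff_integrable.2 hγ
  set g : Lp ℝ 1 (volume : Measure (EuclideanSpace ℝ (Fin n))) := hmem.toLp γ with hg
  have hcont : Continuous fun v : EuclideanSpace ℝ (Fin n) => DomAddAct.mk v +ᵥ g := by fun_prop
  have h0 : Tendsto (fun v : EuclideanSpace ℝ (Fin n) => ‖(DomAddAct.mk v +ᵥ g) - g‖ₑ)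
      (𝓝 0) (𝓝 0) := by
    have : Continuous fun v : EuclideanSpace ℝ (Fin n) => ‖(DomAddAct.mk v +ᵥ g) - g‖ₑ := by
      fun_prop
    have h := this.tendsto 0
    simpa using h
  refine h0.congr fun v => ?_
  rw [Lp.enorm_def, eLpNorm_one_eq_lintegral_enorm]
  refine lintegral_congr_ae ?_
  have hg1 : g =ᵐ[volume] γ := hmem.coeFn_toLp
  have hg2 : ∀ᵐ x, g (x + v) = γ (x + v) :=
    (measurePreserving_add_right volume v).quasiMeasurePreserving.ae hg1
  filter_upwards [Lp.coeFn_sub (DomAddAct.mk v +ᵥ g) g,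
    DomAddAct.vadd_Lp_ae_eq (DomAddAct.mk v) g, hg1, hg2] with x h1 h2 h3 h4
  rw [h1, Pi.sub_apply, h2, h3]
  simp only [Equiv.symm_apply_apply, vadd_eq_add]
  rw [add_comm v x, h4]

variable {f : EuclideanSpace ℝ (Fin n) → ℝ}
  {G : EuclideanSpace ℝ (Fin n) → EuclideanSpace ℝ (Fin n)}

/-- The directional derivative vanishes almost everywhere on a set where the function vanishes: for
most points `x` of the set, `x + ε v` belongs to the set too, so that the mean of the directional
derivative over the segment from `x` to `x + ε v` is zero. -/
theorem HasWeakGradient.ae_inner_eq_zero (hO : IsOpen O)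
    (hf : Measurable f) (hG : Measurable G) (hfG : HasWeakGradient O f G)
    {v : EuclideanSpace ℝ (Fin n)} (hv : ∀ x ∈ O, ∀ s : ℝ, 0 ≤ s → x + s • v ∈ O)
    {A : Set (EuclideanSpace ℝ (Fin n))} (hA : MeasurableSet A)
    (hfA : ∀ᵐ x, x ∈ O → x ∈ A → f x = 0) :
    ∀ᵐ x, x ∈ O → x ∈ A → inner ℝ (G x) v = 0 := by
  have hnull : volume {x | x ∈ O ∧ x ∈ A ∧ inner ℝ (G x) v ≠ 0} = 0 := by
    refine measure_null_of_locally_null _ fun x₀ hx₀ => ?_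
    obtain ⟨ρ', hρ', hball⟩ := Metric.isOpen_iff.1 hO x₀ hx₀.1
    set ρ := ρ' / 3 with hρdef
    have hρ : 0 < ρ := by positivity
    have hB'O : Metric.closedBall x₀ (2 * ρ) ⊆ O :=
      (Metric.closedBall_subset_ball (by linarith)).trans hball
    set B := Metric.closedBall x₀ ρ with hB
    set B' := Metric.closedBall x₀ (2 * ρ) with hB'
    have hBB' : B ⊆ B' := Metric.closedBall_subset_closedBall (by linarith)
    set γ : EuclideanSpace ℝ (Fin n) → ℝ := B'.indicator fun x => inner ℝ (G x) v with hγ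
    have hγm : Measurable γ := hG.inner_const.indicator Metric.isClosed_closedBall.measurableSet
    have hγi : Integrable γ :=
      ((locallyIntegrableOn_inner_right hfG.2.1 v).integrableOn_compact_subset hB'O
        (isCompact_closedBall _ _)).integrable_indicator Metric.isClosed_closedBall.measurableSet
    -- `w` is the quantity to be shown to vanish: the directional derivative on `A`, near `x₀`
    set w := A.indicator γ with hw
    have hwi : Integrable w := hγi.indicator hA
    have hwm : Measurable w := hγm.indicator hA
    have hzero : ∫⁻ x in B, ‖w x‖ₑ = 0 := by
      refine le_antisymm (ENNReal.le_of_forall_pos_le_add fun δ hδ _ => ?_) zero_le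
      have hδ' : (0 : ℝ≥0∞) < (δ / 2 : ℝ≥0) := by
        exact_mod_cast half_pos hδ
      obtain ⟨η, hη, hηw⟩ := Metric.eventually_nhds_iff.1
        (((tendsto_lintegral_enorm_translate_sub hwi).eventually (gt_mem_nhds hδ')).and
          ((tendsto_lintegral_enorm_translate_sub hγi).eventually (gt_mem_nhds hδ')))
      obtain ⟨ε, hε, hε1⟩ : ∃ ε > 0, ε * ‖v‖ < min η ρ := by
        refine ⟨min η ρ / (‖v‖ + 1), by positivity, ?_⟩
        rw [div_mul_eq_mul_div, div_lt_iff₀ (by positivity)]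
        have : 0 < min η ρ := lt_min hη hρ
        nlinarith [norm_nonneg v]
      have hnorm : ∀ s ∈ Icc (0 : ℝ) 1, ‖s • ε • v‖ < min η ρ := by
        intro s hs
        rw [norm_smul, norm_smul, Real.norm_of_nonneg hs.1, Real.norm_of_nonneg hε.le]
        refine lt_of_le_of_lt ?_ hε1
        exact mul_le_of_le_one_left (by positivity) hs.2
      have hdiff := hfG.ae_sub_eq_integral hO hf hG (h := ε • v) fun x hx s hs => by
        rw [smul_smul]
        exact hv x hx _ (mul_nonneg hs.1 hε.le)
      have hfA' : ∀ᵐ x, x + ε • v ∈ O → x + ε • v ∈ A → f (x + ε • v) = 0 :=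
        (measurePreserving_add_right volume (ε • v)).quasiMeasurePreserving.ae hfA
      have hpt : ∀ᵐ x, x ∈ B → ‖w x‖ₑ ≤ ‖w (x + ε • v) - w x‖ₑ
          + ∫⁻ s in Ioc (0 : ℝ) 1, ‖γ (x + s • ε • v) - γ x‖ₑ := by
        filter_upwards [hdiff, hfA, hfA'] with x h1 h2 h3 hxB
        by_cases hxA : x ∈ A
        swap
        · simp [hw, hxA]
        by_cases hxA' : x + ε • v ∈ A
        swap
        · simp [hw, hxA']
        refine le_add_left ?_
        have hxO : x ∈ O := hB'O (hBB' hxB)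
        have hseg : ∀ s ∈ Ioc (0 : ℝ) 1, x + s • ε • v ∈ B' := by
          intro s hs
          have h4 := hnorm s (Ioc_subset_Icc_self hs)
          rw [hB, mem_closedBall_iff_norm] at hxB
          rw [hB', mem_closedBall_iff_norm, add_sub_right_comm]
          have := norm_add_le (x - x₀) (s • ε • v)
          have := min_le_right η ρ
          linarith
        have h5 := h1 hxO
        rw [h2 hxO hxA, h3 (hv x hxO ε hε.le) hxA', sub_zero] at h5
        have h6 : ∫ s in Ioc (0 : ℝ) 1, γ (x + s • ε • v) = 0 := by
          have : ∫ s in Ioc (0 : ℝ) 1, inner ℝ (G (x + s • ε • v)) (ε • v)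
              = ε * ∫ s in Ioc (0 : ℝ) 1, γ (x + s • ε • v) := by
            rw [← integral_const_mul]
            refine setIntegral_congr_fun measurableSet_Ioc fun s hs => ?_
            simp only [hγ, indicator_of_mem (hseg s hs), inner_smul_right]
          rw [this] at h5
          exact (mul_eq_zero.1 h5.symm).resolve_left hε.ne'
        rw [hw, indicator_of_mem hxA]
        have hms : Measurable fun s : ℝ => γ (x + s • ε • v) := hγm.comp (by fun_prop)
        -- for a function which is not integrable on the segment, the integral in `h6` is a junk
        -- value, but the bound to be proved is infinite
        by_cases hint : IntegrableOn (fun s : ℝ => γ (x + s • ε • v)) (Ioc 0 1)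
        · have h7 : ∫ s in Ioc (0 : ℝ) 1, (γ (x + s • ε • v) - γ x) = -γ x := by
            rw [integral_sub hint (integrable_const _), h6]
            simp
          rw [← enorm_neg, ← h7]
          exact enorm_integral_le_lintegral_enorm _
        · have h8 : ¬ IntegrableOn (fun s : ℝ => γ (x + s • ε • v) - γ x) (Ioc 0 1) := by
            intro h
            apply hint
            refine (h.add (integrable_const (γ x))).congr (Eventually.of_forall fun s => ?_)
            simp
          have h9 : ∫⁻ s in Ioc (0 : ℝ) 1, ‖γ (x + s • ε • v) - γ x‖ₑ = ⊤ := by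
            by_contra hne
            exact h8 ⟨(hms.sub_const _).aestronglyMeasurable, lt_top_iff_ne_top.2 hne⟩
          rw [h9]
          exact le_top
      have hmm : Measurable fun p : EuclideanSpace ℝ (Fin n) × ℝ =>
          ‖γ (p.1 + p.2 • ε • v) - γ p.1‖ₑ :=
        ((hγm.comp (by fun_prop)).sub (hγm.comp measurable_fst)).enorm
      calc ∫⁻ x in B, ‖w x‖ₑ
          ≤ ∫⁻ x in B, (‖w (x + ε • v) - w x‖ₑ
            + ∫⁻ s in Ioc (0 : ℝ) 1, ‖γ (x + s • ε • v) - γ x‖ₑ) :=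
            lintegral_mono_ae ((ae_restrict_iff' Metric.isClosed_closedBall.measurableSet).2 hpt)
        _ ≤ ∫⁻ x, (‖w (x + ε • v) - w x‖ₑ
            + ∫⁻ s in Ioc (0 : ℝ) 1, ‖γ (x + s • ε • v) - γ x‖ₑ) := setLIntegral_le_lintegral _ _
        _ = (∫⁻ x, ‖w (x + ε • v) - w x‖ₑ)
            + ∫⁻ s in Ioc (0 : ℝ) 1, ∫⁻ x, ‖γ (x + s • ε • v) - γ x‖ₑ := by
            rw [lintegral_add_left (f := fun x => ‖w (x + ε • v) - w x‖ₑ)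
              ((hwm.comp (measurable_add_const _)).sub hwm).enorm,
              lintegral_lintegral_swap hmm.aemeasurable]
        _ ≤ (δ / 2 : ℝ≥0) + ∫⁻ s in Ioc (0 : ℝ) 1, (δ / 2 : ℝ≥0) := by
            gcongr ?_ + ?_
            · have := hnorm 1 (by simp)
              rw [one_smul] at this
              exact (hηw (by simpa using this.trans_le (min_le_left _ _))).1.le
            · refine setLIntegral_mono measurable_const fun s hs => ?_
              have := hnorm s (Ioc_subset_Icc_self hs)
              exact (hηw (by simpa using this.trans_le (min_le_left _ _))).2.le
        _ = 0 + δ := by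
            simp only [setLIntegral_const, Real.volume_Ioc, sub_zero, ENNReal.ofReal_one, mul_one,
              zero_add]
            norm_cast
            exact add_halves δ
    refine ⟨{x | x ∈ O ∧ x ∈ A ∧ inner ℝ (G x) v ≠ 0} ∩ B, ?_, ?_⟩
    · exact inter_mem self_mem_nhdsWithin
        (mem_nhdsWithin_of_mem_nhds (Metric.closedBall_mem_nhds x₀ hρ))
    · rw [lintegral_eq_zero_iff hwm.enorm, EventuallyEq,
        ae_restrict_iff' Metric.isClosed_closedBall.measurableSet] at hzero
      refine measure_mono_null ?_ (ae_iff.1 hzero)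
      rintro x ⟨⟨-, hxA, hne⟩, hxB⟩ hx
      have := hx hxB
      simp [hw, hγ, hxA, hBB' hxB] at this
      exact hne this
  rw [ae_iff]
  refine measure_mono_null (fun x hx => ?_) hnull
  simpa [Classical.not_imp] using hx

/-- The gradient vanishes almost everywhere on a set where the function vanishes, on an open convex
cone: the directions in the cone span the space. -/
theorem HasWeakGradient.ae_eq_zero_of_ae_eq_zero (hO : IsOpen O) (hne : O.Nonempty)
    (hcone : ∀ x ∈ O, ∀ y ∈ O, ∀ s : ℝ, 0 ≤ s → x + s • y ∈ O)
    (hf : Measurable f) (hG : Measurable G) (hfG : HasWeakGradient O f G)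
    {A : Set (EuclideanSpace ℝ (Fin n))} (hA : MeasurableSet A)
    (hfA : ∀ᵐ x, x ∈ O → x ∈ A → f x = 0) :
    ∀ᵐ x, x ∈ O → x ∈ A → G x = 0 := by
  obtain ⟨v, hv⟩ := hne
  obtain ⟨ρ, hρ, hball⟩ := Metric.isOpen_iff.1 hO v hv
  set b := EuclideanSpace.basisFun (Fin n) ℝ with hb
  have hvi : ∀ i : Fin n, v + (ρ / 2) • b i ∈ O := fun i => hball <| by
    rw [mem_ball_iff_norm, add_sub_cancel_left, norm_smul, b.norm_eq_one,
      Real.norm_of_nonneg (by positivity)]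
    linarith
  have key := fun y hy => hfG.ae_inner_eq_zero hO hf hG (v := y)
    (fun x hx s hs => hcone x hx y hy s hs) hA hfA
  filter_upwards [key v hv, ae_all_iff.2 fun i => key _ (hvi i)] with x h1 h2 hxO hxA
  ext i
  have h3 := h2 i hxO hxA
  rw [inner_add_right, h1 hxO hxA, inner_smul_right, zero_add, real_inner_comm,
    EuclideanSpace.basisFun_inner] at h3
  exact (mul_eq_zero.1 h3).resolve_left (by positivity)

end LevelSet

/-! ### Pointwise Lipschitz estimates on open convex cones -/

section Pointwise

variable {n : ℕ} {O : Set (EuclideanSpace ℝ (Fin n))}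

theorem setLIntegral_closedBall_comp_smul {F : EuclideanSpace ℝ (Fin n) → ℝ≥0∞}
    (hF : Measurable F) (x : EuclideanSpace ℝ (Fin n)) {s : ℝ} (hs : 0 < s) (r : ℝ) :
    ∫⁻ h in Metric.closedBall 0 r, F (x + s • h)
      = ENNReal.ofReal (s ^ n)⁻¹ * ∫⁻ y in Metric.closedBall x (s * r), F y := by
  have hr : (fun h => (Metric.closedBall x (s * r)).indicator F (x + s • h))
      = (Metric.closedBall 0 r).indicator fun h => F (x + s • h) := by
    ext h
    have : x + s • h ∈ Metric.closedBall x (s * r) ↔ h ∈ Metric.closedBall 0 r := by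
      rw [mem_closedBall_iff_norm, add_sub_cancel_left, norm_smul, Real.norm_of_nonneg hs.le,
        mem_closedBall_zero_iff]
      exact mul_le_mul_iff_right₀ hs
    by_cases h1 : h ∈ Metric.closedBall 0 r
    · rw [indicator_of_mem (this.2 h1), indicator_of_mem h1]
    · rw [indicator_of_notMem (fun h2 => h1 (this.1 h2)), indicator_of_notMem h1]
  have hm : Measurable ((Metric.closedBall x (s * r)).indicator F) :=
    hF.indicator Metric.isClosed_closedBall.measurableSet
  have hm' : Measurable fun h => (Metric.closedBall x (s * r)).indicator F (x + h) :=
    hm.comp (by fun_prop)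
  rw [← lintegral_indicator Metric.isClosed_closedBall.measurableSet,
    ← lintegral_indicator Metric.isClosed_closedBall.measurableSet, ← hr,
    ← lintegral_add_left_eq_self ((Metric.closedBall x (s * r)).indicator F) x]
  have h1 := lintegral_map (μ := volume) hm'
    (measurable_const_smul (α := EuclideanSpace ℝ (Fin n)) s)
  rw [← h1, Measure.map_addHaar_smul _ hs.ne', lintegral_smul_measure, smul_eq_mul]
  simp [abs_of_pos hs]

variable {f : EuclideanSpace ℝ (Fin n) → ℝ}
  {G : EuclideanSpace ℝ (Fin n) → EuclideanSpace ℝ (Fin n)} {F : EuclideanSpace ℝ (Fin n) → ℝ≥0∞}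

/-- Almost every point sees almost every other point of its translated cone along a segment on
which `f` is the integral of `G`. -/
theorem HasWeakGradient.ae_ae_sub_eq_integral (hO : IsOpen O)
    (hcone : ∀ x ∈ O, ∀ y ∈ O, ∀ s : ℝ, 0 ≤ s → x + s • y ∈ O)
    (hf : Measurable f) (hG : Measurable G) (hfG : HasWeakGradient O f G) :
    ∀ᵐ x, x ∈ O → ∀ᵐ h, h ∈ O →
      f (x + h) - f x = ∫ s in Ioc (0 : ℝ) 1, inner ℝ (G (x + s • h)) h := by
  have key : ∀ h ∈ O, ∀ᵐ x, x ∈ O →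
      f (x + h) - f x = ∫ s in Ioc (0 : ℝ) 1, inner ℝ (G (x + s • h)) h := fun h hh =>
    hfG.ae_sub_eq_integral hO hf hG fun x hx s hs => hcone x hx h hh s hs.1
  have hmeas : MeasurableSet {p : EuclideanSpace ℝ (Fin n) × EuclideanSpace ℝ (Fin n) |
      f (p.1 + p.2) - f p.1 = ∫ s in Ioc (0 : ℝ) 1, inner ℝ (G (p.1 + s • p.2)) p.2} := by
    refine measurableSet_eq_fun ((hf.comp (by fun_prop)).sub (hf.comp measurable_fst)) ?_
    have : StronglyMeasurable fun q : (EuclideanSpace ℝ (Fin n) × EuclideanSpace ℝ (Fin n)) × ℝ =>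
        (inner ℝ (G (q.1.1 + q.2 • q.1.2)) q.1.2 : ℝ) :=
      ((hG.comp (by fun_prop)).inner (by fun_prop)).stronglyMeasurable
    exact this.integral_prod_right'.measurable
  have h2 : ∀ᵐ x ∂(volume.restrict O), ∀ᵐ h ∂(volume.restrict O),
      f (x + h) - f x = ∫ s in Ioc (0 : ℝ) 1, inner ℝ (G (x + s • h)) h := by
    rw [Measure.ae_ae_comm hmeas]
    refine (ae_restrict_iff' hO.measurableSet).2 (Filter.Eventually.of_forall fun h hh => ?_)
    exact (ae_restrict_iff' hO.measurableSet).2 (key h hh)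
  have h3 := (ae_restrict_iff' hO.measurableSet).1 h2
  filter_upwards [h3] with x hx hxO
  exact (ae_restrict_iff' hO.measurableSet).1 (hx hxO)

/-- The Poincaré type estimate at a point where all averages of the gradient are bounded by `l`. -/
theorem setLIntegral_enorm_sub_le
    (hcone : ∀ x ∈ O, ∀ y ∈ O, ∀ s : ℝ, 0 ≤ s → x + s • y ∈ O)
    (hF : Measurable F) (hGF : ∀ x ∈ O, ‖G x‖ₑ ≤ F x) {x : EuclideanSpace ℝ (Fin n)} (hx : x ∈ O)
    (hdiff : ∀ᵐ h, h ∈ O → f (x + h) - f x = ∫ s in Ioc (0 : ℝ) 1, inner ℝ (G (x + s • h)) h)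
    {l : ℝ≥0∞} (hl : ∀ r > 0, ∫⁻ y in Metric.closedBall x r, F y
      ≤ l * volume (Metric.closedBall x r)) {S : Set (EuclideanSpace ℝ (Fin n))} {R : ℝ}
    (hR : 0 < R) (hSm : MeasurableSet S) (hSO : S ⊆ O) (hSR : S ⊆ Metric.closedBall 0 R) :
    ∫⁻ h in S, ‖f (x + h) - f x‖ₑ
      ≤ ENNReal.ofReal R * (l * volume (Metric.closedBall (0 : EuclideanSpace ℝ (Fin n)) R)) := by
  have hm : Measurable fun p : EuclideanSpace ℝ (Fin n) × ℝ => F (x + p.2 • p.1) :=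
    hF.comp (by fun_prop)
  calc ∫⁻ h in S, ‖f (x + h) - f x‖ₑ
      ≤ ∫⁻ h in S, ENNReal.ofReal R * ∫⁻ s in Ioc (0 : ℝ) 1, F (x + s • h) := by
        refine lintegral_mono_ae ?_
        rw [ae_restrict_iff' hSm]
        filter_upwards [hdiff] with h hh hhS
        rw [hh (hSO hhS), ← lintegral_const_mul _ (f := fun s : ℝ => F (x + s • h))
          (hF.comp (by fun_prop))]
        refine (enorm_integral_le_lintegral_enorm _).trans ?_
        refine setLIntegral_mono ((hF.comp (by fun_prop)).const_mul _) fun s hs => ?_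
        have h1 : ‖(inner ℝ (G (x + s • h)) h : ℝ)‖ₑ ≤ ‖G (x + s • h)‖ₑ * ‖h‖ₑ := by
          rw [← ofReal_norm, ← ofReal_norm, ← ofReal_norm, ← ENNReal.ofReal_mul (norm_nonneg _)]
          exact ENNReal.ofReal_le_ofReal (norm_inner_le_norm _ _)
        have h2 : ‖h‖ₑ ≤ ENNReal.ofReal R := by
          rw [← ofReal_norm]
          exact ENNReal.ofReal_le_ofReal (by simpa using hSR hhS)
        calc _ ≤ ‖G (x + s • h)‖ₑ * ‖h‖ₑ := h1
          _ ≤ F (x + s • h) * ENNReal.ofReal R := by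
            gcongr
            exact hGF _ (hcone x hx h (hSO hhS) s hs.1.le)
          _ = _ := mul_comm _ _
    _ = ENNReal.ofReal R * ∫⁻ s in Ioc (0 : ℝ) 1, ∫⁻ h in S, F (x + s • h) := by
        rw [lintegral_const_mul _ hm.lintegral_prod_right',
          lintegral_lintegral_swap hm.aemeasurable]
    _ ≤ ENNReal.ofReal R * ∫⁻ s in Ioc (0 : ℝ) 1,
          l * volume (Metric.closedBall (0 : EuclideanSpace ℝ (Fin n)) R) := by
        refine mul_le_mul_right (setLIntegral_mono measurable_const fun s hs => ?_) _
        calc ∫⁻ h in S, F (x + s • h) ≤ ∫⁻ h in Metric.closedBall 0 R, F (x + s • h) :=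
              lintegral_mono_set hSR
          _ = ENNReal.ofReal (s ^ n)⁻¹ * ∫⁻ y in Metric.closedBall x (s * R), F y :=
              setLIntegral_closedBall_comp_smul hF x hs.1 R
          _ ≤ ENNReal.ofReal (s ^ n)⁻¹ * (l * volume (Metric.closedBall x (s * R))) := by
              gcongr
              exact hl _ (mul_pos hs.1 hR)
          _ = l * volume (Metric.closedBall (0 : EuclideanSpace ℝ (Fin n)) R) := by
              rw [Measure.addHaar_closedBall_mul _ _ hs.1.le hR.le, mul_left_comm,
                ← mul_assoc (ENNReal.ofReal _), finrank_euclideanSpace, Fintype.card_fin,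
                ← ENNReal.ofReal_mul (by have := hs.1; positivity),
                inv_mul_cancel₀ (pow_pos hs.1 n).ne']
              simp
    _ = _ := by simp

open scoped Pointwise in
/-- A function on an open convex cone is Lipschitz on the set of points where all the averages of
its gradient are bounded: two such points `x`, `y` are compared with the mean value over the
intersection of two balls in the cone with radii and centers proportional to `‖x - y‖`. -/
theorem enorm_sub_le_of_lintegral_closedBall_le (hf : Measurable f)
    (hcone : ∀ x ∈ O, ∀ y ∈ O, ∀ s : ℝ, 0 ≤ s → x + s • y ∈ O)
    (hsmul : ∀ x ∈ O, ∀ s : ℝ, 0 < s → s • x ∈ O)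
    (hF : Measurable F) (hGF : ∀ x ∈ O, ‖G x‖ₑ ≤ F x)
    {a : EuclideanSpace ℝ (Fin n)} {R : ℝ} (hR : 0 < R) (haO : Metric.closedBall a 2 ⊆ O)
    (haR : Metric.closedBall a 2 ⊆ Metric.closedBall 0 R) {l : ℝ≥0∞}
    {x y : EuclideanSpace ℝ (Fin n)} (hx : x ∈ O) (hy : y ∈ O)
    (hdx : ∀ᵐ h, h ∈ O → f (x + h) - f x = ∫ s in Ioc (0 : ℝ) 1, inner ℝ (G (x + s • h)) h)
    (hdy : ∀ᵐ h, h ∈ O → f (y + h) - f y = ∫ s in Ioc (0 : ℝ) 1, inner ℝ (G (y + s • h)) h)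
    (hlx : ∀ r > 0, ∫⁻ z in Metric.closedBall x r, F z ≤ l * volume (Metric.closedBall x r))
    (hly : ∀ r > 0, ∫⁻ z in Metric.closedBall y r, F z ≤ l * volume (Metric.closedBall y r)) :
    ‖f x - f y‖ₑ ≤ ENNReal.ofReal (2 * R ^ (n + 1)) * l * ‖x - y‖ₑ := by
  rcases eq_or_ne x y with rfl | hxy
  · simp
  set d := ‖x - y‖ with hd
  have hd0 : 0 < d := norm_sub_pos_iff.2 hxy
  set S := Metric.closedBall (d • a) (d * 2) with hS
  have hSd : S = d • Metric.closedBall a 2 := by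
    rw [smul_closedBall' hd0.ne', Real.norm_of_nonneg hd0.le]
  have hSO : S ⊆ O := by
    rw [hSd]
    rintro _ ⟨z, hz, rfl⟩
    exact hsmul z (haO hz) d hd0
  have hSR : S ⊆ Metric.closedBall 0 (d * R) := by
    rw [hSd]
    rintro _ ⟨z, hz, rfl⟩
    have := haR hz
    rw [mem_closedBall_zero_iff] at this ⊢
    simp only [norm_smul, Real.norm_of_nonneg hd0.le]
    gcongr
  have hSm : MeasurableSet S := Metric.isClosed_closedBall.measurableSet
  have hdR : 0 < d * R := by positivity
  -- `W` lies in both translates `x + S` and `y + S`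
  set W := Metric.closedBall (x + d • a) d with hW
  have hWm : MeasurableSet W := Metric.isClosed_closedBall.measurableSet
  have aux : ∀ z, (∀ w ∈ W, w - z ∈ S) →
      ∫⁻ w in W, ‖f w - f z‖ₑ ≤ ∫⁻ h in S, ‖f (z + h) - f z‖ₑ := by
    intro z hz
    rw [← lintegral_indicator hWm, ← lintegral_indicator hSm, ← lintegral_add_left_eq_self _ z]
    refine lintegral_mono fun h => ?_
    by_cases hh : z + h ∈ W
    · have := hz _ hh
      rw [add_sub_cancel_left] at this
      rw [indicator_of_mem hh, indicator_of_mem this]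
    · rw [indicator_of_notMem hh]
      exact zero_le
  have h1 : ∫⁻ w in W, ‖f w - f x‖ₑ ≤ ENNReal.ofReal (d * R) *
      (l * volume (Metric.closedBall (0 : EuclideanSpace ℝ (Fin n)) (d * R))) := by
    refine (aux x fun w hw => ?_).trans
      (setLIntegral_enorm_sub_le hcone hF hGF hx hdx hlx hdR hSm hSO hSR)
    rw [hW, mem_closedBall_iff_norm] at hw
    rw [hS, mem_closedBall_iff_norm]
    have e : w - x - d • a = w - (x + d • a) := by abel
    rw [e]
    linarith
  have h2 : ∫⁻ w in W, ‖f w - f y‖ₑ ≤ ENNReal.ofReal (d * R) *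
      (l * volume (Metric.closedBall (0 : EuclideanSpace ℝ (Fin n)) (d * R))) := by
    refine (aux y fun w hw => ?_).trans
      (setLIntegral_enorm_sub_le hcone hF hGF hy hdy hly hdR hSm hSO hSR)
    rw [hW, mem_closedBall_iff_norm] at hw
    rw [hS, mem_closedBall_iff_norm]
    have e : w - y - d • a = (w - (x + d • a)) + (x - y) := by abel
    rw [e]
    have := norm_add_le (w - (x + d • a)) (x - y)
    linarith
  set V := volume (Metric.closedBall (0 : EuclideanSpace ℝ (Fin n)) d) with hV
  have hV0 : V ≠ 0 := (Metric.measure_closedBall_pos volume _ hd0).ne'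
  have hVt : V ≠ ⊤ := measure_closedBall_lt_top.ne
  have hWV : volume W = V := Measure.addHaar_closedBall_center _ _ _
  have hVR : volume (Metric.closedBall (0 : EuclideanSpace ℝ (Fin n)) (d * R))
      = ENNReal.ofReal (R ^ n) * V := by
    rw [mul_comm d R, Measure.addHaar_closedBall_mul _ _ hR.le hd0.le, finrank_euclideanSpace,
      Fintype.card_fin]
  have h3 : ‖f x - f y‖ₑ * V
      ≤ (ENNReal.ofReal (2 * R ^ (n + 1)) * l * ENNReal.ofReal d) * V := by
    calc ‖f x - f y‖ₑ * V = ∫⁻ w in W, ‖f x - f y‖ₑ := by rw [setLIntegral_const, hWV]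
      _ ≤ ∫⁻ w in W, (‖f w - f x‖ₑ + ‖f w - f y‖ₑ) := by
          refine lintegral_mono fun w => ?_
          have : f x - f y = -(f w - f x) + (f w - f y) := by ring
          rw [this]
          refine (enorm_add_le _ _).trans ?_
          rw [enorm_neg]
      _ = (∫⁻ w in W, ‖f w - f x‖ₑ) + ∫⁻ w in W, ‖f w - f y‖ₑ :=
          lintegral_add_left (hf.sub_const _).enorm _
      _ ≤ _ := add_le_add h1 h2
      _ = _ := by
          rw [hVR, ENNReal.ofReal_mul hd0.le, ENNReal.ofReal_mul zero_le_two, pow_succ,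
            ENNReal.ofReal_mul (by positivity), ENNReal.ofReal_ofNat]
          ring
  have h4 := (ENNReal.mul_le_mul_iff_left hV0 hVt).1 h3
  rwa [hd, ofReal_norm] at h4

end Pointwise

/-! ### Geometry of the double cone -/

section Cone

variable {m : ℕ}

/-- The convex component `|(x₁, …, x_m)| < σ x_{m+1}`, `σ = ± 1`, of the double cone. -/
def halfCone (m : ℕ) (σ : ℝ) : Set (EuclideanSpace ℝ (Fin (m + 1))) :=
  {x | ‖(WithLp.toLp 2 fun i : Fin m => x i.castSucc : EuclideanSpace ℝ (Fin m))‖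
    < σ * x (Fin.last m)}

theorem doubleCone_eq_union (m : ℕ) : doubleCone m = halfCone m 1 ∪ halfCone m (-1) := by
  ext x
  simp only [doubleCone, halfCone, mem_union, mem_ofPred_eq, one_mul, neg_one_mul]
  rw [← lt_abs, ← sq_lt_sq₀ (norm_nonneg _) (abs_nonneg _), sq_abs, EuclideanSpace.norm_sq_eq]
  simp

theorem isOpen_halfCone (m : ℕ) (σ : ℝ) : IsOpen (halfCone m σ) :=
  isOpen_lt (by fun_prop) (by fun_prop)

theorem isOpen_doubleCone (m : ℕ) : IsOpen (doubleCone m) := by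
  rw [doubleCone_eq_union]
  exact (isOpen_halfCone m 1).union (isOpen_halfCone m (-1))

theorem nonempty_halfCone (m : ℕ) {σ : ℝ} (hσ : σ ≠ 0) : (halfCone m σ).Nonempty := by
  refine ⟨EuclideanSpace.single (Fin.last m) σ, ?_⟩
  have : (WithLp.toLp 2 fun i : Fin m =>
      (EuclideanSpace.single (Fin.last m) σ : EuclideanSpace ℝ (Fin (m + 1))) i.castSucc :
      EuclideanSpace ℝ (Fin m)) = 0 := by
    ext i
    simp [Fin.castSucc_ne_last]
  simp only [halfCone, mem_ofPred_eq, this, norm_zero]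
  simpa using mul_self_pos.2 hσ

theorem smul_mem_halfCone {σ s : ℝ} {x : EuclideanSpace ℝ (Fin (m + 1))}
    (hx : x ∈ halfCone m σ) (hs : 0 < s) : s • x ∈ halfCone m σ := by
  simp only [halfCone, mem_ofPred_eq, PiLp.smul_apply, smul_eq_mul] at hx ⊢
  have : (WithLp.toLp 2 fun i : Fin m => s * x i.castSucc : EuclideanSpace ℝ (Fin m))
      = s • WithLp.toLp 2 fun i : Fin m => x i.castSucc := by ext i; simp
  rw [this, norm_smul, Real.norm_of_nonneg hs.le]
  nlinarith

theorem add_mem_halfCone {σ : ℝ} {x y : EuclideanSpace ℝ (Fin (m + 1))}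
    (hx : x ∈ halfCone m σ) (hy : y ∈ halfCone m σ) : x + y ∈ halfCone m σ := by
  simp only [halfCone, mem_ofPred_eq, PiLp.add_apply] at hx hy ⊢
  have : (WithLp.toLp 2 fun i : Fin m => x i.castSucc + y i.castSucc : EuclideanSpace ℝ (Fin m))
      = (WithLp.toLp 2 fun i : Fin m => x i.castSucc)
        + WithLp.toLp 2 fun i : Fin m => y i.castSucc := by ext i; simp
  rw [this]
  have := norm_add_le (WithLp.toLp 2 fun i : Fin m => x i.castSucc : EuclideanSpace ℝ (Fin m))
    (WithLp.toLp 2 fun i : Fin m => y i.castSucc)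
  linarith

theorem add_smul_mem_halfCone {σ : ℝ} {x y : EuclideanSpace ℝ (Fin (m + 1))}
    (hx : x ∈ halfCone m σ) (hy : y ∈ halfCone m σ) {s : ℝ} (hs : 0 ≤ s) :
    x + s • y ∈ halfCone m σ := by
  rcases hs.eq_or_lt with rfl | hs
  · simpa using hx
  · exact add_mem_halfCone hx (smul_mem_halfCone hy hs)

theorem exists_closedBall_subset_halfCone (m : ℕ) {σ : ℝ} (hσ : σ ≠ 0) :
    ∃ (a : EuclideanSpace ℝ (Fin (m + 1))) (R : ℝ), 0 < R ∧
      Metric.closedBall a 2 ⊆ halfCone m σ ∧ Metric.closedBall a 2 ⊆ Metric.closedBall 0 R := by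
  obtain ⟨v, hv⟩ := nonempty_halfCone m hσ
  obtain ⟨ρ, hρ, hball⟩ := Metric.isOpen_iff.1 (isOpen_halfCone m σ) v hv
  refine ⟨(3 / ρ) • v, ‖(3 / ρ) • v‖ + 2, by positivity, fun x hx => ?_, fun x hx => ?_⟩
  · have h1 : (ρ / 3) • x ∈ halfCone m σ := by
      apply hball
      rw [mem_ball_iff_norm]
      rw [mem_closedBall_iff_norm] at hx
      have e : (ρ / 3) • x - v = (ρ / 3) • (x - (3 / ρ) • v) := by
        rw [smul_sub, smul_smul, div_mul_div_cancel₀ three_ne_zero, div_self hρ.ne', one_smul]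
      rw [e, norm_smul, Real.norm_of_nonneg (by positivity)]
      nlinarith
    have h2 := smul_mem_halfCone h1 (s := 3 / ρ) (by positivity)
    rwa [smul_smul, div_mul_div_cancel₀ hρ.ne', div_self three_ne_zero, one_smul] at h2
  · rw [mem_closedBall_iff_norm] at hx
    rw [mem_closedBall_zero_iff]
    have := norm_add_le (x - (3 / ρ) • v) ((3 / ρ) • v)
    rw [sub_add_cancel] at this
    linarith

theorem ne_zero_of_mem_doubleCone {x : EuclideanSpace ℝ (Fin (m + 1))} (hx : x ∈ doubleCone m) :
    x ≠ 0 := by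
  rintro rfl
  simp [doubleCone] at hx

/-- Points of the two components form an obtuse angle at the vertex. -/
theorem inner_nonpos_of_mem_halfCone {x y : EuclideanSpace ℝ (Fin (m + 1))}
    (hx : x ∈ halfCone m 1) (hy : y ∈ halfCone m (-1)) : inner ℝ x y ≤ (0 : ℝ) := by
  simp only [halfCone, mem_ofPred_eq, one_mul, neg_one_mul] at hx hy
  have h1 := real_inner_le_norm
    (WithLp.toLp 2 fun i : Fin m => x i.castSucc : EuclideanSpace ℝ (Fin m))
    (WithLp.toLp 2 fun i : Fin m => y i.castSucc)
  have h2 : inner ℝ x y = inner ℝ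
    (WithLp.toLp 2 fun i : Fin m => x i.castSucc : EuclideanSpace ℝ (Fin m))
    (WithLp.toLp 2 fun i : Fin m => y i.castSucc) + x (Fin.last m) * y (Fin.last m) := by
    simp only [PiLp.inner_apply, Fin.sum_univ_castSucc, RCLike.inner_apply, conj_trivial]
    ring
  rw [h2]
  have := mul_le_mul hx.le hy.le (norm_nonneg _) ((norm_nonneg _).trans hx.le)
  linarith

theorem norm_le_norm_sub_of_inner_nonpos {E : Type*} [NormedAddCommGroup E]
    [InnerProductSpace ℝ E] {x y : E} (h : inner ℝ x y ≤ (0 : ℝ)) : ‖x‖ ≤ ‖x - y‖ := by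
  have := norm_sub_sq_real x y
  refine le_of_sq_le_sq ?_ (norm_nonneg _)
  nlinarith [sq_nonneg ‖y‖]

end Cone

/-! ### Lipschitz truncation -/

section Truncation

/-- On the set where a function and the averages of its gradient are bounded, the function is
Lipschitz. Points of the same component are compared along segments, points of different
components through the bound `|f| ≤ l r`. -/
theorem exists_lipschitzOnWith_of_lintegral_closedBall_le (m : ℕ) :
    ∃ C : ℝ≥0, 1 ≤ C ∧ ∀ (f : EuclideanSpace ℝ (Fin (m + 1)) → ℝ)
      (G : EuclideanSpace ℝ (Fin (m + 1)) → EuclideanSpace ℝ (Fin (m + 1)))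
      (F : EuclideanSpace ℝ (Fin (m + 1)) → ℝ≥0∞), Measurable f → Measurable G → Measurable F →
      HasWeakGradient (doubleCone m) f G →
      (∀ x ∈ doubleCone m, ‖G x‖ₑ ≤ F x ∧ ‖f x / ‖x‖‖ₑ ≤ F x) → ∀ (l : ℝ≥0)
      (U : Set (EuclideanSpace ℝ (Fin (m + 1)))),
      (∀ x ∉ U, F x ≤ l ∧ ∀ r > 0, ∫⁻ y in Metric.closedBall x r, F y
        ≤ l * volume (Metric.closedBall x r)) →
      ∃ N : Set (EuclideanSpace ℝ (Fin (m + 1))), volume N = 0 ∧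
        LipschitzOnWith (C * l) f ((doubleCone m \ U) \ N) := by
  obtain ⟨a₁, R₁, hR₁, h1O, h1R⟩ := exists_closedBall_subset_halfCone m one_ne_zero
  obtain ⟨a₂, R₂, hR₂, h2O, h2R⟩ := exists_closedBall_subset_halfCone m
    (neg_ne_zero.2 one_ne_zero)
  set C₁ : ℝ≥0 := ENNReal.toNNReal (ENNReal.ofReal (2 * R₁ ^ (m + 1 + 1))) with hC₁
  set C₂ : ℝ≥0 := ENNReal.toNNReal (ENNReal.ofReal (2 * R₂ ^ (m + 1 + 1))) with hC₂
  refine ⟨max 2 (max C₁ C₂), by simp, ?_⟩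
  intro f G F hf hG hF hfG hFb l U hU
  have hsub1 : halfCone m 1 ⊆ doubleCone m := by
    rw [doubleCone_eq_union]; exact subset_union_left
  have hsub2 : halfCone m (-1) ⊆ doubleCone m := by
    rw [doubleCone_eq_union]; exact subset_union_right
  have hd1 := (hfG.mono hsub1).ae_ae_sub_eq_integral (isOpen_halfCone m 1)
    (fun x hx y hy s hs => add_smul_mem_halfCone hx hy hs) hf hG
  have hd2 := (hfG.mono hsub2).ae_ae_sub_eq_integral (isOpen_halfCone m (-1))
    (fun x hx y hy s hs => add_smul_mem_halfCone hx hy hs) hf hG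
  refine ⟨_, ae_iff.1 (hd1.and hd2), ?_⟩
  have hfl : ∀ x ∈ doubleCone m, x ∉ U → |f x| ≤ l * ‖x‖ := by
    intro x hx hxU
    have h1 := (hFb x hx).2.trans (hU x hxU).1
    have h0 : 0 < ‖x‖ := norm_pos_iff.2 (ne_zero_of_mem_doubleCone hx)
    rw [enorm_le_coe, ← NNReal.coe_le_coe, coe_nnnorm, norm_div, norm_norm, div_le_iff₀ h0] at h1
    exact h1
  -- two points in opposite components
  have hopp : ∀ x y, x ∈ doubleCone m → y ∈ doubleCone m → x ∉ U → y ∉ U →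
      inner ℝ x y ≤ (0 : ℝ) → edist (f x) (f y) ≤ (max 2 (max C₁ C₂) * l : ℝ≥0) * edist x y := by
    intro x y hx hy hxU hyU hxy
    have h1 := norm_le_norm_sub_of_inner_nonpos hxy
    have h2 := norm_le_norm_sub_of_inner_nonpos (x := y) (y := x) (by rwa [real_inner_comm])
    rw [norm_sub_rev] at h2
    have h3 := hfl x hx hxU
    have h4 := hfl y hy hyU
    rw [edist_nndist, edist_nndist, ← ENNReal.coe_mul, ENNReal.coe_le_coe, ← NNReal.coe_le_coe,
      NNReal.coe_mul, NNReal.coe_mul, coe_nndist, coe_nndist, dist_eq_norm, dist_eq_norm]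
    have h5 : (2 : ℝ) ≤ (max 2 (max C₁ C₂) : ℝ≥0) := by
      exact_mod_cast le_max_left _ _
    have hl : (0 : ℝ) ≤ l := l.2
    calc ‖f x - f y‖ ≤ |f x| + |f y| := norm_sub_le _ _
      _ ≤ l * ‖x‖ + l * ‖y‖ := add_le_add h3 h4
      _ ≤ l * ‖x - y‖ + l * ‖x - y‖ := by gcongr
      _ = 2 * l * ‖x - y‖ := by ring
      _ ≤ _ := by gcongr
  -- two points in the same component
  have hsame : ∀ (σ R : ℝ) (a : EuclideanSpace ℝ (Fin (m + 1))), 0 < R →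
      halfCone m σ ⊆ doubleCone m → Metric.closedBall a 2 ⊆ halfCone m σ →
      Metric.closedBall a 2 ⊆ Metric.closedBall 0 R →
      ENNReal.toNNReal (ENNReal.ofReal (2 * R ^ (m + 1 + 1))) ≤ max 2 (max C₁ C₂) →
      ∀ x y, x ∈ halfCone m σ → y ∈ halfCone m σ → x ∉ U → y ∉ U →
      (∀ᵐ h, h ∈ halfCone m σ → f (x + h) - f x =
        ∫ s in Ioc (0 : ℝ) 1, inner ℝ (G (x + s • h)) h) →
      (∀ᵐ h, h ∈ halfCone m σ → f (y + h) - f y =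
        ∫ s in Ioc (0 : ℝ) 1, inner ℝ (G (y + s • h)) h) →
      edist (f x) (f y) ≤ (max 2 (max C₁ C₂) * l : ℝ≥0) * edist x y := by
    intro σ R a hR hsub haO haR hC x y hx hy hxU hyU hdx hdy
    have h1 := enorm_sub_le_of_lintegral_closedBall_le hf
      (fun x hx y hy s hs => add_smul_mem_halfCone hx hy hs)
      (fun x hx s hs => smul_mem_halfCone hx hs) hF (fun x hx => (hFb x (hsub hx)).1)
      hR haO haR hx hy hdx hdy (hU x hxU).2 (hU y hyU).2
    rw [edist_eq_enorm_sub, edist_eq_enorm_sub]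
    refine h1.trans ?_
    rw [ENNReal.coe_mul]
    gcongr
    rw [← ENNReal.coe_toNNReal (ENNReal.ofReal_ne_top (r := 2 * R ^ (m + 1 + 1)))]
    exact_mod_cast hC
  rintro x ⟨⟨hx, hxU⟩, hxN⟩ y ⟨⟨hy, hyU⟩, hyN⟩
  simp only [mem_ofPred_eq, not_not] at hxN hyN
  have hx' := hx
  have hy' := hy
  rw [doubleCone_eq_union] at hx' hy'
  rcases hx' with hx' | hx' <;> rcases hy' with hy' | hy'
  · exact hsame 1 R₁ a₁ hR₁ hsub1 h1O h1R ((le_max_left _ _).trans (le_max_right _ _)) x y hx' hy'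
      hxU hyU (hxN.1 hx') (hyN.1 hy')
  · exact hopp x y hx hy hxU hyU (inner_nonpos_of_mem_halfCone hx' hy')
  · refine hopp x y hx hy hxU hyU ?_
    rw [real_inner_comm]
    exact inner_nonpos_of_mem_halfCone hy' hx'
  · exact hsame (-1) R₂ a₂ hR₂ hsub2 h2O h2R ((le_max_right _ _).trans (le_max_right _ _)) x y hx'
      hy' hxU hyU (hxN.2 hx') (hyN.2 hy')

/-- Lipschitz truncation at height `l`, off a set `U` which contains the points where `F` or its
averages exceed `l`. -/
theorem exists_lipschitz_truncation (m : ℕ) :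
    ∃ C : ℝ≥0, 1 ≤ C ∧ ∀ (f : EuclideanSpace ℝ (Fin (m + 1)) → ℝ)
      (G : EuclideanSpace ℝ (Fin (m + 1)) → EuclideanSpace ℝ (Fin (m + 1)))
      (F : EuclideanSpace ℝ (Fin (m + 1)) → ℝ≥0∞), Measurable f → Measurable G → Measurable F →
      HasWeakGradient (doubleCone m) f G →
      (∀ x ∈ doubleCone m, ‖f x‖ₑ ≤ F x ∧ ‖G x‖ₑ ≤ F x ∧ ‖f x / ‖x‖‖ₑ ≤ F x) → ∀ (l : ℝ≥0)
      (U : Set (EuclideanSpace ℝ (Fin (m + 1)))), MeasurableSet U →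
      (∀ x ∉ U, F x ≤ l ∧ ∀ r > 0, ∫⁻ y in Metric.closedBall x r, F y
        ≤ l * volume (Metric.closedBall x r)) →
      ∃ g : EuclideanSpace ℝ (Fin (m + 1)) → ℝ, LipschitzWith (C * l) g ∧ (∀ x, |g x| ≤ l) ∧
        (∀ x, |g x| ≤ l * ‖x‖) ∧
        ∀ᵐ x, x ∈ doubleCone m → x ∉ U → f x = g x ∧ G x = gradient g x := by
  obtain ⟨C, hC1, hC⟩ := exists_lipschitzOnWith_of_lintegral_closedBall_le m
  refine ⟨C, hC1, ?_⟩
  intro f G F hf hG hF hfG hFb l U hUm hU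
  obtain ⟨N, hN, hLip⟩ := hC f G F hf hG hF hfG (fun x hx => (hFb x hx).2) l U hU
  obtain ⟨g₀, hg₀, hfg₀⟩ := hLip.extend_real
  set b : EuclideanSpace ℝ (Fin (m + 1)) → ℝ := fun x => min (l : ℝ) (l * ‖x‖) with hb
  have hb0 : ∀ x, 0 ≤ b x := fun x => le_min l.2 (by positivity)
  have hbL : LipschitzWith l b := by
    have h1 : LipschitzWith l fun x : EuclideanSpace ℝ (Fin (m + 1)) => (l : ℝ) * ‖x‖ := by
      refine LipschitzWith.of_dist_le_mul fun x y => ?_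
      rw [Real.dist_eq, ← mul_sub, abs_mul, NNReal.abs_eq, dist_eq_norm]
      exact mul_le_mul_of_nonneg_left (abs_norm_sub_norm_le _ _) l.2
    simpa using h1.const_min (l : ℝ)
  -- the extension of `f` is cut off at `± l min(1, r)`, which does not affect the values off `U`
  set g : EuclideanSpace ℝ (Fin (m + 1)) → ℝ := fun x => max (-b x) (min (g₀ x) (b x)) with hg
  have hlC : l ≤ C * l := le_mul_of_one_le_left zero_le hC1
  have hgL : LipschitzWith (C * l) g := by
    have h1 := hbL.neg.max (hg₀.min hbL)
    refine h1.weaken ?_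
    simp [hlC]
  have hgb : ∀ x, |g x| ≤ b x := fun x =>
    abs_le.2 ⟨le_max_left _ _, max_le (by linarith [hb0 x]) (min_le_right _ _)⟩
  have hNae : ∀ᵐ x : EuclideanSpace ℝ (Fin (m + 1)), x ∉ N := by
    rw [ae_iff]; simpa using hN
  have hfg : ∀ᵐ x, x ∈ doubleCone m → x ∉ U → f x = g x := by
    filter_upwards [hNae] with x hxN hx hxU
    have h1 := (hFb x hx).1.trans (hU x hxU).1
    have h2 := (hFb x hx).2.2.trans (hU x hxU).1
    have h0 : 0 < ‖x‖ := norm_pos_iff.2 (ne_zero_of_mem_doubleCone hx)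
    rw [enorm_le_coe, ← NNReal.coe_le_coe, coe_nnnorm, Real.norm_eq_abs] at h1
    rw [enorm_le_coe, ← NNReal.coe_le_coe, coe_nnnorm, norm_div, norm_norm, div_le_iff₀ h0,
      Real.norm_eq_abs] at h2
    have h3 : |f x| ≤ b x := le_min h1 h2
    have h4 : f x = g₀ x := hfg₀ ⟨⟨hx, hxU⟩, hxN⟩
    rw [abs_le] at h3
    rw [hg]
    simp only
    rw [← h4, min_eq_left h3.2, max_eq_right h3.1]
  refine ⟨g, hgL, fun x => (hgb x).trans (min_le_left _ _),
    fun x => (hgb x).trans (min_le_right _ _), ?_⟩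
  have hdiff := hfG.sub (isOpen_doubleCone m).measurableSet (hgL.hasWeakGradient _)
  have key : ∀ σ : ℝ, σ ≠ 0 → halfCone m σ ⊆ doubleCone m →
      ∀ᵐ x, x ∈ halfCone m σ → x ∈ Uᶜ → (G - gradient g) x = 0 := fun σ hσ hsub =>
    (hdiff.mono hsub).ae_eq_zero_of_ae_eq_zero (isOpen_halfCone m σ) (nonempty_halfCone m hσ)
      (fun x hx y hy s hs => add_smul_mem_halfCone hx hy hs) (hf.sub hgL.continuous.measurable)
      (hG.sub (measurable_gradient g)) hUm.compl
      (by
        filter_upwards [hfg] with x hx h1 h2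
        simp [hx (hsub h1) h2])
  have k1 := key 1 one_ne_zero (by rw [doubleCone_eq_union]; exact subset_union_left)
  have k2 := key (-1) (neg_ne_zero.2 one_ne_zero)
    (by rw [doubleCone_eq_union]; exact subset_union_right)
  filter_upwards [hfg, k1, k2] with x h1 h2 h3 hx hxU
  refine ⟨h1 hx hxU, ?_⟩
  rw [doubleCone_eq_union] at hx
  rcases hx with hx | hx
  · exact sub_eq_zero.1 (h2 hx hxU)
  · exact sub_eq_zero.1 (h3 hx hxU)

end Truncation

/-! ### Norms of extended nonnegative functions -/

section ENNRealNorm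

variable {α : Type*} {mα : MeasurableSpace α} {μ : Measure α}

theorem eLpNorm_le_mul_eLpNorm_of_ae_enorm_le {ε ε' : Type*} [TopologicalSpace ε]
    [ContinuousENorm ε] [TopologicalSpace ε'] [ContinuousENorm ε'] {f : α → ε} {g : α → ε'}
    {c : ℝ≥0∞} (hc : c ≠ ⊤) (h : ∀ᵐ x ∂μ, ‖f x‖ₑ ≤ c * ‖g x‖ₑ) (p : ℝ≥0∞) :
    eLpNorm f p μ ≤ c * eLpNorm g p μ := by
  lift c to ℝ≥0 using hc
  have h1 := eLpNorm_le_nnreal_smul_eLpNorm_of_ae_le_mul' h p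
  rwa [ENNReal.smul_def, smul_eq_mul] at h1

/-- Minkowski's inequality for series of nonnegative functions. -/
theorem eLpNorm_tsum_le {f : ℕ → α → ℝ≥0∞} (hf : ∀ j, Measurable (f j)) {p : ℝ≥0∞} (hp : 1 ≤ p) :
    eLpNorm (fun x => ∑' j, f j x) p μ ≤ ∑' j, eLpNorm (f j) p μ := by
  rcases eq_or_ne p ⊤ with rfl | hpt
  · simp only [eLpNorm_exponent_top]
    refine eLpNormEssSup_le_of_ae_enorm_bound ?_
    filter_upwards [ae_all_iff.2 fun j => ae_le_eLpNormEssSup (f := f j) (μ := μ)] with x hx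
    simp only [enorm_eq_self] at hx ⊢
    exact ENNReal.tsum_le_tsum hx
  have hp0 : p ≠ 0 := (zero_lt_one.trans_le hp).ne'
  have hpos : 0 < p.toReal := ENNReal.toReal_pos hp0 hpt
  have hmono : ∀ x, Monotone fun N : ℕ => ∑ j ∈ Finset.range N, f j x := fun x =>
    monotone_nat_of_le_succ fun N => by
      rw [Finset.sum_range_succ]
      exact le_self_add
  have hpow : ∀ x, ‖∑' j, f j x‖ₑ ^ p.toReal
      = ⨆ N : ℕ, (∑ j ∈ Finset.range N, f j x) ^ p.toReal := by
    intro x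
    rw [enorm_eq_self, ENNReal.tsum_eq_iSup_nat]
    exact (ENNReal.orderIsoRpow p.toReal hpos).map_iSup _
  rw [eLpNorm_eq_lintegral_rpow_enorm_toReal hp0 hpt]
  simp only [hpow]
  rw [lintegral_iSup
    (fun N => (Finset.measurable_sum _ fun j _ => hf j).pow_const _)
    (fun N M hNM x => ENNReal.rpow_le_rpow (hmono x hNM) hpos.le)]
  have hroot : (⨆ N : ℕ, ∫⁻ x, (∑ j ∈ Finset.range N, f j x) ^ p.toReal ∂μ) ^ (1 / p.toReal)
      = ⨆ N : ℕ, (∫⁻ x, (∑ j ∈ Finset.range N, f j x) ^ p.toReal ∂μ) ^ (1 / p.toReal) :=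
    (ENNReal.orderIsoRpow (1 / p.toReal) (by positivity)).map_iSup _
  rw [hroot]
  refine iSup_le fun N => ?_
  have h1 := eLpNorm_sum_le (s := Finset.range N) (f := f) (μ := μ)
    (fun j _ => (hf j).aestronglyMeasurable) hp
  rw [eLpNorm_eq_lintegral_rpow_enorm_toReal hp0 hpt] at h1
  simp only [Finset.sum_apply, enorm_eq_self] at h1
  exact h1.trans (ENNReal.sum_le_tsum _)

end ENNRealNorm

/-! ### The decreasing rearrangement -/

section Rearrangement

variable {α : Type*} {mα : MeasurableSpace α} {μ : Measure α} {F F₀ F₁ : α → ℝ≥0∞}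

/-- The decreasing rearrangement of `F`: the smallest level which `F` exceeds on a set of measure
at most `s` only. -/
noncomputable def decRearr (μ : Measure α) (F : α → ℝ≥0∞) (s : ℝ) : ℝ≥0∞ :=
  sInf {l | μ {x | l < F x} ≤ ENNReal.ofReal s}

theorem antitone_decRearr (μ : Measure α) (F : α → ℝ≥0∞) : Antitone (decRearr μ F) :=
  fun _ _ hst => sInf_le_sInf fun _ hl => le_trans hl (ENNReal.ofReal_le_ofReal hst)

theorem decRearr_le {l : ℝ≥0∞} {s : ℝ} (h : μ {x | l < F x} ≤ ENNReal.ofReal s) :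
    decRearr μ F s ≤ l := sInf_le h

theorem measure_decRearr_lt_le (μ : Measure α) (F : α → ℝ≥0∞) (s : ℝ) :
    μ {x | decRearr μ F s < F x} ≤ ENNReal.ofReal s := by
  obtain ⟨u, hu, hlim, hmem⟩ := exists_seq_tendsto_sInf
    (S := {l | μ {x | l < F x} ≤ ENNReal.ofReal s}) ⟨⊤, by simp⟩ (OrderBot.bddBelow _)
  have h1 : {x | decRearr μ F s < F x} = ⋃ n, {x | u n < F x} := by
    ext x
    simp only [mem_ofPred_eq, mem_iUnion]
    refine ⟨fun hx => ((hlim.eventually (gt_mem_nhds hx)).exists), ?_⟩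
    rintro ⟨n, hn⟩
    exact (sInf_le (hmem n)).trans_lt hn
  have hmono : Monotone fun n => {x | u n < F x} := fun a b hab x hx =>
    lt_of_le_of_lt (hu hab) hx
  rw [h1, hmono.measure_iUnion]
  exact iSup_le hmem

theorem lt_decRearr_iff {l : ℝ≥0∞} {s : ℝ} :
    l < decRearr μ F s ↔ ENNReal.ofReal s < μ {x | l < F x} := by
  constructor
  · intro h
    by_contra! hle
    exact absurd (decRearr_le hle) (not_le.2 h)
  · intro h
    by_contra! hle
    refine absurd ((measure_mono fun x hx => ?_).trans (measure_decRearr_lt_le μ F s)) (not_le.2 h)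
    exact lt_of_le_of_lt hle hx

theorem volume_Ioi_inter_ofReal_lt (y : ℝ≥0∞) :
    volume {u ∈ Ioi (0 : ℝ) | ENNReal.ofReal u < y} = y := by
  rcases eq_or_ne y ⊤ with rfl | hy
  · have : {u ∈ Ioi (0 : ℝ) | ENNReal.ofReal u < ⊤} = Ioi 0 := by ext; simp
    rw [this, Real.volume_Ioi]
  · have : {u ∈ Ioi (0 : ℝ) | ENNReal.ofReal u < y} = Ioo 0 y.toReal := by
      ext u
      simp only [mem_ofPred_eq, mem_Ioi, mem_Ioo]
      exact and_congr_right fun hu => ENNReal.ofReal_lt_iff_lt_toReal hu.le hy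
    rw [this, Real.volume_Ioo, sub_zero, ENNReal.ofReal_toReal hy]

/-- The layer cake formula for functions which may take the value `∞`. -/
theorem lintegral_eq_lintegral_measure_ofReal_lt [SFinite μ] (hF : Measurable F) :
    ∫⁻ x, F x ∂μ = ∫⁻ u in Ioi (0 : ℝ), μ {x | ENNReal.ofReal u < F x} := by
  have hm : MeasurableSet {q : α × ℝ | ENNReal.ofReal q.2 < F q.1} :=
    measurableSet_lt (by fun_prop) (hF.comp measurable_fst)
  have h1 := Measure.prod_apply (μ := μ) (ν := volume.restrict (Ioi (0 : ℝ))) hm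
  have h2 := Measure.prod_apply_symm (μ := μ) (ν := volume.restrict (Ioi (0 : ℝ))) hm
  rw [h1] at h2
  simp only [preimage_ofPred_eq] at h2
  rw [← h2]
  refine lintegral_congr fun x => ?_
  rw [Measure.restrict_apply (measurableSet_lt (by fun_prop) measurable_const)]
  conv_lhs => rw [← volume_Ioi_inter_ofReal_lt (F x)]
  congr 1
  ext u
  simp [and_comm]

/-- A function and its decreasing rearrangement have the same `L^p` norms. -/
theorem lintegral_decRearr_rpow [SFinite μ] (hF : Measurable F) {p : ℝ} (hp : 0 < p) :
    ∫⁻ s in Ioi (0 : ℝ), decRearr μ F s ^ p = ∫⁻ x, F x ^ p ∂μ := by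
  rw [lintegral_eq_lintegral_measure_ofReal_lt (hF.pow_const p),
    lintegral_eq_lintegral_measure_ofReal_lt
      ((antitone_decRearr μ F).measurable.pow_const p)]
  refine lintegral_congr fun u => ?_
  have h1 : ∀ y : ℝ≥0∞, ENNReal.ofReal u < y ^ p ↔ ENNReal.ofReal u ^ p⁻¹ < y := fun y => by
    rw [← ENNReal.rpow_lt_rpow_iff (z := p) (x := _ ^ p⁻¹) hp, ENNReal.rpow_inv_rpow hp.ne']
  simp only [h1]
  rw [Measure.restrict_apply (measurableSet_lt measurable_const (antitone_decRearr μ F).measurable)]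
  simp only [lt_decRearr_iff]
  conv_rhs => rw [← volume_Ioi_inter_ofReal_lt (μ {x | ENNReal.ofReal u ^ p⁻¹ < F x})]
  congr 1
  ext s
  simp [and_comm]

theorem decRearr_add_le (h : ∀ᵐ x ∂μ, F x ≤ F₀ x + F₁ x) {s s' : ℝ} (hs : 0 ≤ s) (hs' : 0 ≤ s') :
    decRearr μ F (s + s') ≤ decRearr μ F₀ s + decRearr μ F₁ s' := by
  apply decRearr_le
  rw [ENNReal.ofReal_add hs hs']
  refine le_trans ?_ (add_le_add (measure_decRearr_lt_le μ F₀ s) (measure_decRearr_lt_le μ F₁ s'))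
  refine le_trans (measure_mono_ae ?_) (measure_union_le _ _)
  filter_upwards [h] with x hx hlt
  have hlt' : decRearr μ F₀ s + decRearr μ F₁ s' < F x := hlt
  by_contra hnot
  have hnot' : ¬ (decRearr μ F₀ s < F₀ x ∨ decRearr μ F₁ s' < F₁ x) := hnot
  rw [not_or, not_lt, not_lt] at hnot'
  exact absurd (hlt'.trans_le (hx.trans (add_le_add hnot'.1 hnot'.2))) (lt_irrefl _)

/-- Chebyshev's inequality for the decreasing rearrangement. -/
theorem decRearr_le_rpow_mul_eLpNorm (hF : Measurable F) {q : ℝ≥0∞} (hq : 1 ≤ q) {s : ℝ}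
    (hs : 0 < s) :
    decRearr μ F s ≤ ENNReal.ofReal (s ^ (-q.toReal⁻¹)) * eLpNorm F q μ := by
  rcases eq_or_ne q ⊤ with rfl | hqt
  · simp only [ENNReal.toReal_top, inv_zero, neg_zero, Real.rpow_zero, ENNReal.ofReal_one, one_mul,
      eLpNorm_exponent_top]
    apply decRearr_le
    have : μ {x | eLpNormEssSup F μ < F x} = 0 := by
      have := ae_le_eLpNormEssSup (f := F) (μ := μ)
      simpa [ae_iff] using this
    rw [this]
    exact zero_le
  have hq0 : q ≠ 0 := (zero_lt_one.trans_le hq).ne'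
  have hpos : 0 < q.toReal := ENNReal.toReal_pos hq0 hqt
  refine le_of_forall_lt_imp_le_of_dense fun l hl => ?_
  rw [lt_decRearr_iff] at hl
  have h1 := mul_meas_ge_le_pow_eLpNorm' μ hq0 hqt hF.aestronglyMeasurable l
  simp only [enorm_eq_self] at h1
  have hsub : {x | l < F x} ⊆ {x | l ≤ F x} := by
    intro x hx
    rw [mem_ofPred_eq] at hx ⊢
    exact hx.le
  have h2 : l ^ q.toReal * ENNReal.ofReal s ≤ eLpNorm F q μ ^ q.toReal :=
    le_trans (mul_le_mul_right (hl.le.trans (measure_mono hsub)) _) h1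
  have h3 := ENNReal.rpow_le_rpow h2 (inv_nonneg.2 hpos.le)
  rw [ENNReal.mul_rpow_of_nonneg _ _ (inv_nonneg.2 hpos.le), ENNReal.rpow_rpow_inv hpos.ne',
    ENNReal.rpow_rpow_inv hpos.ne', ENNReal.ofReal_rpow_of_pos hs] at h3
  calc l = ENNReal.ofReal (s ^ (-q.toReal⁻¹)) * (l * ENNReal.ofReal (s ^ q.toReal⁻¹)) := by
        rw [mul_left_comm, ← ENNReal.ofReal_mul (by positivity), ← Real.rpow_add hs]
        simp
    _ ≤ _ := by gcongr

end Rearrangement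

/-! ### Scalar estimates for the real interpolation norm -/

section Scalar

variable {α : Type*} {mα : MeasurableSpace α} {μ : Measure α} {F : α → ℝ≥0∞}

/-- The measure `dt / t` on `(0, ∞)`. -/
noncomputable def haarIoi : Measure ℝ :=
  (volume.restrict (Ioi 0)).withDensity fun t : ℝ => ENNReal.ofReal t⁻¹

theorem ae_haarIoi {P : ℝ → Prop} (h : ∀ t, 0 < t → P t) : ∀ᵐ t ∂haarIoi, P t :=
  (withDensity_absolutelyContinuous _ _).ae_le
    ((ae_restrict_iff' measurableSet_Ioi).2 (Filter.Eventually.of_forall h))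

theorem lintegral_Ioi_comp_mul_rpow {b c : ℝ} (hb : 0 < b) (hc : 0 < c) (φ : ℝ → ℝ≥0∞) :
    ∫⁻ t in Ioi (0 : ℝ), ENNReal.ofReal (t ^ (b - 1)) * φ (c * t ^ b)
      = ENNReal.ofReal (b * c)⁻¹ * ∫⁻ s in Ioi (0 : ℝ), φ s := by
  have himage : (fun t : ℝ => c * t ^ b) '' Ioi 0 = Ioi 0 := by
    ext s
    constructor
    · rintro ⟨t, ht, rfl⟩
      exact mul_pos hc (Real.rpow_pos_of_pos ht b)
    · intro hs
      have hs' : 0 < s / c := div_pos hs hc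
      refine ⟨(s / c) ^ b⁻¹, Real.rpow_pos_of_pos hs' _, ?_⟩
      simp only
      rw [Real.rpow_inv_rpow hs'.le hb.ne', mul_div_cancel₀ _ hc.ne']
  have hinj : InjOn (fun t : ℝ => c * t ^ b) (Ioi 0) := by
    intro x hx y hy hxy
    exact (Real.rpow_left_inj (le_of_lt hx) (le_of_lt hy) hb.ne').1
      (mul_left_cancel₀ hc.ne' hxy)
  have h1 := lintegral_image_eq_lintegral_abs_deriv_mul measurableSet_Ioi
    (f' := fun t => c * (b * t ^ (b - 1)))
    (fun t ht => ((Real.hasDerivAt_rpow_const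
      (Or.inl (ne_of_gt (mem_Ioi.1 ht)))).const_mul c).hasDerivWithinAt) hinj φ
  rw [himage] at h1
  rw [h1, ← lintegral_const_mul' _ _ ENNReal.ofReal_ne_top]
  refine setLIntegral_congr_fun measurableSet_Ioi fun t ht => ?_
  have ht' : 0 < t := ht
  rw [← mul_assoc, ← ENNReal.ofReal_mul (by positivity),
    abs_of_pos (by positivity)]
  congr 2
  field_simp

/-- The norm of the dilated rearrangement: this is where the exponents of the interpolation
theorem have to match. -/
theorem eLpNorm_rpow_mul_decRearr [SFinite μ] (hF : Measurable F) {p : ℝ≥0∞} (hp0 : p ≠ 0)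
    (hp : p ≠ ⊤) {b c : ℝ} (hb : 0 < b) (hc : 0 < c) :
    eLpNorm (fun t : ℝ => ENNReal.ofReal (t ^ (b * p.toReal⁻¹)) * decRearr μ F (c * t ^ b)) p
        haarIoi = ENNReal.ofReal ((b * c)⁻¹ ^ p.toReal⁻¹) * eLpNorm F p μ := by
  have hpos : 0 < p.toReal := ENNReal.toReal_pos hp0 hp
  have hm : Measurable fun t : ℝ =>
      ENNReal.ofReal (t ^ (b * p.toReal⁻¹)) * decRearr μ F (c * t ^ b) :=
    (by fun_prop : Measurable fun t : ℝ => ENNReal.ofReal (t ^ (b * p.toReal⁻¹))).mul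
      ((antitone_decRearr μ F).measurable.comp (by fun_prop))
  rw [eLpNorm_eq_lintegral_rpow_enorm_toReal hp0 hp, eLpNorm_eq_lintegral_rpow_enorm_toReal hp0 hp]
  simp only [enorm_eq_self]
  rw [haarIoi, lintegral_withDensity_eq_lintegral_mul _ (by fun_prop) (hm.pow_const _),
    ← lintegral_decRearr_rpow hF hpos]
  have h1 : ∫⁻ t in Ioi (0 : ℝ), ((fun t : ℝ => ENNReal.ofReal t⁻¹) * fun t : ℝ =>
        (ENNReal.ofReal (t ^ (b * p.toReal⁻¹)) * decRearr μ F (c * t ^ b)) ^ p.toReal) t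
      = ∫⁻ t in Ioi (0 : ℝ), ENNReal.ofReal (t ^ (b - 1)) *
          (fun s => decRearr μ F s ^ p.toReal) (c * t ^ b) := by
    refine setLIntegral_congr_fun measurableSet_Ioi fun t ht => ?_
    have ht' : 0 < t := ht
    simp only [Pi.mul_apply]
    rw [ENNReal.mul_rpow_of_nonneg _ _ hpos.le, ENNReal.ofReal_rpow_of_pos (by positivity),
      ← Real.rpow_mul ht'.le, mul_assoc b, inv_mul_cancel₀ hpos.ne', mul_one, ← mul_assoc,
      ← ENNReal.ofReal_mul (by positivity), Real.rpow_sub_one ht'.ne', inv_mul_eq_div]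
  rw [h1, lintegral_Ioi_comp_mul_rpow hb hc fun s => decRearr μ F s ^ p.toReal,
    ENNReal.mul_rpow_of_nonneg _ _ (by positivity),
    ENNReal.ofReal_rpow_of_pos (by positivity), one_div]

theorem eLpNorm_indicator_decRearr_le {s : ℝ} (hs : 0 < s) (r : ℝ) (q : ℝ≥0∞) :
    eLpNorm ({x | decRearr μ F s < F x}.indicator fun _ => decRearr μ F r) q μ
      ≤ ENNReal.ofReal (s ^ q.toReal⁻¹) * decRearr μ F r := by
  refine (eLpNorm_indicator_const_le _ _).trans ?_
  rw [enorm_eq_self, one_div, mul_comm, ← ENNReal.ofReal_rpow_of_pos hs]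
  gcongr
  exact measure_decRearr_lt_le μ F s

/-- Dyadic estimate for the large values of a function. -/
theorem eLpNorm_indicator_decRearr_lt_le (hF : Measurable F) {q : ℝ≥0∞} (hq : 1 ≤ q) {s : ℝ}
    (hs : 0 < s) :
    eLpNorm ({x | decRearr μ F s < F x}.indicator F) q μ
      ≤ ∑' j : ℕ, ENNReal.ofReal (((1 / 2) ^ j * s) ^ q.toReal⁻¹)
        * decRearr μ F ((1 / 2) ^ (j + 1) * s) := by
  set E : ℕ → Set α := fun j => {x | decRearr μ F ((1 / 2) ^ j * s) < F x} with hE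
  have hEm : ∀ j, MeasurableSet (E j) := fun j => measurableSet_lt measurable_const hF
  have hnull : μ (⋂ j, E j) = 0 := by
    have hlim : Filter.Tendsto (fun j : ℕ => ENNReal.ofReal ((1 / 2) ^ j * s)) Filter.atTop
        (nhds 0) := by
      have h1 : Filter.Tendsto (fun j : ℕ => ((1 : ℝ) / 2) ^ j * s) Filter.atTop (nhds (0 * s)) :=
        (tendsto_pow_atTop_nhds_zero_of_lt_one (by norm_num) (by norm_num)).mul_const s
      have h2 := (ENNReal.continuous_ofReal.tendsto _).comp h1
      simpa [Function.comp_def] using h2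
    refine le_antisymm (ge_of_tendsto' hlim fun j => ?_) zero_le
    exact (measure_mono (iInter_subset E j)).trans (measure_decRearr_lt_le μ F _)
  have hae : ∀ᵐ x ∂μ, x ∉ ⋂ j, E j := compl_mem_ae_iff.2 hnull
  have hpt : ∀ᵐ x ∂μ, ‖{x | decRearr μ F s < F x}.indicator F x‖ₑ
      ≤ ‖∑' j : ℕ, (E j).indicator (fun _ => decRearr μ F ((1 / 2) ^ (j + 1) * s)) x‖ₑ := by
    filter_upwards [hae] with x hx
    simp only [enorm_eq_self]
    by_cases h0 : x ∈ {x | decRearr μ F s < F x}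
    · have hex : ∃ j, x ∉ E j := by simpa using hx
      classical
      set k := Nat.find hex with hk
      have hk0 : k ≠ 0 := by
        intro h
        have := Nat.find_spec hex
        rw [← hk, h] at this
        exact this (by simpa [hE] using h0)
      obtain ⟨i, hi⟩ := Nat.exists_eq_succ_of_ne_zero hk0
      have h1 : x ∈ E i := not_not.1 (Nat.find_min hex (m := i) (by omega))
      have h2 : x ∉ E (i + 1) := by
        have := Nat.find_spec hex
        rwa [← hk, hi] at this
      have h3 : F x ≤ decRearr μ F ((1 / 2) ^ (i + 1) * s) := not_lt.1 h2
      rw [indicator_of_mem h0]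
      refine h3.trans ?_
      refine le_trans ?_ (ENNReal.le_tsum i)
      rw [indicator_of_mem h1]
    · rw [indicator_of_notMem h0]
      exact zero_le
  refine (eLpNorm_mono_enorm_ae hpt).trans ?_
  refine (eLpNorm_tsum_le (fun j => measurable_const.indicator (hEm j)) hq).trans ?_
  refine ENNReal.tsum_le_tsum fun j => ?_
  exact eLpNorm_indicator_decRearr_le (by positivity) _ q

/-- Dyadic estimate for the small values of a function. -/
theorem eLpNorm_min_decRearr_le (hF : Measurable F) {p : ℝ≥0∞} (hp1 : 1 ≤ p) (hp : p ≠ ⊤)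
    (hFp : eLpNorm F p μ ≠ ⊤) {q : ℝ≥0∞} (hq : 1 ≤ q) {s : ℝ} (hs : 0 < s) :
    eLpNorm (fun x => min (F x) (decRearr μ F s)) q μ
      ≤ 2 * ∑' j : ℕ, ENNReal.ofReal ((2 ^ (j + 1) * s) ^ q.toReal⁻¹)
        * decRearr μ F (2 ^ j * s) := by
  have hp0 : p ≠ 0 := (zero_lt_one.trans_le hp1).ne'
  have hpos : 0 < p.toReal := ENNReal.toReal_pos hp0 hp
  set E : ℕ → Set α := fun j => {x | decRearr μ F (2 ^ j * s) < F x} with hE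
  have hEm : ∀ j, MeasurableSet (E j) := fun j => measurableSet_lt measurable_const hF
  have hlim : Filter.Tendsto (fun j : ℕ => decRearr μ F (2 ^ j * s)) Filter.atTop (nhds 0) := by
    have h1 : Filter.Tendsto (fun j : ℕ => ((2 : ℝ) ^ j * s) ^ (-p.toReal⁻¹)) Filter.atTop
        (nhds 0) :=
      (tendsto_rpow_neg_atTop (inv_pos.2 hpos)).comp
        ((tendsto_pow_atTop_atTop_of_one_lt one_lt_two).atTop_mul_const hs)
    have h2 := (ENNReal.continuous_ofReal.tendsto _).comp h1
    have h3 := ENNReal.Tendsto.mul_const h2 (Or.inr hFp)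
    simp only [ENNReal.ofReal_zero, zero_mul] at h3
    exact tendsto_of_tendsto_of_tendsto_of_le_of_le tendsto_const_nhds h3 (fun j => zero_le)
      fun j => decRearr_le_rpow_mul_eLpNorm hF hp1 (by positivity)
  have hpt : ∀ x, ‖min (F x) (decRearr μ F s)‖ₑ
      ≤ ‖((E 0).indicator (fun _ => decRearr μ F s) + fun x => ∑' j : ℕ,
          (E (j + 1)).indicator (fun _ => decRearr μ F (2 ^ j * s)) x) x‖ₑ := by
    intro x
    simp only [enorm_eq_self, Pi.add_apply]
    by_cases h0 : x ∈ E 0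
    · rw [indicator_of_mem h0]
      exact (min_le_right _ _).trans le_self_add
    refine (min_le_left _ _).trans (le_add_left ?_)
    by_cases hex : ∃ j, x ∈ E j
    · classical
      set k := Nat.find hex with hk
      have hk0 : k ≠ 0 := by
        intro h
        have := Nat.find_spec hex
        rw [← hk, h] at this
        exact h0 this
      obtain ⟨i, hi⟩ := Nat.exists_eq_succ_of_ne_zero hk0
      have h1 : x ∉ E i := Nat.find_min hex (m := i) (by omega)
      have h2 : x ∈ E (i + 1) := by
        have := Nat.find_spec hex
        rwa [← hk, hi] at this
      refine (not_lt.1 h1 : F x ≤ _).trans ?_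
      refine le_trans ?_ (ENNReal.le_tsum i)
      rw [indicator_of_mem h2]
    · have h1 : F x ≤ 0 := ge_of_tendsto' hlim fun j => by
        by_contra hj
        exact hex ⟨j, not_le.1 hj⟩
      exact h1.trans zero_le
  refine (eLpNorm_mono_enorm hpt).trans ?_
  refine (eLpNorm_add_le (measurable_const.indicator (hEm 0)).aestronglyMeasurable
    (Measurable.tsum fun j => measurable_const.indicator (hEm (j + 1))).aestronglyMeasurable
    hq).trans ?_
  rw [two_mul]
  gcongr ?_ + ?_
  · refine le_trans ?_ (ENNReal.le_tsum 0)
    have h1 := eLpNorm_indicator_decRearr_le (μ := μ) (F := F) (s := 2 ^ 0 * s)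
      (by positivity) s q
    refine h1.trans ?_
    simp only [pow_zero, one_mul, zero_add, pow_one]
    gcongr
    linarith
  · refine (eLpNorm_tsum_le (fun j => measurable_const.indicator (hEm (j + 1))) hq).trans ?_
    refine ENNReal.tsum_le_tsum fun j => ?_
    exact eLpNorm_indicator_decRearr_le (by positivity) _ q

theorem eLpNorm_tsum_rpow_mul_decRearr_le [SFinite μ] (hF : Measurable F) {p : ℝ≥0∞} (hp1 : 1 ≤ p)
    (hp : p ≠ ⊤) {b : ℝ} (hb : 0 < b) {c d : ℕ → ℝ} (hc : ∀ j, 0 < c j) (hd : ∀ j, 0 ≤ d j) :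
    eLpNorm (fun t : ℝ => ∑' j, ENNReal.ofReal (d j) *
        (ENNReal.ofReal (t ^ (b * p.toReal⁻¹)) * decRearr μ F (c j * t ^ b))) p haarIoi
      ≤ (∑' j, ENNReal.ofReal (d j * (b * c j)⁻¹ ^ p.toReal⁻¹)) * eLpNorm F p μ := by
  have hp0 : p ≠ 0 := (zero_lt_one.trans_le hp1).ne'
  have hm : ∀ j, Measurable fun t : ℝ => ENNReal.ofReal (d j) *
        (ENNReal.ofReal (t ^ (b * p.toReal⁻¹)) * decRearr μ F (c j * t ^ b)) := fun j =>
    ((by fun_prop : Measurable fun t : ℝ => ENNReal.ofReal (t ^ (b * p.toReal⁻¹))).mul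
      ((antitone_decRearr μ F).measurable.comp (by fun_prop))).const_mul _
  refine (eLpNorm_tsum_le hm hp1).trans ?_
  rw [← ENNReal.tsum_mul_right]
  refine ENNReal.tsum_le_tsum fun j => ?_
  rw [ENNReal.ofReal_mul (hd j), mul_assoc, ← eLpNorm_rpow_mul_decRearr hF hp0 hp hb (hc j)]
  exact eLpNorm_le_mul_eLpNorm_of_ae_enorm_le ENNReal.ofReal_ne_top
    (Filter.Eventually.of_forall fun t => by simp only [enorm_eq_self]; exact le_rfl) p

theorem tsum_ofReal_half_ne_top {a a₀ b : ℝ} (h : a < a₀) (hb : 0 < b) :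
    ∑' j : ℕ, ENNReal.ofReal (((1 / 2) ^ j) ^ a₀ * (b * (1 / 2) ^ (j + 1))⁻¹ ^ a) ≠ ⊤ := by
  have hr : ((1 : ℝ) / 2) ^ (a₀ - a) < 1 :=
    Real.rpow_lt_one (by norm_num) (by norm_num) (by linarith)
  refine Summable.tsum_ofReal_ne_top (Summable.congr
    ((summable_geometric_of_lt_one (by positivity) hr).mul_left ((b / 2)⁻¹ ^ a)) fun j => ?_)
  have hx : (0 : ℝ) < (1 / 2) ^ j := by positivity
  have e : (b * (1 / 2) ^ (j + 1))⁻¹ = (b / 2)⁻¹ * ((1 / 2) ^ j)⁻¹ := by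
    rw [pow_succ, ← mul_inv]; congr 1; ring
  rw [e, Real.mul_rpow (by positivity) (by positivity), Real.inv_rpow hx.le, Real.rpow_pow_comm
    (by norm_num), Real.rpow_sub hx]
  field_simp

theorem tsum_ofReal_two_ne_top {a a₁ b : ℝ} (h : a₁ < a) (hb : 0 < b) :
    ∑' j : ℕ, ENNReal.ofReal ((2 ^ (j + 1)) ^ a₁ * (b * 2 ^ j)⁻¹ ^ a) ≠ ⊤ := by
  have hr : (2 : ℝ) ^ (a₁ - a) < 1 := Real.rpow_lt_one_of_one_lt_of_neg one_lt_two (by linarith)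
  refine Summable.tsum_ofReal_ne_top (Summable.congr
    ((summable_geometric_of_lt_one (by positivity) hr).mul_left (2 ^ a₁ * b⁻¹ ^ a)) fun j => ?_)
  have hx : (0 : ℝ) < 2 ^ j := by positivity
  rw [pow_succ, mul_comm (2 ^ j : ℝ) 2, Real.mul_rpow (by positivity) (by positivity), mul_inv,
    Real.mul_rpow (by positivity) (by positivity), Real.inv_rpow hx.le, Real.rpow_pow_comm
    (by norm_num), Real.rpow_sub hx]
  field_simp

/-- The interpolation norm of a functional which is dominated by the decomposition of `F` at the
height of its rearrangement. -/
theorem exists_eLpNorm_le_of_le_decRearr [SFinite μ] {p₀ p₁ p : ℝ≥0∞} {θ : ℝ} (hp₀ : 1 ≤ p₀)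
    (hp₁ : 1 ≤ p₁) (hp1 : 1 ≤ p) (hp : p ≠ ⊤) (h₀ : p.toReal⁻¹ < p₀.toReal⁻¹)
    (h₁ : p₁.toReal⁻¹ < p.toReal⁻¹)
    (hθ : p.toReal⁻¹ = (1 - θ) * p₀.toReal⁻¹ + θ * p₁.toReal⁻¹) :
    ∃ C : ℝ≥0∞, C ≠ ⊤ ∧ ∀ F : α → ℝ≥0∞, Measurable F → eLpNorm F p μ ≠ ⊤ → ∀ k : ℝ → ℝ≥0∞,
      (∀ t, 0 < t → k t ≤
        eLpNorm ({x | decRearr μ F (t ^ (p₀.toReal⁻¹ - p₁.toReal⁻¹)⁻¹) < F x}.indicator F) p₀ μ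
        + ENNReal.ofReal t * eLpNorm
          (fun x => min (F x) (decRearr μ F (t ^ (p₀.toReal⁻¹ - p₁.toReal⁻¹)⁻¹))) p₁ μ
        + ENNReal.ofReal ((t ^ (p₀.toReal⁻¹ - p₁.toReal⁻¹)⁻¹) ^ p₀.toReal⁻¹)
          * decRearr μ F (t ^ (p₀.toReal⁻¹ - p₁.toReal⁻¹)⁻¹)) →
      eLpNorm (fun t : ℝ => ENNReal.ofReal (t ^ (-θ)) * k t) p haarIoi ≤ C * eLpNorm F p μ := by
  set a₀ := p₀.toReal⁻¹ with ha₀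
  set a₁ := p₁.toReal⁻¹ with ha₁
  set a := p.toReal⁻¹ with ha
  set b := (a₀ - a₁)⁻¹ with hb
  have hb0 : 0 < b := inv_pos.2 (by linarith)
  have hb1 : b * (a₀ - a₁) = 1 := inv_mul_cancel₀ (by linarith)
  have ha1 : 0 ≤ a₁ := by positivity
  set c : ℕ → ℝ := fun j => (1 / 2) ^ (j + 1)
  set d : ℕ → ℝ := fun j => ((1 / 2) ^ j) ^ a₀
  set c' : ℕ → ℝ := fun j => 2 ^ j
  set d' : ℕ → ℝ := fun j => (2 ^ (j + 1)) ^ a₁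
  refine ⟨(∑' j, ENNReal.ofReal (d j * (b * c j)⁻¹ ^ a))
    + 3 * (∑' j, ENNReal.ofReal (d' j * (b * c' j)⁻¹ ^ a)),
    ENNReal.add_ne_top.2 ⟨tsum_ofReal_half_ne_top h₀ hb0,
      ENNReal.mul_ne_top (by simp) (tsum_ofReal_two_ne_top h₁ hb0)⟩, ?_⟩
  intro F hF hFp k hk
  set A : ℝ → ℝ≥0∞ := fun t => ∑' j, ENNReal.ofReal (d j) *
        (ENNReal.ofReal (t ^ (b * a)) * decRearr μ F (c j * t ^ b)) with hA
  set B : ℝ → ℝ≥0∞ := fun t => ∑' j, ENNReal.ofReal (d' j) *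
        (ENNReal.ofReal (t ^ (b * a)) * decRearr μ F (c' j * t ^ b)) with hB
  have hm : ∀ x y : ℝ, Measurable fun t : ℝ => ENNReal.ofReal x *
        (ENNReal.ofReal (t ^ (b * a)) * decRearr μ F (y * t ^ b)) := fun x y =>
    ((by fun_prop : Measurable fun t : ℝ => ENNReal.ofReal (t ^ (b * a))).mul
      ((antitone_decRearr μ F).measurable.comp (by fun_prop))).const_mul _
  have hAm : Measurable A := Measurable.tsum fun j => hm _ _
  have hBm : Measurable B := Measurable.tsum fun j => hm _ _
  have hpt : ∀ t, 0 < t → ENNReal.ofReal (t ^ (-θ)) * k t ≤ A t + 3 * B t := by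
    intro t ht
    set s := t ^ b with hs
    have hs0 : 0 < s := Real.rpow_pos_of_pos ht b
    -- the powers of `t` combine because of the choice of `b`
    have e1 : t ^ (-θ) * s ^ a₀ = t ^ (b * a) := by
      rw [hs, ← Real.rpow_mul ht.le, ← Real.rpow_add ht]
      congr 1
      rw [hθ]
      linear_combination θ * hb1
    have e2 : t * s ^ a₁ = s ^ a₀ := by
      rw [hs, ← Real.rpow_mul ht.le, ← Real.rpow_mul ht.le]
      nth_rewrite 1 [← Real.rpow_one t]
      rw [← Real.rpow_add ht]
      congr 1
      linear_combination -hb1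
    have hAt : ENNReal.ofReal (t ^ (-θ)) * eLpNorm ({x | decRearr μ F s < F x}.indicator F) p₀ μ
        ≤ A t := by
      refine (mul_le_mul_right (eLpNorm_indicator_decRearr_lt_le hF hp₀ hs0) _).trans ?_
      rw [← ENNReal.tsum_mul_left]
      refine ENNReal.tsum_le_tsum fun j => le_of_eq ?_
      rw [← e1, Real.mul_rpow (by positivity) hs0.le, ENNReal.ofReal_mul (by positivity),
        ENNReal.ofReal_mul (by positivity)]
      ring
    have hBt : ENNReal.ofReal (t ^ (-θ)) * (ENNReal.ofReal t *
        eLpNorm (fun x => min (F x) (decRearr μ F s)) p₁ μ) ≤ 2 * B t := by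
      refine (mul_le_mul_right (mul_le_mul_right
        (eLpNorm_min_decRearr_le hF hp1 hp hFp hp₁ hs0) _) _).trans ?_
      rw [mul_left_comm _ 2, mul_left_comm _ 2]
      gcongr
      rw [← ENNReal.tsum_mul_left, ← ENNReal.tsum_mul_left]
      refine ENNReal.tsum_le_tsum fun j => le_of_eq ?_
      rw [← e1, ← e2, Real.mul_rpow (by positivity) hs0.le, ENNReal.ofReal_mul (by positivity),
        ENNReal.ofReal_mul (by positivity), ENNReal.ofReal_mul (by positivity)]
      ring
    have hCt : ENNReal.ofReal (t ^ (-θ)) * (ENNReal.ofReal (s ^ a₀) * decRearr μ F s) ≤ B t := by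
      refine le_trans ?_ (ENNReal.le_tsum 0)
      rw [← mul_assoc, ← ENNReal.ofReal_mul (by positivity), e1]
      simp only [c', d', pow_zero, one_mul, zero_add, pow_one]
      refine le_mul_of_one_le_left zero_le ?_
      rw [ENNReal.one_le_ofReal]
      exact Real.one_le_rpow one_le_two ha1
    calc ENNReal.ofReal (t ^ (-θ)) * k t ≤ _ := mul_le_mul_right (hk t ht) _
      _ ≤ A t + 2 * B t + B t := by
        rw [mul_add, mul_add]
        exact add_le_add (add_le_add hAt hBt) hCt
      _ = A t + 3 * B t := by ring
  calc eLpNorm (fun t : ℝ => ENNReal.ofReal (t ^ (-θ)) * k t) p haarIoi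
      ≤ eLpNorm (A + fun t => 3 * B t) p haarIoi :=
        eLpNorm_mono_enorm_ae (ae_haarIoi fun t ht => by
          simpa only [enorm_eq_self, Pi.add_apply] using hpt t ht)
    _ ≤ eLpNorm A p haarIoi + eLpNorm (fun t => 3 * B t) p haarIoi :=
        eLpNorm_add_le hAm.aestronglyMeasurable (hBm.const_mul 3).aestronglyMeasurable hp1
    _ ≤ eLpNorm A p haarIoi + 3 * eLpNorm B p haarIoi := by
        gcongr
        exact eLpNorm_le_mul_eLpNorm_of_ae_enorm_le (by simp)
          (Filter.Eventually.of_forall fun t => by simp only [enorm_eq_self]; exact le_rfl) p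
    _ ≤ _ := by
        rw [add_mul, mul_assoc]
        gcongr
        · exact eLpNorm_tsum_rpow_mul_decRearr_le hF hp1 hp hb0 (fun j => by positivity)
            fun j => by positivity
        · exact eLpNorm_tsum_rpow_mul_decRearr_le hF hp1 hp hb0 (fun j => by positivity)
            fun j => by positivity

end Scalar

/-! ### The size function and the norms -/

section Size

variable {m : ℕ} {f : EuclideanSpace ℝ (Fin (m + 1)) → ℝ}
  {G : EuclideanSpace ℝ (Fin (m + 1)) → EuclideanSpace ℝ (Fin (m + 1))} {p : ℝ≥0∞}

/-- The function `|f| + |f| / r + |G|` on the double cone, extended by zero, whose `L^p` norm is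
equivalent to the norm of `f` if `G` is its gradient. -/
noncomputable def coneSize (f : EuclideanSpace ℝ (Fin (m + 1)) → ℝ)
    (G : EuclideanSpace ℝ (Fin (m + 1)) → EuclideanSpace ℝ (Fin (m + 1))) :
    EuclideanSpace ℝ (Fin (m + 1)) → ℝ≥0∞ :=
  (doubleCone m).indicator fun x => ‖f x‖ₑ + ‖f x / ‖x‖‖ₑ + ‖G x‖ₑ

theorem measurableSet_doubleCone (m : ℕ) : MeasurableSet (doubleCone m) :=
  (isOpen_doubleCone m).measurableSet

theorem coneSize_of_mem {x : EuclideanSpace ℝ (Fin (m + 1))} (hx : x ∈ doubleCone m) :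
    coneSize f G x = ‖f x‖ₑ + ‖f x / ‖x‖‖ₑ + ‖G x‖ₑ := indicator_of_mem hx _

theorem measurable_coneSize (hf : Measurable f) (hG : Measurable G) :
    Measurable (coneSize f G) :=
  ((hf.enorm.add (hf.div measurable_norm).enorm).add hG.enorm).indicator
    (measurableSet_doubleCone m)

theorem ae_cone {P : EuclideanSpace ℝ (Fin (m + 1)) → Prop} (h : ∀ x ∈ doubleCone m, P x) :
    ∀ᵐ x ∂(volume.restrict (doubleCone m)), P x :=
  (ae_restrict_iff' (measurableSet_doubleCone m)).2 (Filter.Eventually.of_forall h)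

theorem eLpNorm_le_eLpNorm_coneSize :
    eLpNorm f p (volume.restrict (doubleCone m))
      ≤ eLpNorm (coneSize f G) p (volume.restrict (doubleCone m)) :=
  eLpNorm_mono_enorm_ae (ae_cone fun x hx => by
    rw [enorm_eq_self, coneSize_of_mem hx, add_assoc]; exact le_self_add)

theorem eLpNorm_div_norm_le_eLpNorm_coneSize :
    eLpNorm (fun x => f x / ‖x‖) p (volume.restrict (doubleCone m))
      ≤ eLpNorm (coneSize f G) p (volume.restrict (doubleCone m)) :=
  eLpNorm_mono_enorm_ae (ae_cone fun x hx => by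
    rw [enorm_eq_self, coneSize_of_mem hx, add_right_comm]; exact le_add_self)

theorem eLpNorm_grad_le_eLpNorm_coneSize :
    eLpNorm G p (volume.restrict (doubleCone m))
      ≤ eLpNorm (coneSize f G) p (volume.restrict (doubleCone m)) :=
  eLpNorm_mono_enorm_ae (ae_cone fun x hx => by
    rw [enorm_eq_self, coneSize_of_mem hx]; exact le_add_self)

theorem eLpNorm_coneSize_le (hf : Measurable f) (hG : Measurable G) (hp : 1 ≤ p) :
    eLpNorm (coneSize f G) p (volume.restrict (doubleCone m))
      ≤ eLpNorm f p (volume.restrict (doubleCone m))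
        + eLpNorm (fun x => f x / ‖x‖) p (volume.restrict (doubleCone m))
        + eLpNorm G p (volume.restrict (doubleCone m)) := by
  have hd : Measurable fun x => ‖f x / ‖x‖‖ₑ := (hf.div measurable_norm).enorm
  calc eLpNorm (coneSize f G) p (volume.restrict (doubleCone m))
      ≤ eLpNorm (((fun x => ‖f x‖ₑ) + fun x => ‖f x / ‖x‖‖ₑ) + fun x => ‖G x‖ₑ) p
          (volume.restrict (doubleCone m)) :=
        eLpNorm_mono_enorm_ae (ae_cone fun x hx => by
          rw [enorm_eq_self, coneSize_of_mem hx, enorm_eq_self]; rfl)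
    _ ≤ _ := by
        refine (eLpNorm_add_le (hf.enorm.add hd).aestronglyMeasurable
          hG.enorm.aestronglyMeasurable hp).trans ?_
        rw [eLpNorm_enorm]
        gcongr
        refine (eLpNorm_add_le hf.enorm.aestronglyMeasurable hd.aestronglyMeasurable hp).trans ?_
        rw [eLpNorm_enorm, eLpNorm_enorm]

theorem sobolevNorm_eq {f : EuclideanSpace ℝ (Fin (m + 1)) → ℝ}
    (h : HasWeakGradient (doubleCone m) f G) :
    sobolevNorm (doubleCone m) p f = eLpNorm f p (volume.restrict (doubleCone m))
      + eLpNorm G p (volume.restrict (doubleCone m)) := by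
  rw [sobolevNorm]
  congr 1
  refine le_antisymm (iInf₂_le G h) (le_iInf₂ fun G' h' => ?_)
  rw [eLpNorm_congr_ae (h.ae_eq (isOpen_doubleCone m) h')]

theorem coneHTildeNorm_le {f : ConeFun m} (h : HasWeakGradient (doubleCone m) f G) :
    coneHTildeNorm m p f
      ≤ 3 * eLpNorm (coneSize f G) p (volume.restrict (doubleCone m)) := by
  rw [coneHTildeNorm, sobolevNorm_eq h]
  calc _ ≤ eLpNorm (coneSize f G) p (volume.restrict (doubleCone m))
        + eLpNorm (coneSize f G) p (volume.restrict (doubleCone m))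
        + eLpNorm (coneSize f G) p (volume.restrict (doubleCone m)) :=
      add_le_add (add_le_add eLpNorm_le_eLpNorm_coneSize eLpNorm_grad_le_eLpNorm_coneSize)
        eLpNorm_div_norm_le_eLpNorm_coneSize
    _ = _ := by ring

theorem eLpNorm_coneSize_le_coneHTildeNorm {f : ConeFun m} (hG : Measurable G)
    (h : HasWeakGradient (doubleCone m) f G) (hp : 1 ≤ p) :
    eLpNorm (coneSize f G) p (volume.restrict (doubleCone m)) ≤ coneHTildeNorm m p f := by
  rw [coneHTildeNorm, sobolevNorm_eq h, add_right_comm]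
  exact eLpNorm_coneSize_le f.stronglyMeasurable.measurable hG hp

theorem exists_measurable_hasWeakGradient {f : EuclideanSpace ℝ (Fin (m + 1)) → ℝ}
    (h : HasWeakGradient (doubleCone m) f G) (hG : MemLp G p (volume.restrict (doubleCone m))) :
    ∃ G', Measurable G' ∧ HasWeakGradient (doubleCone m) f G' ∧
      MemLp G' p (volume.restrict (doubleCone m)) :=
  ⟨hG.1.mk G, hG.1.stronglyMeasurable_mk.measurable,
    h.congr Filter.EventuallyEq.rfl hG.1.ae_eq_mk, hG.ae_eq hG.1.ae_eq_mk⟩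

/-- Members of the space have a gradient, for `p = ∞` because of Rademacher's theorem. -/
theorem exists_hasWeakGradient_of_mem_coneHTilde {f : ConeFun m} (hf : f ∈ coneHTilde m p) :
    ∃ G, Measurable G ∧ HasWeakGradient (doubleCone m) f G ∧
      MemLp f p (volume.restrict (doubleCone m)) ∧
      MemLp (fun x => f x / ‖x‖) p (volume.restrict (doubleCone m)) ∧
      MemLp G p (volume.restrict (doubleCone m)) := by
  obtain ⟨hfH, hdiv⟩ := hf
  rcases hfH with ⟨-, ⟨hfp, G, hfG, hGp⟩, -⟩ | ⟨rfl, ⟨K, u, hu, hfu⟩, hftop⟩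
  · obtain ⟨G', h1, h2, h3⟩ := exists_measurable_hasWeakGradient hfG hGp
    exact ⟨G', h1, h2, hfp, hdiv, h3⟩
  · obtain ⟨v, hv, huv⟩ := hu.extend_real
    have hfv : v =ᵐ[volume.restrict (doubleCone m)] f := by
      filter_upwards [hfu, ae_restrict_mem (measurableSet_doubleCone m)] with x hx hxO
      rw [hx, huv (subset_closure hxO)]
    exact ⟨gradient v, measurable_gradient v,
      (hv.hasWeakGradient _).congr hfv Filter.EventuallyEq.rfl, hftop, hdiv,
      memLp_top_of_bound (measurable_gradient v).aestronglyMeasurable K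
        (Filter.Eventually.of_forall hv.norm_gradient_le)⟩

theorem eLpNorm_coneSize_lt_top (hf : Measurable f) (hG : Measurable G) (hp : 1 ≤ p)
    (hfp : MemLp f p (volume.restrict (doubleCone m)))
    (hdiv : MemLp (fun x => f x / ‖x‖) p (volume.restrict (doubleCone m)))
    (hGp : MemLp G p (volume.restrict (doubleCone m))) :
    eLpNorm (coneSize f G) p (volume.restrict (doubleCone m)) < ⊤ :=
  (eLpNorm_coneSize_le hf hG hp).trans_lt
    (ENNReal.add_lt_top.2 ⟨ENNReal.add_lt_top.2 ⟨hfp.2, hdiv.2⟩, hGp.2⟩)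

/-- The truncation of `f` at height `l`, with the norms of both parts. The number `x` is the
measure of a set which contains all points where the size or one of its averages exceeds `l`. -/
theorem exists_truncation_eLpNorm_le (m : ℕ) :
    ∃ C : ℝ≥0, ∀ (f : EuclideanSpace ℝ (Fin (m + 1)) → ℝ)
      (G : EuclideanSpace ℝ (Fin (m + 1)) → EuclideanSpace ℝ (Fin (m + 1))),
      Measurable f → Measurable G → HasWeakGradient (doubleCone m) f G → ∀ l : ℝ≥0, l ≠ 0 →
      ∃ (g : EuclideanSpace ℝ (Fin (m + 1)) → ℝ) (K : ℝ≥0) (x : ℝ≥0∞), LipschitzWith K g ∧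
        (∀ x, |g x| ≤ l) ∧ (∀ x, |g x| ≤ l * ‖x‖) ∧
        (∀ q : ℝ≥0∞, 1 ≤ q → q ≠ ⊤ → l * x ^ q.toReal⁻¹ ≤ C *
          eLpNorm ({x | l / 2 < coneSize f G x}.indicator (coneSize f G)) q
            (volume.restrict (doubleCone m))) ∧
        (∀ q : ℝ≥0∞, 1 ≤ q → q ≠ ⊤ → eLpNorm (coneSize (f - g) (G - gradient g)) q
          (volume.restrict (doubleCone m)) ≤ C *
          eLpNorm ({x | l / 2 < coneSize f G x}.indicator (coneSize f G)) q
            (volume.restrict (doubleCone m))) ∧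
        ∀ q : ℝ≥0∞, 1 ≤ q → eLpNorm (coneSize g (gradient g)) q
          (volume.restrict (doubleCone m)) ≤ C * (eLpNorm (fun x => min (coneSize f G x) l) q
            (volume.restrict (doubleCone m)) + l * x ^ q.toReal⁻¹) := by
  obtain ⟨C₀, hC₀, htrunc⟩ := exists_lipschitz_truncation m
  set C₁ : ℝ≥0 := 2 * (2 * 5 ^ (m + 1) + 1) with hC₁
  refine ⟨1 + 4 * C₀ * C₁ + C₁ + 3 * C₀, ?_⟩
  intro f G hf hG hfG l hl
  set μ := volume.restrict (doubleCone m) with hμ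
  set F := coneSize f G with hF
  have hFm : Measurable F := measurable_coneSize hf hG
  obtain ⟨U, hUm, hUq, hUx⟩ := exists_measurableSet_rpow_measure_le
    (volume : Measure (EuclideanSpace ℝ (Fin (m + 1)))) hFm
    (l := l) (by exact_mod_cast hl) ENNReal.coe_ne_top
  obtain ⟨g, hgL, hgl, hglr, hgae⟩ := htrunc f G F hf hG hFm hfG (fun x hx => by
    rw [hF, coneSize_of_mem hx]
    exact ⟨by rw [add_assoc]; exact le_self_add, le_add_self,
      by rw [add_right_comm]; exact le_add_self⟩) l U hUm hUx
  have hAm : MeasurableSet {x | (l : ℝ≥0∞) / 2 < F x} := measurableSet_lt measurable_const hFm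
  set y : ℝ≥0∞ → ℝ≥0∞ := fun q => eLpNorm ({x | (l : ℝ≥0∞) / 2 < F x}.indicator F) q μ with hy
  have hU : ∀ q : ℝ≥0∞, 1 ≤ q → q ≠ ⊤ → l * volume U ^ q.toReal⁻¹ ≤ C₁ * y q := by
    intro q hq hqt
    have hq0 : q ≠ 0 := (zero_lt_one.trans_le hq).ne'
    have hq1 : 1 ≤ q.toReal := by
      rw [← ENNReal.toReal_one]; exact ENNReal.toReal_mono hqt hq
    refine (hUq q.toReal hq1).trans ?_
    rw [finrank_euclideanSpace, Fintype.card_fin]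
    have e : (C₁ : ℝ≥0∞) = 2 * (2 * 5 ^ (m + 1) + 1) := by rw [hC₁]; push_cast; rfl
    rw [e, hy]
    simp only
    rw [eLpNorm_eq_lintegral_rpow_enorm_toReal hq0 hqt, one_div]
    refine mul_le_mul_right (ENNReal.rpow_le_rpow ?_ (by positivity)) _
    rw [← lintegral_indicator hAm, hμ, ← lintegral_indicator (measurableSet_doubleCone m)]
    refine lintegral_mono fun x => ?_
    by_cases hx : x ∈ {x | (l : ℝ≥0∞) / 2 < F x}
    · have hxO : x ∈ doubleCone m := by
        by_contra hxO
        have : F x = 0 := indicator_of_notMem hxO _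
        rw [mem_ofPred_eq, this] at hx
        exact not_lt_zero hx
      rw [indicator_of_mem hx, indicator_of_mem hxO, indicator_of_mem hx, enorm_eq_self]
    · rw [indicator_of_notMem hx]
      exact zero_le
  have hgb : ∀ x, ‖g x‖ₑ ≤ l := fun x => by
    rw [enorm_le_coe, ← NNReal.coe_le_coe, coe_nnnorm]
    exact hgl x
  have hgrb : ∀ x ∈ doubleCone m, ‖g x / ‖x‖‖ₑ ≤ l := fun x hx => by
    have h0 : 0 < ‖x‖ := norm_pos_iff.2 (ne_zero_of_mem_doubleCone hx)
    rw [enorm_le_coe, ← NNReal.coe_le_coe, coe_nnnorm, norm_div, norm_norm, div_le_iff₀ h0]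
    exact hglr x
  have hggb : ∀ x, ‖gradient g x‖ₑ ≤ C₀ * l := fun x => by
    rw [← ENNReal.coe_mul, enorm_le_coe, ← NNReal.coe_le_coe, coe_nnnorm]
    exact hgL.norm_gradient_le x
  have hlC : (l : ℝ≥0∞) ≤ C₀ * l := le_mul_of_one_le_left zero_le (by exact_mod_cast hC₀)
  have hae : ∀ᵐ x ∂μ, x ∉ U → f x = g x ∧ G x = gradient g x :=
    (ae_restrict_iff' (measurableSet_doubleCone m)).2 hgae
  have hindU : ∀ (c q : ℝ≥0∞), eLpNorm (U.indicator fun _ => c) q μ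
      ≤ c * volume U ^ q.toReal⁻¹ := fun c q => by
    refine (eLpNorm_indicator_const_le _ _).trans ?_
    rw [enorm_eq_self, one_div]
    exact mul_le_mul_right (ENNReal.rpow_le_rpow (Measure.restrict_apply_le _ _) (by positivity)) _
  refine ⟨g, C₀ * l, volume U, hgL, hgl, hglr, fun q hq hqt => (hU q hq hqt).trans ?_,
    fun q hq hqt => ?_, fun q hq => ?_⟩
  · gcongr
    exact le_add_right le_add_self
  · have hpt : ∀ᵐ x ∂μ, ‖coneSize (f - g) (G - gradient g) x‖ₑ
        ≤ ‖({x | (l : ℝ≥0∞) / 2 < F x}.indicator F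
            + U.indicator fun _ => (4 * C₀ * l : ℝ≥0∞)) x‖ₑ := by
      filter_upwards [hae, ae_restrict_mem (measurableSet_doubleCone m)] with x hx hxO
      rw [enorm_eq_self, enorm_eq_self, coneSize_of_mem hxO]
      by_cases hxU : x ∈ U
      · have h1 : F x ≤ {x | (l : ℝ≥0∞) / 2 < F x}.indicator F x + l := by
          by_cases hxA : x ∈ {x | (l : ℝ≥0∞) / 2 < F x}
          · rw [indicator_of_mem hxA]; exact le_self_add
          · exact le_add_left ((not_lt.1 hxA).trans ENNReal.half_le_self)
        have h2 : ‖(f - g) x / ‖x‖‖ₑ ≤ ‖f x / ‖x‖‖ₑ + ‖g x / ‖x‖‖ₑ := by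
          rw [Pi.sub_apply, sub_div]; exact enorm_sub_le
        simp only [Pi.add_apply, indicator_of_mem hxU]
        calc ‖(f - g) x‖ₑ + ‖(f - g) x / ‖x‖‖ₑ + ‖(G - gradient g) x‖ₑ
            ≤ (‖f x‖ₑ + ‖g x‖ₑ) + (‖f x / ‖x‖‖ₑ + ‖g x / ‖x‖‖ₑ)
              + (‖G x‖ₑ + ‖gradient g x‖ₑ) :=
              add_le_add (add_le_add enorm_sub_le h2) enorm_sub_le
          _ = F x + (‖g x‖ₑ + ‖g x / ‖x‖‖ₑ + ‖gradient g x‖ₑ) := by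
              rw [hF, coneSize_of_mem hxO]; ring
          _ ≤ ({x | (l : ℝ≥0∞) / 2 < F x}.indicator F x + C₀ * l)
              + (C₀ * l + C₀ * l + C₀ * l) := by
              gcongr
              · exact h1.trans (by gcongr)
              · exact (hgb x).trans hlC
              · exact (hgrb x hxO).trans hlC
              · exact hggb x
          _ = _ := by ring
      · obtain ⟨h1, h2⟩ := hx hxU
        simp [h1, h2]
    refine (eLpNorm_mono_enorm_ae hpt).trans ?_
    refine (eLpNorm_add_le (hFm.indicator hAm).aestronglyMeasurable
      (measurable_const.indicator hUm).aestronglyMeasurable hq).trans ?_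
    calc y q + eLpNorm (U.indicator fun _ => 4 * C₀ * (l : ℝ≥0∞)) q μ
        ≤ y q + 4 * C₀ * (C₁ * y q) := by
          gcongr
          refine (hindU _ _).trans ?_
          rw [mul_assoc (4 * C₀ : ℝ≥0∞)]
          exact mul_le_mul_right (hU q hq hqt) _
      _ = (1 + 4 * C₀ * C₁ : ℝ≥0) * y q := by push_cast; ring
      _ ≤ _ := by
          refine mul_le_mul_left (ENNReal.coe_le_coe.2 ?_) _
          rw [add_assoc]
          exact le_self_add
  · have hpt : ∀ᵐ x ∂μ, ‖coneSize g (gradient g) x‖ₑ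
        ≤ ‖((fun x => min (F x) l) + U.indicator fun _ => (3 * C₀ * l : ℝ≥0∞)) x‖ₑ := by
      filter_upwards [hae, ae_restrict_mem (measurableSet_doubleCone m)] with x hx hxO
      rw [enorm_eq_self, enorm_eq_self]
      by_cases hxU : x ∈ U
      · simp only [Pi.add_apply, indicator_of_mem hxU]
        refine le_add_left ?_
        rw [coneSize_of_mem hxO]
        calc _ ≤ C₀ * (l : ℝ≥0∞) + C₀ * l + C₀ * l := by
              gcongr
              · exact (hgb x).trans hlC
              · exact (hgrb x hxO).trans hlC
              · exact hggb x
          _ = _ := by ring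
      · obtain ⟨h1, h2⟩ := hx hxU
        refine le_add_right ?_
        have h3 : coneSize g (gradient g) x = F x := by
          rw [hF, coneSize_of_mem hxO, coneSize_of_mem hxO, h1, h2]
        simp only [h3]
        exact le_min le_rfl (hUx x hxU).1
    refine (eLpNorm_mono_enorm_ae hpt).trans ?_
    refine (eLpNorm_add_le (hFm.min measurable_const).aestronglyMeasurable
      (measurable_const.indicator hUm).aestronglyMeasurable hq).trans ?_
    have h1C : (1 : ℝ≥0) ≤ 1 + 4 * C₀ * C₁ + C₁ + 3 * C₀ := by
      rw [add_assoc, add_assoc]; exact le_self_add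
    rw [mul_add]
    gcongr ?_ + ?_
    · exact le_mul_of_one_le_left zero_le (by exact_mod_cast h1C)
    · refine (hindU _ _).trans ?_
      rw [mul_assoc (3 * C₀ : ℝ≥0∞)]
      refine mul_le_mul_left ?_ _
      push_cast
      exact le_add_self

end Size

/-! ### Density of the compactly supported Lipschitz functions -/

theorem tendsto_eLpNorm_indicator_zero {α : Type*} {mα : MeasurableSpace α} {μ : Measure α}
    {H : α → ℝ≥0∞} (hH : Measurable H) {q : ℝ≥0∞} (hq0 : q ≠ 0) (hq : q ≠ ⊤)
    (hHq : eLpNorm H q μ ≠ ⊤) {A : ℕ → Set α} (hA : ∀ n, MeasurableSet (A n))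
    (h : ∀ᵐ x ∂μ, ∀ᶠ n in Filter.atTop, x ∉ A n) :
    Filter.Tendsto (fun n => eLpNorm ((A n).indicator H) q μ) Filter.atTop (nhds 0) := by
  have hpos : 0 < q.toReal := ENNReal.toReal_pos hq0 hq
  simp only [eLpNorm_eq_lintegral_rpow_enorm_toReal hq0 hq, enorm_eq_self] at hHq ⊢
  have h0 : (0 : ℝ≥0∞) = (∫⁻ _, 0 ∂μ) ^ (1 / q.toReal) := by
    rw [lintegral_zero, ENNReal.zero_rpow_of_pos (by positivity)]
  rw [h0]
  refine (ENNReal.continuous_rpow_const.tendsto _).comp ?_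
  refine tendsto_lintegral_of_dominated_convergence (fun x => H x ^ q.toReal)
    (fun n => (hH.indicator (hA n)).pow_const _) (fun n => Filter.Eventually.of_forall fun x =>
      ENNReal.rpow_le_rpow (indicator_le_self _ _ _) hpos.le) ?_ ?_
  · intro hint
    rw [hint, ENNReal.top_rpow_of_pos (by positivity)] at hHq
    exact hHq rfl
  · filter_upwards [h] with x hx
    refine tendsto_const_nhds.congr' ?_
    filter_upwards [hx] with n hn
    rw [indicator_of_notMem hn, ENNReal.zero_rpow_of_pos hpos]

theorem norm_gradient_eq_norm_fderiv {n : ℕ} (g : EuclideanSpace ℝ (Fin n) → ℝ)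
    (x : EuclideanSpace ℝ (Fin n)) : ‖gradient g x‖ = ‖fderiv ℝ g x‖ := by
  rw [gradient, LinearIsometryEquiv.norm_map]

/-- Cutting off a bounded Lipschitz function at distance `R` from the origin. -/
theorem LipschitzWith.exists_cutoff {n : ℕ} {g : EuclideanSpace ℝ (Fin n) → ℝ} {K l : ℝ≥0}
    (hg : LipschitzWith K g) (hl : ∀ x, |g x| ≤ l) {R : ℝ} (hR : 1 ≤ R) :
    ∃ (u : EuclideanSpace ℝ (Fin n) → ℝ) (K' : ℝ≥0), LipschitzWith K' u ∧
      (∀ x, x ∉ Metric.closedBall 0 (2 * R) → u x = 0) ∧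
      ∀ᵐ x, ‖(g - u) x‖ₑ ≤ 2 * {x | R ≤ ‖x‖}.indicator (fun x => ‖g x‖ₑ + ‖gradient g x‖ₑ) x ∧
        ‖gradient (g - u) x‖ₑ
          ≤ 2 * {x | R ≤ ‖x‖}.indicator (fun x => ‖g x‖ₑ + ‖gradient g x‖ₑ) x := by
  have hR0 : 0 < R := by linarith
  set ψ : EuclideanSpace ℝ (Fin n) → ℝ := fun x => max 0 (min 1 (‖x‖ / R - 1)) with hψ
  have hψ0 : ∀ x, 0 ≤ ψ x := fun x => le_max_left _ _
  have hψ1 : ∀ x, ψ x ≤ 1 := fun x => max_le zero_le_one (min_le_left _ _)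
  have hψa : ∀ x, |ψ x| ≤ 1 := fun x => by rw [abs_of_nonneg (hψ0 x)]; exact hψ1 x
  have hψL : LipschitzWith 1 ψ := by
    have h1 : LipschitzWith 1 fun x : EuclideanSpace ℝ (Fin n) => ‖x‖ / R - 1 := by
      refine LipschitzWith.of_dist_le_mul fun x y => ?_
      rw [Real.dist_eq, sub_sub_sub_cancel_right, ← sub_div, abs_div, abs_of_pos hR0,
        NNReal.coe_one, one_mul, dist_eq_norm]
      exact (div_le_self (abs_nonneg _) hR).trans (abs_norm_sub_norm_le _ _)
    exact (h1.const_min 1).const_max 0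
  set w : EuclideanSpace ℝ (Fin n) → ℝ := fun x => ψ x * g x with hw
  have hwL : LipschitzWith (K + l) w := by
    refine LipschitzWith.of_dist_le_mul fun x y => ?_
    have h1 := hg.dist_le_mul x y
    have h2 := hψL.dist_le_mul x y
    rw [Real.dist_eq] at h1 h2 ⊢
    have e : w x - w y = ψ x * (g x - g y) + g y * (ψ x - ψ y) := by simp only [hw]; ring
    rw [e, NNReal.coe_add, add_mul]
    refine (abs_add_le _ _).trans (add_le_add ?_ ?_)
    · rw [abs_mul]
      exact (mul_le_of_le_one_left (abs_nonneg _) (hψa x)).trans h1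
    · rw [abs_mul]
      rw [NNReal.coe_one, one_mul] at h2
      exact mul_le_mul (hl y) h2 (abs_nonneg _) l.2
  have hgw : g - (g - w) = w := sub_sub_cancel g w
  refine ⟨g - w, K + (K + l), hg.sub hwL, fun x hx => ?_, ?_⟩
  · rw [mem_closedBall_zero_iff, not_le] at hx
    have h1 : ψ x = 1 := by
      have : 1 ≤ ‖x‖ / R - 1 := by
        rw [le_sub_iff_add_le, le_div_iff₀ hR0]; linarith
      simp only [hψ]
      rw [min_eq_left this, max_eq_right zero_le_one]
    simp [hw, h1]
  · rw [hgw]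
    filter_upwards [hg.ae_differentiableAt, hψL.ae_differentiableAt] with x hx hx'
    by_cases hxR : x ∈ {x : EuclideanSpace ℝ (Fin n) | R ≤ ‖x‖}
    · rw [indicator_of_mem hxR, two_mul]
      constructor
      · refine le_add_right (le_add_right ?_)
        simp only [hw]
        rw [enorm_mul]
        refine mul_le_of_le_one_left zero_le ?_
        rw [Real.enorm_eq_ofReal_abs]
        exact ENNReal.ofReal_le_one.2 (hψa x)
      · refine le_trans ?_ (add_le_add le_add_self le_self_add)
        have h3 : ‖gradient w x‖ ≤ ‖gradient g x‖ + ‖g x‖ := by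
          rw [norm_gradient_eq_norm_fderiv, norm_gradient_eq_norm_fderiv, hw, fderiv_fun_mul hx' hx]
          refine (norm_add_le _ _).trans (add_le_add ?_ ?_)
          · rw [norm_smul]
            exact mul_le_of_le_one_left (norm_nonneg _) (hψa x)
          · rw [norm_smul]
            refine mul_le_of_le_one_right (norm_nonneg _) ?_
            exact norm_fderiv_le_of_lipschitz ℝ hψL
        rw [← ofReal_norm, ← ofReal_norm, ← ofReal_norm, ← ENNReal.ofReal_add (norm_nonneg _)
          (norm_nonneg _)]
        exact ENNReal.ofReal_le_ofReal h3
    · have hxR' : ‖x‖ < R := not_le.1 fun h => hxR h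
      have h4 : w =ᶠ[nhds x] fun _ => 0 := by
        filter_upwards [(isOpen_lt continuous_norm continuous_const).mem_nhds 
            hxR'] with z hz
        have : ‖z‖ / R - 1 ≤ 0 := by
          rw [sub_nonpos, div_le_one hR0]; exact le_of_lt hz
        simp only [hw, hψ]
        rw [max_eq_left ((min_le_right _ _).trans this), zero_mul]
      have h5 : ‖gradient w x‖ = 0 := by
        rw [norm_gradient_eq_norm_fderiv, h4.fderiv_eq]; simp
      rw [h4.eq_of_nhds, norm_eq_zero.1 h5]
      simp

section Density

variable {m : ℕ} {f : ConeFun m}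
  {G : EuclideanSpace ℝ (Fin (m + 1)) → EuclideanSpace ℝ (Fin (m + 1))} {q : ℝ≥0∞}

theorem memLp_of_eLpNorm_coneSize_lt_top (hG : Measurable G)
    (hs : eLpNorm (coneSize f G) q (volume.restrict (doubleCone m)) < ⊤) :
    MemLp f q (volume.restrict (doubleCone m)) ∧
      MemLp (fun x => f x / ‖x‖) q (volume.restrict (doubleCone m)) ∧
      MemLp G q (volume.restrict (doubleCone m)) :=
  ⟨⟨f.aestronglyMeasurable, eLpNorm_le_eLpNorm_coneSize.trans_lt hs⟩,
    ⟨(f.stronglyMeasurable.measurable.div measurable_norm).aestronglyMeasurable,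
      eLpNorm_div_norm_le_eLpNorm_coneSize.trans_lt hs⟩,
    ⟨hG.aestronglyMeasurable, eLpNorm_grad_le_eLpNorm_coneSize.trans_lt hs⟩⟩

theorem exists_coneLipCompact_sobolevNorm_lt (hG : Measurable G)
    (h : HasWeakGradient (doubleCone m) f G) (hq : 1 ≤ q) (hqt : q ≠ ⊤)
    (hs : eLpNorm (coneSize f G) q (volume.restrict (doubleCone m)) < ⊤) {ε : ℝ≥0∞} (hε : 0 < ε) :
    ∃ g ∈ coneLipCompact m, sobolevNorm (doubleCone m) q ⇑(f - g) < ε := by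
  have hq0 : q ≠ 0 := (zero_lt_one.trans_le hq).ne'
  have hfm : Measurable f := f.stronglyMeasurable.measurable
  set μ := volume.restrict (doubleCone m) with hμ
  set F := coneSize f G with hF
  have hFm : Measurable F := measurable_coneSize hfm hG
  obtain ⟨C, hC⟩ := exists_truncation_eLpNorm_le m
  have hFfin : ∀ x, F x ≠ ⊤ := fun x => by
    by_cases hx : x ∈ doubleCone m
    · rw [hF, coneSize_of_mem hx]; simp
    · rw [hF, coneSize, indicator_of_notMem hx]; simp
  -- the truncation at a large height
  obtain ⟨l, hl0, hlε⟩ : ∃ l : ℝ≥0, l ≠ 0 ∧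
      2 * (C * eLpNorm ({x | (l : ℝ≥0∞) / 2 < F x}.indicator F) q μ) < ε / 2 := by
    have h1 := tendsto_eLpNorm_indicator_zero (μ := μ) hFm hq0 hqt hs.ne
      (A := fun n => {x | (((n : ℝ≥0) + 1 : ℝ≥0) : ℝ≥0∞) / 2 < F x})
      (fun n => measurableSet_lt measurable_const hFm)
      (Filter.Eventually.of_forall fun x => by
        obtain ⟨N, hN⟩ := ENNReal.exists_nat_gt (hFfin x)
        filter_upwards [Filter.eventually_ge_atTop (2 * N)] with n hn
        rw [not_lt]
        refine hN.le.trans ?_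
        rw [ENNReal.le_div_iff_mul_le (by simp) (by simp)]
        have : N * 2 ≤ n + 1 := by omega
        push_cast
        exact_mod_cast this)
    have h2 := ENNReal.Tendsto.const_mul (a := 2 * (C : ℝ≥0∞)) h1
      (Or.inr (ENNReal.mul_ne_top (by simp) ENNReal.coe_ne_top))
    rw [mul_zero] at h2
    obtain ⟨n, hn⟩ := (h2.eventually_lt_const (ENNReal.half_pos hε.ne')).exists
    exact ⟨n + 1, by positivity, by rwa [← mul_assoc]⟩
  obtain ⟨g, K, x₀, hgL, hgl, -, hx₀, hfg, hg⟩ := hC f G hfm hG h l hl0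
  have hFl : eLpNorm ({x | (l : ℝ≥0∞) / 2 < F x}.indicator F) q μ < ⊤ :=
    (eLpNorm_mono_enorm fun x => by
      rw [enorm_eq_self, enorm_eq_self]; exact indicator_le_self _ _ _).trans_lt hs
  have hgq : eLpNorm (coneSize g (gradient g)) q μ < ⊤ := by
    refine (hg q hq).trans_lt (ENNReal.mul_lt_top ENNReal.coe_lt_top (ENNReal.add_lt_top.2
      ⟨(eLpNorm_mono_enorm fun x => ?_).trans_lt hs, (hx₀ q hq hqt).trans_lt
        (ENNReal.mul_lt_top ENNReal.coe_lt_top hFl)⟩))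
    rw [enorm_eq_self, enorm_eq_self]
    exact min_le_left _ _
  have hgm : Measurable g := hgL.continuous.measurable
  have hgrad : Measurable (gradient g) := measurable_gradient g
  set Fg := coneSize g (gradient g) with hFg
  have hFgm : Measurable Fg := measurable_coneSize hgm hgrad
  -- the cutoff at a large radius
  obtain ⟨R, hR1, hRε⟩ : ∃ R : ℝ, 1 ≤ R ∧
      4 * eLpNorm ({x | R ≤ ‖x‖}.indicator Fg) q μ < ε / 2 := by
    have h1 := tendsto_eLpNorm_indicator_zero (μ := μ) hFgm hq0 hqt hgq.ne
      (A := fun n : ℕ => {x | (n : ℝ) + 1 ≤ ‖x‖})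
      (fun n => measurableSet_le measurable_const measurable_norm)
      (Filter.Eventually.of_forall fun x => by
        obtain ⟨N, hN⟩ := exists_nat_gt ‖x‖
        filter_upwards [Filter.eventually_ge_atTop N] with n hn
        rw [not_le]
        have : (N : ℝ) ≤ n := by exact_mod_cast hn
        linarith)
    have h2 := ENNReal.Tendsto.const_mul (a := 4) h1 (Or.inr (by simp))
    rw [mul_zero] at h2
    obtain ⟨n, hn⟩ := (h2.eventually_lt_const (ENNReal.half_pos hε.ne')).exists
    exact ⟨n + 1, by simp, hn⟩
  obtain ⟨u, K', huL, hu0, hgu⟩ := hgL.exists_cutoff hgl hR1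
  have hum : AEStronglyMeasurable u μ := huL.continuous.aestronglyMeasurable
  refine ⟨AEEqFun.mk u hum, ⟨K', u, huL.lipschitzOnWith,
    ⟨Metric.closedBall 0 (2 * R), isCompact_closedBall _ _, fun x _ hx => hu0 x hx⟩,
    AEEqFun.coeFn_mk u hum⟩, ?_⟩
  have hfu : ⇑(f - AEEqFun.mk u hum) =ᵐ[μ] (⇑f - g) + (g - u) := by
    filter_upwards [AEEqFun.coeFn_sub f (AEEqFun.mk u hum), AEEqFun.coeFn_mk u hum] with x h1 h2
    rw [h1, Pi.sub_apply, h2]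
    simp
  have hO : MeasurableSet (doubleCone m) := measurableSet_doubleCone m
  have hwg : HasWeakGradient (doubleCone m) ⇑(f - AEEqFun.mk u hum)
      ((G - gradient g) + gradient (g - u)) :=
    ((h.sub hO (hgL.hasWeakGradient _)).add hO ((hgL.sub huL).hasWeakGradient _)).congr
      hfu.symm Filter.EventuallyEq.rfl
  have hind : ∀ᵐ x ∂μ, {x | R ≤ ‖x‖}.indicator (fun x => ‖g x‖ₑ + ‖gradient g x‖ₑ) x
      ≤ {x | R ≤ ‖x‖}.indicator Fg x := ae_cone fun x hx => by
    by_cases hxR : x ∈ {x : EuclideanSpace ℝ (Fin (m + 1)) | R ≤ ‖x‖}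
    · rw [indicator_of_mem hxR, indicator_of_mem hxR, hFg, coneSize_of_mem hx, add_right_comm]
      exact le_self_add
    · rw [indicator_of_notMem hxR]; exact zero_le
  have hgu1 : eLpNorm (g - u) q μ ≤ 2 * eLpNorm ({x | R ≤ ‖x‖}.indicator Fg) q μ := by
    refine eLpNorm_le_mul_eLpNorm_of_ae_enorm_le (by simp) ?_ q
    filter_upwards [hind, ae_restrict_of_ae hgu] with x h1 h2
    exact h2.1.trans (by rw [enorm_eq_self]; exact mul_le_mul_right h1 2)
  have hgu2 : eLpNorm (gradient (g - u)) q μ ≤ 2 * eLpNorm ({x | R ≤ ‖x‖}.indicator Fg) q μ := by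
    refine eLpNorm_le_mul_eLpNorm_of_ae_enorm_le (by simp) ?_ q
    filter_upwards [hind, ae_restrict_of_ae hgu] with x h1 h2
    exact h2.2.trans (by rw [enorm_eq_self]; exact mul_le_mul_right h1 2)
  rw [sobolevNorm_eq hwg, eLpNorm_congr_ae hfu]
  calc _ ≤ (eLpNorm (⇑f - g) q μ + eLpNorm (g - u) q μ)
        + (eLpNorm (G - gradient g) q μ + eLpNorm (gradient (g - u)) q μ) :=
        add_le_add
          (eLpNorm_add_le (hfm.sub hgm).aestronglyMeasurable
            (hgL.sub huL).continuous.aestronglyMeasurable hq)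
          (eLpNorm_add_le (hG.sub hgrad).aestronglyMeasurable
            (measurable_gradient _).aestronglyMeasurable hq)
    _ ≤ (C * eLpNorm ({x | (l : ℝ≥0∞) / 2 < F x}.indicator F) q μ
          + 2 * eLpNorm ({x | R ≤ ‖x‖}.indicator Fg) q μ)
        + (C * eLpNorm ({x | (l : ℝ≥0∞) / 2 < F x}.indicator F) q μ
          + 2 * eLpNorm ({x | R ≤ ‖x‖}.indicator Fg) q μ) :=
        add_le_add (add_le_add (eLpNorm_le_eLpNorm_coneSize.trans (hfg q hq hqt)) hgu1)
          (add_le_add (eLpNorm_grad_le_eLpNorm_coneSize.trans (hfg q hq hqt)) hgu2)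
    _ = 2 * (C * eLpNorm ({x | (l : ℝ≥0∞) / 2 < F x}.indicator F) q μ)
        + 4 * eLpNorm ({x | R ≤ ‖x‖}.indicator Fg) q μ := by ring
    _ < ε / 2 + ε / 2 := ENNReal.add_lt_add hlε hRε
    _ = ε := ENNReal.add_halves ε

/-- For `p < ∞` the space is characterized by the integrability of `f`, `f / r` and the gradient
alone. -/
theorem mem_coneHTilde_of_eLpNorm_coneSize_lt_top (hG : Measurable G)
    (h : HasWeakGradient (doubleCone m) f G) (hq : 1 ≤ q) (hqt : q ≠ ⊤)
    (hs : eLpNorm (coneSize f G) q (volume.restrict (doubleCone m)) < ⊤) :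
    f ∈ coneHTilde m q := by
  obtain ⟨h1, h2, h3⟩ := memLp_of_eLpNorm_coneSize_lt_top hG hs
  exact ⟨Or.inl ⟨hqt.lt_top, ⟨h1, G, h, h3⟩, fun ε hε =>
    exists_coneLipCompact_sobolevNorm_lt hG h hq hqt hs hε⟩, h2⟩

/-- Lipschitz functions with integrable size belong to the space for all `p`. -/
theorem mk_mem_coneHTilde_of_lipschitzWith {g : EuclideanSpace ℝ (Fin (m + 1)) → ℝ} {K : ℝ≥0}
    (hg : LipschitzWith K g) (hgm : AEStronglyMeasurable g (volume.restrict (doubleCone m)))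
    (hq : 1 ≤ q)
    (hs : eLpNorm (coneSize g (gradient g)) q (volume.restrict (doubleCone m)) < ⊤) :
    AEEqFun.mk g hgm ∈ coneHTilde m q ∧ coneHTildeNorm m q (AEEqFun.mk g hgm)
      ≤ 3 * eLpNorm (coneSize g (gradient g)) q (volume.restrict (doubleCone m)) := by
  have he := AEEqFun.coeFn_mk g hgm
  have hwg : HasWeakGradient (doubleCone m) (AEEqFun.mk g hgm) (gradient g) :=
    (hg.hasWeakGradient _).congr he.symm Filter.EventuallyEq.rfl
  have hsize : eLpNorm (coneSize (AEEqFun.mk g hgm) (gradient g)) q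
      (volume.restrict (doubleCone m))
      = eLpNorm (coneSize g (gradient g)) q (volume.restrict (doubleCone m)) := by
    refine eLpNorm_congr_ae ?_
    filter_upwards [he] with x hx
    simp only [coneSize, indicator, hx]
  rw [← hsize] at hs ⊢
  refine ⟨?_, coneHTildeNorm_le hwg⟩
  rcases eq_or_ne q ⊤ with rfl | hqt
  · obtain ⟨h1, h2, -⟩ := memLp_of_eLpNorm_coneSize_lt_top (measurable_gradient g) hs
    exact ⟨Or.inr ⟨rfl, ⟨K, g, hg.lipschitzOnWith, he⟩, h1⟩, h2⟩
  · exact mem_coneHTilde_of_eLpNorm_coneSize_lt_top (measurable_gradient g) hwg hq hqt hs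

end Density

/-! ### The `K`-functional -/

theorem kFunctional_le {V : Type*} [AddCommGroup V] {A₀ A₁ : Set V} {N₀ N₁ : V → ℝ≥0∞} {t : ℝ}
    {f a₀ a₁ : V} (h₀ : a₀ ∈ A₀) (h₁ : a₁ ∈ A₁) (h : f = a₀ + a₁) :
    kFunctional A₀ A₁ N₀ N₁ t f ≤ N₀ a₀ + ENNReal.ofReal t * N₁ a₁ :=
  iInf₂_le_of_le a₀ h₀ (iInf₂_le_of_le a₁ h₁ (iInf_le _ h))

section KFunctional

variable {m : ℕ} {p₀ p₁ : ℝ≥0∞}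

/-- Bound of the `K`-functional by the truncation of `f` at an arbitrary height `l`. -/
theorem exists_kFunctional_le (m : ℕ) (hp₀ : 1 ≤ p₀) (hp₁ : 1 ≤ p₁) (hp₀t : p₀ ≠ ⊤)
    (hlt : p₁.toReal⁻¹ < p₀.toReal⁻¹) :
    ∃ C : ℝ≥0, ∀ (f : ConeFun m)
      (G : EuclideanSpace ℝ (Fin (m + 1)) → EuclideanSpace ℝ (Fin (m + 1))),
      Measurable G → HasWeakGradient (doubleCone m) f G → ∀ l : ℝ≥0, l ≠ 0 → ∀ t : ℝ, 0 < t →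
      kFunctional (coneHTilde m p₀) (coneHTilde m p₁) (coneHTildeNorm m p₀)
          (coneHTildeNorm m p₁) t f
        ≤ C * (eLpNorm ({x | l / 2 < coneSize f G x}.indicator (coneSize f G)) p₀
            (volume.restrict (doubleCone m))
          + ENNReal.ofReal t * eLpNorm (fun x => min (coneSize f G x) l) p₁
            (volume.restrict (doubleCone m))
          + ENNReal.ofReal ((t ^ (p₀.toReal⁻¹ - p₁.toReal⁻¹)⁻¹) ^ p₀.toReal⁻¹) * l) := by
  obtain ⟨C, hC⟩ := exists_truncation_eLpNorm_le m
  -- the summand `1` makes the constant positive, so that the bound is trivial if a norm is infinite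
  refine ⟨3 * C * (1 + C) + 1, ?_⟩
  intro f G hG hfG l hl t ht
  set a₀ := p₀.toReal⁻¹ with ha₀
  set a₁ := p₁.toReal⁻¹ with ha₁
  have ha1 : 0 ≤ a₁ := by positivity
  set μ := volume.restrict (doubleCone m) with hμ
  have hfm : Measurable f := f.stronglyMeasurable.measurable
  set F := coneSize f G with hF
  obtain ⟨g, K, x, hgL, -, -, hx, hfg, hg⟩ := hC f G hfm hG hfG l hl
  set y := eLpNorm ({x | (l : ℝ≥0∞) / 2 < F x}.indicator F) p₀ μ with hy
  set M := eLpNorm (fun x => min (F x) l) p₁ μ with hM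
  set T := ENNReal.ofReal t with hT
  have hT0 : T ≠ 0 := by rw [hT, ne_eq, ENNReal.ofReal_eq_zero, not_le]; exact ht
  set s := t ^ (a₀ - a₁)⁻¹ with hs
  have hs0 : 0 < s := Real.rpow_pos_of_pos ht _
  set S := ENNReal.ofReal s with hS
  have hST : T = S ^ (a₀ - a₁) := by
    rw [hS, ENNReal.ofReal_rpow_of_pos hs0, hs, Real.rpow_inv_rpow ht.le (by linarith)]
  have hpow : ∀ z : ℝ≥0∞, z ^ (a₀ - a₁) * z ^ a₁ = z ^ a₀ := fun z => by
    rw [← ENNReal.rpow_add_of_nonneg _ _ (by linarith) ha1, sub_add_cancel]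
  rw [← ENNReal.ofReal_rpow_of_pos hs0, ← hS]
  rcases eq_or_ne y ⊤ with hyt | hyt
  · rw [hyt, top_add, top_add, ENNReal.mul_top (by simp)]
    exact le_top
  rcases eq_or_ne M ⊤ with hMt | hMt
  · rw [hMt, ENNReal.mul_top hT0, add_top, top_add, ENNReal.mul_top (by simp)]
    exact le_top
  -- according to whether the bad set has measure at most `s`
  have hTx : T * (l * x ^ a₁) ≤ S ^ a₀ * l + C * y := by
    rcases le_total x S with hxS | hxS
    · refine le_add_right ?_
      calc T * (l * x ^ a₁) ≤ T * (l * S ^ a₁) :=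
            mul_le_mul_right (mul_le_mul_right (ENNReal.rpow_le_rpow hxS ha1) _) _
        _ = S ^ (a₀ - a₁) * S ^ a₁ * l := by rw [← hST]; ring
        _ = S ^ a₀ * l := by rw [hpow]
    · refine le_add_left ?_
      calc T * (l * x ^ a₁) ≤ x ^ (a₀ - a₁) * (l * x ^ a₁) := by
            refine mul_le_mul_left ?_ _
            rw [hST]
            exact ENNReal.rpow_le_rpow hxS (by linarith)
        _ = l * (x ^ (a₀ - a₁) * x ^ a₁) := by ring
        _ = l * x ^ a₀ := by rw [hpow]
        _ ≤ C * y := hx p₀ hp₀ hp₀t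
  have hSt : S ^ a₀ * l + C * y ≠ ⊤ :=
    ENNReal.add_ne_top.2 ⟨ENNReal.mul_ne_top (ENNReal.rpow_ne_top_of_nonneg (by positivity)
      ENNReal.ofReal_ne_top) ENNReal.coe_ne_top, ENNReal.mul_ne_top ENNReal.coe_ne_top hyt⟩
  have hlx : l * x ^ a₁ < ⊤ := by
    by_contra hcon
    rw [not_lt_top_iff.1 hcon, ENNReal.mul_top hT0, top_le_iff] at hTx
    exact hSt hTx
  have hgs := hg p₁ hp₁
  have hgm : AEStronglyMeasurable g μ := hgL.continuous.aestronglyMeasurable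
  obtain ⟨hg1, hg2⟩ := mk_mem_coneHTilde_of_lipschitzWith (m := m) hgL hgm hp₁
    (hgs.trans_lt (ENNReal.mul_lt_top ENNReal.coe_lt_top (ENNReal.add_lt_top.2 ⟨hMt.lt_top, hlx⟩)))
  have hb : ⇑(f - AEEqFun.mk g hgm) =ᵐ[μ] ⇑f - g := by
    filter_upwards [AEEqFun.coeFn_sub f (AEEqFun.mk g hgm), AEEqFun.coeFn_mk g hgm] with x h1 h2
    rw [h1, Pi.sub_apply, h2, Pi.sub_apply]
  have hbG : HasWeakGradient (doubleCone m) ⇑(f - AEEqFun.mk g hgm) (G - gradient g) :=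
    (hfG.sub (measurableSet_doubleCone m) (hgL.hasWeakGradient _)).congr hb.symm
      Filter.EventuallyEq.rfl
  have hbs : eLpNorm (coneSize ⇑(f - AEEqFun.mk g hgm) (G - gradient g)) p₀ μ ≤ C * y := by
    refine le_of_eq_of_le (eLpNorm_congr_ae ?_) (hfg p₀ hp₀ hp₀t)
    filter_upwards [hb] with x hx
    simp only [coneSize, indicator, hx]
  refine (kFunctional_le (mem_coneHTilde_of_eLpNorm_coneSize_lt_top
    (hG.sub (measurable_gradient g)) hbG hp₀ hp₀t (hbs.trans_lt
      (ENNReal.mul_lt_top ENNReal.coe_lt_top hyt.lt_top))) hg1 (sub_add_cancel _ _).symm).trans ?_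
  calc _ ≤ 3 * (C * y) + T * (3 * (C * (M + l * x ^ a₁))) :=
        add_le_add ((coneHTildeNorm_le hbG).trans (mul_le_mul_right hbs 3))
          (mul_le_mul_right (hg2.trans (mul_le_mul_right hgs 3)) T)
    _ = 3 * C * (y + T * M + T * (l * x ^ a₁)) := by ring
    _ ≤ 3 * C * (y + T * M + (S ^ a₀ * l + C * y)) := by gcongr
    _ ≤ 3 * C * ((1 + C) * (y + T * M + S ^ a₀ * l)) := by
        refine mul_le_mul_right ?_ _
        calc y + T * M + (S ^ a₀ * l + C * y) = (y + T * M + S ^ a₀ * l) + C * y := by ring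
          _ ≤ (y + T * M + S ^ a₀ * l) + C * (y + T * M + S ^ a₀ * l) := by
              refine add_le_add_right (mul_le_mul_right ?_ _) _
              rw [add_assoc]
              exact le_self_add
          _ = _ := by ring
    _ = (3 * C * (1 + C) : ℝ≥0) * (y + T * M + S ^ a₀ * l) := by push_cast; ring
    _ ≤ _ := mul_le_mul_left (ENNReal.coe_le_coe.2 le_self_add) _

/-- Bound of the `K`-functional by the truncation of `f` at the height of its rearrangement. -/
theorem exists_kFunctional_le_decRearr (m : ℕ) (hp₀ : 1 ≤ p₀) (hp₁ : 1 ≤ p₁) (hp₀t : p₀ ≠ ⊤)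
    (hlt : p₁.toReal⁻¹ < p₀.toReal⁻¹) :
    ∃ C : ℝ≥0, ∀ (f : ConeFun m)
      (G : EuclideanSpace ℝ (Fin (m + 1)) → EuclideanSpace ℝ (Fin (m + 1))),
      Measurable G → HasWeakGradient (doubleCone m) f G → ∀ (t s : ℝ), 0 < t →
      s = t ^ (p₀.toReal⁻¹ - p₁.toReal⁻¹)⁻¹ →
      decRearr (volume.restrict (doubleCone m)) (coneSize f G) s ≠ ⊤ →
      kFunctional (coneHTilde m p₀) (coneHTilde m p₁) (coneHTildeNorm m p₀)
          (coneHTildeNorm m p₁) t f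
        ≤ C * (eLpNorm ({x | decRearr (volume.restrict (doubleCone m)) (coneSize f G) s
              < coneSize f G x}.indicator (coneSize f G)) p₀ (volume.restrict (doubleCone m))
          + ENNReal.ofReal t * eLpNorm (fun x => min (coneSize f G x)
              (decRearr (volume.restrict (doubleCone m)) (coneSize f G) s)) p₁
              (volume.restrict (doubleCone m))
          + ENNReal.ofReal (s ^ p₀.toReal⁻¹)
            * decRearr (volume.restrict (doubleCone m)) (coneSize f G) s) := by
  obtain ⟨C, hC⟩ := exists_kFunctional_le m hp₀ hp₁ hp₀t hlt
  refine ⟨C * 2, ?_⟩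
  intro f G hG hfG t s ht hs hD
  have hfm : Measurable f := f.stronglyMeasurable.measurable
  set a₀ := p₀.toReal⁻¹ with ha₀
  set a₁ := p₁.toReal⁻¹ with ha₁
  set μ := volume.restrict (doubleCone m) with hμ
  set F := coneSize f G with hF
  have hFm : Measurable F := measurable_coneSize hfm hG
  set D := decRearr μ F s with hDdef
  set y := eLpNorm ({x | D < F x}.indicator F) p₀ μ with hy
  set M := eLpNorm (fun x => min (F x) D) p₁ μ with hM
  set T := ENNReal.ofReal t with hT
  set S := ENNReal.ofReal (s ^ a₀) with hS
  have hs0 : 0 < s := by rw [hs]; exact Real.rpow_pos_of_pos ht _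
  have hTS : T * ENNReal.ofReal (s ^ a₁) = S := by
    rw [hT, hS, ← ENNReal.ofReal_mul ht.le]
    congr 1
    have h1 : t = s ^ (a₀ - a₁) := by rw [hs, Real.rpow_inv_rpow ht.le (by linarith)]
    nth_rewrite 1 [h1]
    rw [← Real.rpow_add hs0, sub_add_cancel]
  -- the height `2 (D + ε)`, positive even if `D = 0`
  have hstep : ∀ ε : ℝ≥0, ε ≠ 0 →
      kFunctional (coneHTilde m p₀) (coneHTilde m p₁) (coneHTildeNorm m p₀)
          (coneHTildeNorm m p₁) t f
        ≤ C * (2 * (y + T * M + S * D) + 4 * S * ε) := by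
    intro ε hε
    set l : ℝ≥0 := 2 * (D.toNNReal + ε) with hl
    have hl0 : l ≠ 0 := by positivity
    have hlD : (l : ℝ≥0∞) = 2 * (D + ε) := by
      rw [hl]; push_cast; rw [ENNReal.coe_toNNReal hD]
    have hl2 : (l : ℝ≥0∞) / 2 = D + ε := by
      rw [hlD, mul_comm]; exact ENNReal.mul_div_cancel_right (by simp) (by simp)
    have h1 := hC f G hG hfG l hl0 t ht
    rw [← hs, hl2] at h1
    have hy' : eLpNorm ({x | D + ε < F x}.indicator F) p₀ μ ≤ y := by
      refine eLpNorm_mono_enorm fun x => ?_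
      rw [enorm_eq_self, enorm_eq_self]
      refine indicator_le_indicator_of_subset (fun z hz => ?_) (fun _ => zero_le) x
      rw [mem_ofPred_eq] at hz ⊢
      exact lt_of_le_of_lt le_self_add hz
    have hM' : eLpNorm (fun x => min (F x) l) p₁ μ
        ≤ 2 * (M + ENNReal.ofReal (s ^ a₁) * ε) := by
      have hind : MeasurableSet {x | D < F x} := measurableSet_lt measurable_const hFm
      calc eLpNorm (fun x => min (F x) l) p₁ μ
          ≤ 2 * eLpNorm ((fun x => min (F x) D) + {x | D < F x}.indicator fun _ => (ε : ℝ≥0∞))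
              p₁ μ := by
            refine eLpNorm_le_mul_eLpNorm_of_ae_enorm_le (by simp)
              (Filter.Eventually.of_forall fun x => ?_) p₁
            simp only [enorm_eq_self, Pi.add_apply]
            by_cases hx : x ∈ {x | D < F x}
            · rw [indicator_of_mem hx]
              rw [mem_ofPred_eq] at hx
              rw [min_eq_right hx.le, ← hlD]
              exact min_le_right _ _
            · rw [indicator_of_notMem hx, add_zero]
              rw [mem_ofPred_eq, not_lt] at hx
              rw [min_eq_left hx, two_mul]
              exact (min_le_left _ _).trans le_self_add
        _ ≤ 2 * (M + eLpNorm ({x | D < F x}.indicator fun _ => (ε : ℝ≥0∞)) p₁ μ) :=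
            mul_le_mul_right (eLpNorm_add_le (hFm.min measurable_const).aestronglyMeasurable
              (measurable_const.indicator hind).aestronglyMeasurable hp₁) 2
        _ ≤ _ := by
            refine mul_le_mul_right (add_le_add_right ?_ M) 2
            refine (eLpNorm_indicator_const_le _ _).trans ?_
            rw [enorm_eq_self, one_div, mul_comm, ← ENNReal.ofReal_rpow_of_pos hs0]
            exact mul_le_mul_left (ENNReal.rpow_le_rpow (measure_decRearr_lt_le μ F s)
              (by positivity)) _
    refine h1.trans (mul_le_mul_right ?_ _)
    calc _ ≤ y + T * (2 * (M + ENNReal.ofReal (s ^ a₁) * ε)) + S * (2 * (D + ε)) := by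
          rw [hlD] at hM' ⊢
          exact add_le_add (add_le_add hy' (mul_le_mul_right hM' _)) le_rfl
      _ = y + 2 * (T * M) + 2 * (T * ENNReal.ofReal (s ^ a₁)) * ε + 2 * (S * D) + 2 * S * ε := by
          ring
      _ = y + (2 * (T * M) + 2 * (S * D) + 4 * S * ε) := by rw [hTS]; ring
      _ ≤ 2 * y + (2 * (T * M) + 2 * (S * D) + 4 * S * ε) := by
          refine add_le_add_left ?_ _
          rw [two_mul]; exact le_self_add
      _ = _ := by ring
  have hlim : Filter.Tendsto (fun n : ℕ => C * (2 * (y + T * M + S * D)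
      + 4 * S * ((((n + 1 : ℕ) : ℝ≥0)⁻¹ : ℝ≥0) : ℝ≥0∞))) Filter.atTop
      (nhds (C * (2 * (y + T * M + S * D) + 4 * S * ((0 : ℝ≥0) : ℝ≥0∞)))) := by
    have h1 : Filter.Tendsto (fun n : ℕ => (((n + 1 : ℕ) : ℝ≥0)⁻¹ : ℝ≥0)) Filter.atTop (nhds 0) :=
      (tendsto_inv_atTop_nhds_zero_nat (𝕜 := ℝ≥0)).comp (Filter.tendsto_add_atTop_nat 1)
    refine ENNReal.Tendsto.const_mul (tendsto_const_nhds.add (ENNReal.Tendsto.const_mul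
      (ENNReal.tendsto_coe.2 h1) (Or.inr (ENNReal.mul_ne_top (by simp) ENNReal.ofReal_ne_top))))
      (Or.inr ENNReal.coe_ne_top)
  rw [ENNReal.coe_zero, mul_zero, add_zero] at hlim
  refine (ge_of_tendsto' hlim fun n => hstep _ (by positivity)).trans (le_of_eq ?_)
  push_cast
  ring

/-- The rearrangement of the size is bounded by the `K`-functional: for every decomposition
`f = f₀ + f₁` the size is dominated by the sum of the sizes of `f₀` and `f₁`. -/
theorem mul_decRearr_le_kFunctional (hp₀ : 1 ≤ p₀) (hp₁ : 1 ≤ p₁)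
    (hlt : p₁.toReal⁻¹ < p₀.toReal⁻¹) {f : ConeFun m}
    {G : EuclideanSpace ℝ (Fin (m + 1)) → EuclideanSpace ℝ (Fin (m + 1))}
    (hfG : HasWeakGradient (doubleCone m) f G) {t s : ℝ} (ht : 0 < t)
    (hs : s = t ^ (p₀.toReal⁻¹ - p₁.toReal⁻¹)⁻¹) :
    ENNReal.ofReal (s ^ p₀.toReal⁻¹)
        * decRearr (volume.restrict (doubleCone m)) (coneSize f G) (2 * s)
      ≤ kFunctional (coneHTilde m p₀) (coneHTilde m p₁) (coneHTildeNorm m p₀) (coneHTildeNorm m p₁)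
        t f := by
  refine le_iInf₂ fun f₀ hf₀ => le_iInf₂ fun f₁ hf₁ => le_iInf fun hf => ?_
  obtain ⟨G₀, hG₀, hfG₀, -⟩ := exists_hasWeakGradient_of_mem_coneHTilde hf₀
  obtain ⟨G₁, hG₁, hfG₁, -⟩ := exists_hasWeakGradient_of_mem_coneHTilde hf₁
  set a₀ := p₀.toReal⁻¹ with ha₀
  set a₁ := p₁.toReal⁻¹ with ha₁
  set μ := volume.restrict (doubleCone m) with hμ
  have hs0 : 0 < s := by rw [hs]; exact Real.rpow_pos_of_pos ht _
  have hfe : ⇑f =ᵐ[μ] ⇑f₀ + ⇑f₁ := by rw [hf]; exact AEEqFun.coeFn_add f₀ f₁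
  have hGe : G =ᵐ[μ] G₀ + G₁ := hfG.ae_eq (isOpen_doubleCone m)
    ((hfG₀.add (measurableSet_doubleCone m) hfG₁).congr hfe.symm Filter.EventuallyEq.rfl)
  have hsize : ∀ᵐ x ∂μ, coneSize f G x ≤ coneSize f₀ G₀ x + coneSize f₁ G₁ x := by
    filter_upwards [hfe, hGe, ae_restrict_mem (measurableSet_doubleCone m)] with x h1 h2 hx
    rw [coneSize_of_mem hx, coneSize_of_mem hx, coneSize_of_mem hx, h1, h2, Pi.add_apply,
      Pi.add_apply, add_div]
    calc _ ≤ (‖f₀ x‖ₑ + ‖f₁ x‖ₑ) + (‖f₀ x / ‖x‖‖ₑ + ‖f₁ x / ‖x‖‖ₑ) + (‖G₀ x‖ₑ + ‖G₁ x‖ₑ) :=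
          add_le_add (add_le_add (enorm_add_le _ _) (enorm_add_le _ _)) (enorm_add_le _ _)
      _ = _ := by ring
  have h0 : decRearr μ (coneSize f₀ G₀) s ≤ ENNReal.ofReal (s ^ (-a₀)) * coneHTildeNorm m p₀ f₀ :=
    (decRearr_le_rpow_mul_eLpNorm (measurable_coneSize f₀.stronglyMeasurable.measurable hG₀)
      hp₀ hs0).trans (mul_le_mul_right (eLpNorm_coneSize_le_coneHTildeNorm hG₀ hfG₀ hp₀) _)
  have h1 : decRearr μ (coneSize f₁ G₁) s ≤ ENNReal.ofReal (s ^ (-a₁)) * coneHTildeNorm m p₁ f₁ :=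
    (decRearr_le_rpow_mul_eLpNorm (measurable_coneSize f₁.stronglyMeasurable.measurable hG₁)
      hp₁ hs0).trans (mul_le_mul_right (eLpNorm_coneSize_le_coneHTildeNorm hG₁ hfG₁ hp₁) _)
  have e0 : ENNReal.ofReal (s ^ a₀) * ENNReal.ofReal (s ^ (-a₀)) = 1 := by
    rw [← ENNReal.ofReal_mul (by positivity), ← Real.rpow_add hs0, add_neg_cancel, Real.rpow_zero,
      ENNReal.ofReal_one]
  have e1 : ENNReal.ofReal (s ^ a₀) * ENNReal.ofReal (s ^ (-a₁)) = ENNReal.ofReal t := by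
    rw [← ENNReal.ofReal_mul (by positivity), ← Real.rpow_add hs0, ← sub_eq_add_neg, hs,
      Real.rpow_inv_rpow ht.le (by linarith)]
  calc _ ≤ ENNReal.ofReal (s ^ a₀) * (ENNReal.ofReal (s ^ (-a₀)) * coneHTildeNorm m p₀ f₀
        + ENNReal.ofReal (s ^ (-a₁)) * coneHTildeNorm m p₁ f₁) := by
        refine mul_le_mul_right ?_ _
        rw [two_mul]
        exact (decRearr_add_le hsize hs0.le hs0.le).trans (add_le_add h0 h1)
    _ = _ := by rw [mul_add, ← mul_assoc, ← mul_assoc, e0, e1, one_mul]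

end KFunctional

/-! ### The interpolation theorem -/

theorem haarIoi_ne_zero : haarIoi ≠ 0 := by
  intro h
  rw [haarIoi, withDensity_eq_zero_iff (by fun_prop)] at h
  have h1 : ∀ᵐ t ∂(volume.restrict (Ioi (0 : ℝ))), False := by
    filter_upwards [h, ae_restrict_mem measurableSet_Ioi] with t h2 h3
    have h4 : 0 < t⁻¹ := inv_pos.2 h3
    rw [Pi.zero_apply, ENNReal.ofReal_eq_zero] at h2
    linarith
  rw [Filter.eventually_false_iff_eq_bot, ae_eq_bot, Measure.restrict_eq_zero,
    Real.volume_Ioi] at h1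
  exact ENNReal.top_ne_zero h1

theorem exists_eq_add_of_realInterpNorm_ne_top {V : Type*} [AddCommGroup V] {A₀ A₁ : Set V}
    {N₀ N₁ : V → ℝ≥0∞} {θ : ℝ} {p : ℝ≥0∞} (hp0 : p ≠ 0) (hp : p ≠ ⊤) {f : V}
    (h : realInterpNorm A₀ A₁ N₀ N₁ θ p f ≠ ⊤) : ∃ a₀ ∈ A₀, ∃ a₁ ∈ A₁, f = a₀ + a₁ := by
  by_contra! hcon
  have hpos : 0 < p.toReal := ENNReal.toReal_pos hp0 hp
  -- without a decomposition, the functional is an infimum over the empty set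
  have hK : ∀ t, kFunctional A₀ A₁ N₀ N₁ t f = ⊤ := fun t => by
    refine top_le_iff.1 (le_iInf₂ fun a₀ h₀ => le_iInf₂ fun a₁ h₁ => le_iInf fun hf => ?_)
    exact absurd hf (hcon a₀ h₀ a₁ h₁)
  refine h (top_le_iff.1 ?_)
  calc ⊤ = eLpNorm (fun _ : ℝ => (⊤ : ℝ≥0∞)) p haarIoi := by
        rw [eLpNorm_eq_lintegral_rpow_enorm_toReal hp0 hp]
        simp only [enorm_eq_self, ENNReal.top_rpow_of_pos hpos, lintegral_const]
        rw [ENNReal.top_mul (by simpa using haarIoi_ne_zero),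
          ENNReal.top_rpow_of_pos (by positivity)]
    _ ≤ realInterpNorm A₀ A₁ N₀ N₁ θ p f :=
        eLpNorm_mono_enorm_ae (ae_haarIoi fun t ht => by
          rw [hK, ENNReal.mul_top]
          rw [ne_eq, ENNReal.ofReal_eq_zero, not_le]
          exact Real.rpow_pos_of_pos ht _)

/-- The relation of the exponents in terms of real numbers; `⊤.toReal⁻¹ = 0` is the right value for
an infinite exponent. -/
theorem inv_toReal_of_interp {p₀ p₁ p : ℝ≥0∞} {θ : ℝ} (hp₀ : 1 ≤ p₀) (hp₀₁ : p₀ < p₁)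
    (hθ₀ : 0 < θ) (hθ₁ : θ < 1)
    (hp : 1 / p = ENNReal.ofReal (1 - θ) / p₀ + ENNReal.ofReal θ / p₁) :
    1 ≤ p ∧ p ≠ ⊤ ∧ p₁.toReal⁻¹ < p.toReal⁻¹ ∧ p.toReal⁻¹ < p₀.toReal⁻¹ ∧
      p.toReal⁻¹ = (1 - θ) * p₀.toReal⁻¹ + θ * p₁.toReal⁻¹ := by
  have hp₀t : p₀ ≠ ⊤ := hp₀₁.ne_top
  have hp₀0 : p₀ ≠ 0 := (zero_lt_one.trans_le hp₀).ne'
  have hp₁0 : p₁ ≠ 0 := (zero_lt_one.trans_le (hp₀.trans hp₀₁.le)).ne'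
  have hr₀ : 0 < p₀.toReal := ENNReal.toReal_pos hp₀0 hp₀t
  have hr1 : 1 ≤ p₀.toReal := by
    rw [← ENNReal.toReal_one]; exact ENNReal.toReal_mono hp₀t hp₀
  have hpt : p ≠ ⊤ := by
    rintro rfl
    rw [ENNReal.div_top] at hp
    have h1 := (add_eq_zero.1 hp.symm).1
    rw [ENNReal.div_eq_zero_iff, ENNReal.ofReal_eq_zero] at h1
    rcases h1 with h1 | h1
    · linarith
    · exact hp₀t h1
  have hlt : p₁.toReal⁻¹ < p₀.toReal⁻¹ := by
    rcases eq_or_ne p₁ ⊤ with rfl | hp₁t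
    · simpa using hr₀
    · exact (inv_lt_inv₀ (ENNReal.toReal_pos hp₁0 hp₁t) hr₀).2
        ((ENNReal.toReal_lt_toReal hp₀t hp₁t).2 hp₀₁)
  have heq : p.toReal⁻¹ = (1 - θ) * p₀.toReal⁻¹ + θ * p₁.toReal⁻¹ := by
    have h1 := congrArg ENNReal.toReal hp
    rw [ENNReal.toReal_add (ENNReal.div_ne_top ENNReal.ofReal_ne_top hp₀0)
      (ENNReal.div_ne_top ENNReal.ofReal_ne_top hp₁0), ENNReal.toReal_div, ENNReal.toReal_div,
      ENNReal.toReal_div, ENNReal.toReal_ofReal (by linarith), ENNReal.toReal_ofReal hθ₀.le,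
      ENNReal.toReal_one, one_div] at h1
    rw [h1, div_eq_mul_inv, div_eq_mul_inv]
  have h0 : p.toReal⁻¹ < p₀.toReal⁻¹ := by
    rw [heq]; nlinarith
  have h1 : p₁.toReal⁻¹ < p.toReal⁻¹ := by
    rw [heq]; nlinarith
  refine ⟨?_, hpt, h1, h0, heq⟩
  have h2 : 0 < p.toReal⁻¹ := lt_of_le_of_lt (by positivity) h1
  have h3 : 0 < p.toReal := inv_pos.1 h2
  have h4 : p₀.toReal < p.toReal := (inv_lt_inv₀ h3 hr₀).1 h0
  rw [← ENNReal.ofReal_toReal hpt, ENNReal.one_le_ofReal]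
  linarith

section Interpolation

variable {m : ℕ} {p₀ p₁ p : ℝ≥0∞} {θ : ℝ}

/-- The interpolation space embeds into the space for the exponent `p`. -/
theorem exists_eLpNorm_coneSize_le_realInterpNorm (hp₀ : 1 ≤ p₀) (hp₁ : 1 ≤ p₁) (hp0 : p ≠ 0)
    (hp : p ≠ ⊤) (h₀₁ : p₁.toReal⁻¹ < p₀.toReal⁻¹)
    (hθ : p.toReal⁻¹ = (1 - θ) * p₀.toReal⁻¹ + θ * p₁.toReal⁻¹) :
    ∃ C : ℝ≥0∞, C ≠ ⊤ ∧ ∀ (f : ConeFun m)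
      (G : EuclideanSpace ℝ (Fin (m + 1)) → EuclideanSpace ℝ (Fin (m + 1))),
      Measurable G → HasWeakGradient (doubleCone m) f G →
      eLpNorm (coneSize f G) p (volume.restrict (doubleCone m)) ≤ C *
        realInterpNorm (coneHTilde m p₀) (coneHTilde m p₁) (coneHTildeNorm m p₀)
          (coneHTildeNorm m p₁) θ p f := by
  set a₀ := p₀.toReal⁻¹ with ha₀
  set a₁ := p₁.toReal⁻¹ with ha₁
  set a := p.toReal⁻¹ with ha
  set b := (a₀ - a₁)⁻¹ with hb
  have hb0 : 0 < b := inv_pos.2 (by linarith)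
  have hb1 : b * (a₀ - a₁) = 1 := inv_mul_cancel₀ (by linarith)
  set c := ENNReal.ofReal ((b * 2)⁻¹ ^ a) with hc
  have hc0 : c ≠ 0 := by
    rw [hc, ne_eq, ENNReal.ofReal_eq_zero, not_le]; positivity
  have hct : c ≠ ⊤ := ENNReal.ofReal_ne_top
  refine ⟨c⁻¹, ENNReal.inv_ne_top.2 hc0, fun f G hG hfG => ?_⟩
  rw [← ENNReal.mul_le_mul_iff_right hc0 hct, ← mul_assoc, ENNReal.mul_inv_cancel hc0 hct, one_mul,
    hc, ← eLpNorm_rpow_mul_decRearr (measurable_coneSize f.stronglyMeasurable.measurable hG) hp0 hp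
      hb0 two_pos]
  refine eLpNorm_mono_enorm_ae (ae_haarIoi fun t ht => ?_)
  rw [enorm_eq_self, enorm_eq_self]
  have h1 : t ^ (b * a) = t ^ (-θ) * (t ^ b) ^ a₀ := by
    rw [← Real.rpow_mul ht.le, ← Real.rpow_add ht]
    congr 1
    rw [hθ]
    linear_combination -θ * hb1
  rw [h1, ENNReal.ofReal_mul (by positivity), mul_assoc]
  exact mul_le_mul_right (mul_decRearr_le_kFunctional hp₀ hp₁ h₀₁ hfG ht rfl) _

/-- The space for the exponent `p` embeds into the interpolation space. -/
theorem exists_realInterpNorm_le (hp₀ : 1 ≤ p₀) (hp₁ : 1 ≤ p₁) (hp1 : 1 ≤ p) (hp₀t : p₀ ≠ ⊤)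
    (hp : p ≠ ⊤) (h₀ : p.toReal⁻¹ < p₀.toReal⁻¹) (h₁ : p₁.toReal⁻¹ < p.toReal⁻¹)
    (hθ : p.toReal⁻¹ = (1 - θ) * p₀.toReal⁻¹ + θ * p₁.toReal⁻¹) :
    ∃ C : ℝ≥0∞, C ≠ ⊤ ∧ ∀ (f : ConeFun m)
      (G : EuclideanSpace ℝ (Fin (m + 1)) → EuclideanSpace ℝ (Fin (m + 1))),
      Measurable G → HasWeakGradient (doubleCone m) f G →
      eLpNorm (coneSize f G) p (volume.restrict (doubleCone m)) ≠ ⊤ →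
      realInterpNorm (coneHTilde m p₀) (coneHTilde m p₁) (coneHTildeNorm m p₀)
          (coneHTildeNorm m p₁) θ p f
        ≤ C * eLpNorm (coneSize f G) p (volume.restrict (doubleCone m)) := by
  obtain ⟨C₁, hC₁, h1⟩ := exists_eLpNorm_le_of_le_decRearr
    (μ := volume.restrict (doubleCone m)) hp₀ hp₁ hp1 hp h₀ h₁ hθ
  obtain ⟨C₂, h2⟩ := exists_kFunctional_le_decRearr m hp₀ hp₁ hp₀t (h₁.trans h₀)
  refine ⟨(C₂ + 1 : ℝ≥0) * C₁, ENNReal.mul_ne_top ENNReal.coe_ne_top hC₁, ?_⟩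
  intro f G hG hfG hF
  have hFm : Measurable (coneSize f G) := measurable_coneSize f.stronglyMeasurable.measurable hG
  set K := fun t => kFunctional (coneHTilde m p₀) (coneHTilde m p₁) (coneHTildeNorm m p₀)
    (coneHTildeNorm m p₁) t f with hK
  set c : ℝ≥0∞ := ((C₂ + 1 : ℝ≥0) : ℝ≥0∞) with hc
  have hc0 : c ≠ 0 := by rw [hc]; simp
  have hct : c ≠ ⊤ := ENNReal.coe_ne_top
  -- the scalar estimate applies to the `K`-functional divided by its constant
  have h3 := h1 _ hFm hF (fun t => c⁻¹ * K t) fun t ht => by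
    have hs0 : 0 < t ^ (p₀.toReal⁻¹ - p₁.toReal⁻¹)⁻¹ := Real.rpow_pos_of_pos ht _
    rw [← ENNReal.mul_le_mul_iff_right hc0 hct, ← mul_assoc, ENNReal.mul_inv_cancel hc0 hct,
      one_mul]
    refine (h2 f G hG hfG t _ ht rfl ?_).trans
      (mul_le_mul_left (ENNReal.coe_le_coe.2 le_self_add) _)
    exact ne_top_of_le_ne_top (ENNReal.mul_ne_top ENNReal.ofReal_ne_top hF)
      (decRearr_le_rpow_mul_eLpNorm hFm hp1 hs0)
  rw [mul_assoc]
  refine le_trans ?_ (mul_le_mul_right h3 c)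
  refine eLpNorm_le_mul_eLpNorm_of_ae_enorm_le hct (Filter.Eventually.of_forall fun t => ?_) p
  rw [enorm_eq_self, enorm_eq_self, mul_left_comm, ← mul_assoc c, ENNReal.mul_inv_cancel hc0 hct,
    one_mul]

end Interpolation

theorem theorem3p5 (m : ℕ) (hm : 1 ≤ m) (p₀ p₁ p : ℝ≥0∞) (θ : ℝ)
    (hp₀ : 1 ≤ p₀) (hp₀₁ : p₀ < p₁) (hθ₀ : 0 < θ) (hθ₁ : θ < 1)
    (hp : 1 / p = ENNReal.ofReal (1 - θ) / p₀ + ENNReal.ofReal θ / p₁) :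
    realInterpSpace (coneHTilde m p₀) (coneHTilde m p₁)
        (coneHTildeNorm m p₀) (coneHTildeNorm m p₁) θ p = coneHTilde m p ∧
      ∃ C : ℝ, 0 < C ∧ ∀ f ∈ coneHTilde m p,
        realInterpNorm (coneHTilde m p₀) (coneHTilde m p₁)
            (coneHTildeNorm m p₀) (coneHTildeNorm m p₁) θ p f
          ≤ ENNReal.ofReal C * coneHTildeNorm m p f ∧
        coneHTildeNorm m p f ≤ ENNReal.ofReal C *
          realInterpNorm (coneHTilde m p₀) (coneHTilde m p₁)
            (coneHTildeNorm m p₀) (coneHTildeNorm m p₁) θ p f := by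
  obtain ⟨hp1, hpt, h₁, h₀, hθ⟩ := inv_toReal_of_interp hp₀ hp₀₁ hθ₀ hθ₁ hp
  have hp0 : p ≠ 0 := (zero_lt_one.trans_le hp1).ne'
  have hp₁ : 1 ≤ p₁ := hp₀.trans hp₀₁.le
  obtain ⟨C₁, hC₁, hlow⟩ := exists_eLpNorm_coneSize_le_realInterpNorm (m := m) hp₀ hp₁ hp0 hpt
    (h₁.trans h₀) hθ
  obtain ⟨C₂, hC₂, hup⟩ := exists_realInterpNorm_le (m := m) hp₀ hp₁ hp1 hp₀₁.ne_top hpt h₀ h₁ hθ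
  refine ⟨Subset.antisymm ?_ ?_, (C₂ + 3 * C₁).toReal + 1, by positivity, ?_⟩
  · rintro f ⟨⟨f₀, hf₀, f₁, hf₁, rfl⟩, hfin⟩
    obtain ⟨G₀, hG₀, hfG₀, -⟩ := exists_hasWeakGradient_of_mem_coneHTilde hf₀
    obtain ⟨G₁, hG₁, hfG₁, -⟩ := exists_hasWeakGradient_of_mem_coneHTilde hf₁
    have hG : HasWeakGradient (doubleCone m) ⇑(f₀ + f₁) (G₀ + G₁) :=
      (hfG₀.add (measurableSet_doubleCone m) hfG₁).congr (AEEqFun.coeFn_add f₀ f₁).symm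
        Filter.EventuallyEq.rfl
    exact mem_coneHTilde_of_eLpNorm_coneSize_lt_top (hG₀.add hG₁) hG hp1 hpt
      ((hlow _ _ (hG₀.add hG₁) hG).trans_lt (ENNReal.mul_lt_top hC₁.lt_top hfin))
  · intro f hf
    obtain ⟨G, hG, hfG, h1, h2, h3⟩ := exists_hasWeakGradient_of_mem_coneHTilde hf
    have hs := eLpNorm_coneSize_lt_top f.stronglyMeasurable.measurable hG hp1 h1 h2 h3
    have hfin := (hup f G hG hfG hs.ne).trans_lt (ENNReal.mul_lt_top hC₂.lt_top hs)
    exact ⟨exists_eq_add_of_realInterpNorm_ne_top hp0 hpt hfin.ne, hfin⟩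
  · intro f hf
    obtain ⟨G, hG, hfG, h1, h2, h3⟩ := exists_hasWeakGradient_of_mem_coneHTilde hf
    have hs := eLpNorm_coneSize_lt_top f.stronglyMeasurable.measurable hG hp1 h1 h2 h3
    have hC : C₂ + 3 * C₁ ≤ ENNReal.ofReal ((C₂ + 3 * C₁).toReal + 1) := by
      rw [← ENNReal.ofReal_toReal (ENNReal.add_ne_top.2 ⟨hC₂, ENNReal.mul_ne_top (by simp) hC₁⟩)]
      refine ENNReal.ofReal_le_ofReal ?_
      rw [ENNReal.toReal_ofReal ENNReal.toReal_nonneg]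
      linarith
    constructor
    · refine (hup f G hG hfG hs.ne).trans (mul_le_mul' (le_self_add.trans hC) ?_)
      exact eLpNorm_coneSize_le_coneHTildeNorm hG hfG hp1
    · refine (coneHTildeNorm_le hfG).trans ((mul_le_mul_right (hlow f G hG hfG) 3).trans ?_)
      rw [← mul_assoc]
      exact mul_le_mul_left (le_add_self.trans hC) _
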